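/- **Setting.** Fix $d\ge 1$. Let $S$ be the simplex of probability vectors indexed by the $2d$ unit vectors $e\in\mathbb Z^d$, $|e|=1$, and $\Omega=S^{\mathbb Z^d}$; write $\omega(z,z+e)$ for the coordinates of $\omega(z,\cdot)$. For $\omega\in\Omega$, $P_\omega^z$ is the law of the Markov chain $(X_n)$ on $\mathbb Z^d$ with $X_0=z$ and $P_\omega^z(X_{n+1}=x+e\mid X_n=x)=\omega(x,x+e)$. For a probability measure $P$ on $\Omega$ put $\mathbb P^o=P\otimes P^o_\omega$. Fix $\ell\in\mathbb Z^d\setminus\{0\}$, with $|\cdot|$ the Euclidean norm and $|\ell|_1=\sum_i|\ell_i|$, and for $\zeta\in(0,1)$ let $C(x,\ell,\zeta)=\{y\in\mathbb R^d:(y-x)\cdot\ell\ge\zeta|y-x||\ell|\}$. Put $\mathcal E=\{\mathrm{sgn}(\ell_i)e_i\}_{i\le d}\setminus\{0\}$ and $W=\{0\}\cup\mathcal E$. **Standing assumptions.** * $P$ is stationary and ergodic under the shifts of $\mathbb Z^d$, and there is $\phi$ with $\phi(r)\to0$ as $r\to\infty$ such that for all $r>0$, all $A\in\sigma(\omega_z: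 z\cdot\ell\le 0)$ with $P(A)>0$ and all $B\in\sigma(\omega_z: z\in C(r\ell,\ell,\zeta))$, $\;|P(A\cap B)/P(A)-P(B)|\le\phi(r|\ell|)$. * $P(\omega(0,e)>0\ \forall\,|e|=1)=1$, and for some $\kappa>0$, $P(\min_{e\in\mathcal E}\omega(0,e)\ge\kappa)=1$. * Let $\bar\varepsilon=(\bar\varepsilon_1,\dots,\bar\varepsilon_{|\ell|_1})$ be the sequence consisting of $|\ell_1|$ times $\mathrm{sgn}(\ell_1)e_1$, then $|\ell_2|$ times $\mathrm{sgn}(\ell_2)e_2$, and so on. The number $\zeta\in(0,1)$ is small enough that all partial sums $\bar\varepsilon_1+\dots+\bar\varepsilon_m$, $1\le m\le|\ell|_1$, lie in $C(0,\ell,\zeta)$ and that the mixing assumption above holds with this $\zeta$. **Extended space.** Let $Q$ be the product law on $W^{\mathbb N}$ of letters $\varepsilon_0,\varepsilon_1,\dots$ with $Q(\varepsilon_n=e)=\kappa$ for $e\in\mathcal E$ and $Q(\varepsilon_n=0)=1-\kappa|\mathcal E|$. Given $\omega$ and $\varepsilon$, $\overline P^o_{\omega,\varepsilon}$ is the law of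 the chain with $X_0=0$ and $$\overline P^o_{\omega,\varepsilon}(X_{n+1}=z+e\mid X_n=z)=\mathbf 1_{\{\varepsilon_n=e\}}+\frac{\mathbf 1_{\{\varepsilon_n=0\}}}{1-\kappa|\mathcal E|}\bigl[\omega(z,z+e)-\kappa\mathbf 1_{\{e\in\mathcal E\}}\bigr],$$ and $\overline{\mathbb P}^o=P\otimes Q\otimes\overline P^o_{\omega,\varepsilon}$ on $\Omega\times W^{\mathbb N}\times(\mathbb Z^d)^{\mathbb N}$, with expectation $\overline{\mathbb E}^o$. **Regeneration times.** Let $D'=\inf\{n\ge0:X_n\notin C(X_0,\ell,\zeta)\}$. For $L\in|\ell|_1\mathbb N^*$ let $\bar\varepsilon^{(L)}$ be the $L/|\ell|_1$-fold repetition of $\bar\varepsilon$. Put $\overline R_0=0$ and, for $k\ge0$, $$\overline S_{k+1}=\inf\Bigl\{n\ge\max(L,\overline R_k):\ X_{n-L}\cdot\ell>\max_{m<n-L}X_m\cdot\ell,\ (\varepsilon_{n-L},\dots,\varepsilon_{n-1})=\bar\varepsilon^{(L)}\Bigr\},\qquad \overline R_{k+1}=\overline S_{k+1}+D'\circ\theta_{\overline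 S_{k+1}},$$ where $\theta$ is the time shift, $\inf\emptyset=\infty$ and $\max\emptyset=-\infty$. Let $K=\inf\{k\ge1:\overline S_k<\infty,\ \overline R_k=\infty\}$ and $\tau_1^{(L)}=\overline S_K$ ($=\infty$ if $K=\infty$). Inductively, $\tau^{(L)}_{k+1}$ is $\tau^{(L)}_k$ plus the time $\tau_1^{(L)}$ computed from the letters $\varepsilon_{\tau_k^{(L)}+\cdot}$ and the path $X_{\tau_k^{(L)}+\cdot}-X_{\tau_k^{(L)}}$. Let $\mathcal H_k=\mathcal H_k^{(L)}$ be the $\sigma$-algebra generated by $\tau_1^{(L)},\dots,\tau_k^{(L)}$, $X_0,\varepsilon_0,X_1,\dots,\varepsilon_{\tau_k^{(L)}-1},X_{\tau_k^{(L)}}$ and $\{\omega(y,\cdot):\ell\cdot y<\ell\cdot X_{\tau_k^{(L)}}-L|\ell|^2/|\ell|_1\}$, and $\mathcal F_0^L=\sigma(\omega(y,\cdot):\ell\cdot y<-L)$. For $\phi(L)<\overline{\mathbb P}^o(D'=\infty)$ set $\phi'(L)=2\,[\overline{\mathbb P}^o(D'=\infty)-\phi(L)]^{-1}\phi(L)$.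 **Theorem.** Under the standing assumptions, suppose that the following two conditions hold. 1. (Approximate renewal.) For all sufficiently large $L\in|\ell|_1\mathbb N^*$: $\phi(L)<\overline{\mathbb P}^o(D'=\infty)$, and for every $k\ge1$, $\tau_k^{(L)}<\infty$ $\overline{\mathbb P}^o$-a.s. and, a.s., $$\Bigl\|\overline{\mathbb P}^o\bigl(\{X_{\tau_k^{(L)}+n}-X_{\tau_k^{(L)}}\}_{n\ge0}\in\cdot\mid\mathcal H_k\bigr)-\overline{\mathbb P}^o\bigl(\{X_n\}_{n\ge0}\in\cdot\mid D'=\infty\bigr)\Bigr\|_{\rm var}\le\phi'(L),$$ where $\|\mu-\nu\|_{\rm var}=\sup_A(\mu(A)-\nu(A))$. 2. (Integrability.) There are $\alpha>1$ and $M=M(L)$ with $\phi'(L)^{1/\alpha'}M(L)^{1/\alpha}\to0$ as $L\to\infty$ in $|\ell|_1\mathbb N^*$, where $1/\alpha'=1-1/\alpha$, such that for all sufficiently large $L\in|\ell|_1\mathbb N^*$, almost surely, $$\overline{\mathbb E}^o\bigl((\kappa^L\tau_1^{(L)})^\alpha\mid D'=\infty,\ \mathcal F_0^L\bigr)\le M(L).$$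 Then there is a deterministic $v\in\mathbb R^d$ with $v\cdot\ell>0$ such that $\lim_{n\to\infty}X_n/n=v$, $\mathbb P^o$-a.s. -/

import Mathlib

open MeasureTheory ProbabilityTheory Filter Topology
open scoped ENNReal

namespace RWRE

noncomputable section

/-! ### The lattice, the directions, the environments -/

/-- The lattice `ℤ^d`. -/
abbrev Site (d : ℕ) : Type := Fin d → ℤ

/-- The `2d` lattice vectors of norm one. -/
def unitVectors (d : ℕ) : Finset (Site d) :=
  Finset.univ.image (fun i : Fin d => Pi.single i (1 : ℤ)) ∪
    Finset.univ.image (fun i : Fin d => Pi.single i (-1 : ℤ))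

/-- The index set of the nearest neighbour steps. -/
abbrev Dir (d : ℕ) : Type := ↥(unitVectors d)

/-- An environment attaches to every site a probability vector on the `2d` directions;
`ω x e` is the probability `ω(x, x + e)` of a jump from `x` to `x + e`. -/
abbrev Env (d : ℕ) : Type := Site d → stdSimplex ℝ (Dir d)

instance instStandardBorelSimplex (d : ℕ) : StandardBorelSpace (stdSimplex ℝ (Dir d)) :=
  (isClosed_stdSimplex ℝ (Dir d)).measurableSet.standardBorel

/-- A lattice point as a point of Euclidean space. -/
def toReal {d : ℕ} (x : Site d) : EuclideanSpace ℝ (Fin d) :=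
  WithLp.toLp 2 (fun i => (x i : ℝ))

/-- `|ℓ|₁ = ∑ᵢ |ℓᵢ|`. -/
def normOne {d : ℕ} (l : Site d) : ℕ := ∑ i, (l i).natAbs

/-- The cone `C(x, ℓ, ζ) = {y : (y - x)·ℓ ≥ ζ |y - x| |ℓ|}`, Euclidean norms. -/
def cone {d : ℕ} (x l : EuclideanSpace ℝ (Fin d)) (ζ : ℝ) : Set (EuclideanSpace ℝ (Fin d)) :=
  {y | ζ * ‖y - x‖ * ‖l‖ ≤ inner ℝ (y - x) l}

/-- The space shift of environments. -/
def shift {d : ℕ} (x : Site d) (ω : Env d) : Env d := fun y => ω (x + y)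

/-- The `σ`-algebra `σ(ω(z, ·) : z ∈ A)`. -/
abbrev envSigma {d : ℕ} (A : Set (Site d)) : MeasurableSpace (Env d) :=
  ⨆ z ∈ A, MeasurableSpace.comap (fun ω : Env d => ω z) inferInstance

/-! ### Nearest neighbour chains with frozen environment

`E` is the space of the frozen variables (environment, possibly with extra randomness). -/

section Chain

variable {d : ℕ} {E : Type*} [MeasurableSpace E]

/-- One step of the walk: from `x`, with frozen variables `s`, jump to `x + e` with probability
`w (s, x) e`.  Where `w (s, x)` is not a probability vector the walk stays put. -/
def stepKernel (w : E × Site d → Dir d → ℝ) (hw : Measurable w) :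
    Kernel (E × Site d) (Site d) := by
  classical
  exact
  { toFun := fun s =>
      if (∀ e, 0 ≤ w s e) ∧ ∑ e, w s e = 1 then
        ∑ e : Dir d, ENNReal.ofReal (w s e) • Measure.dirac (s.2 + (e : Site d))
      else Measure.dirac s.2
    measurable' := by
      have hwe : ∀ e, Measurable fun s => w s e := fun e => (measurable_pi_apply e).comp hw
      refine Measurable.ite ?_ ?_ ?_
      · refine MeasurableSet.inter ?_ ?_
        · have : {s | ∀ e, 0 ≤ w s e} = ⋂ e, {s | 0 ≤ w s e} := by ext; simp
          change MeasurableSet {s | ∀ e, 0 ≤ w s e}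
          rw [this]
          exact MeasurableSet.iInter fun e => measurableSet_le measurable_const (hwe e)
        · exact measurableSet_eq_fun (Finset.measurable_sum _ fun e _ => hwe e) measurable_const
      · refine Measure.measurable_of_measurable_coe _ fun A hA => ?_
        simp only [Measure.finsetSum_apply, Measure.smul_apply, smul_eq_mul]
        refine Finset.measurable_sum _ fun e _ => ?_
        refine ((hwe e).ennreal_ofReal).mul ?_
        exact (Measure.measurable_coe hA).comp
          (Measure.measurable_dirac.comp
            ((measurable_of_countable (fun x : Site d => x + (e : Site d))).comp measurable_snd))
      · exact Measure.measurable_dirac.comp measurable_snd }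

instance instMarkovStep (w : E × Site d → Dir d → ℝ) (hw : Measurable w) :
    IsMarkovKernel (stepKernel w hw) := by
  classical
  refine ⟨fun s => ⟨?_⟩⟩
  change (if (∀ e, 0 ≤ w s e) ∧ ∑ e, w s e = 1 then
        ∑ e : Dir d, ENNReal.ofReal (w s e) • Measure.dirac (s.2 + (e : Site d))
      else Measure.dirac s.2) Set.univ = 1
  split_ifs with h
  · simp only [Measure.finsetSum_apply, Measure.smul_apply, smul_eq_mul, measure_univ, mul_one]
    rw [← ENNReal.ofReal_sum_of_nonneg fun e _ => h.1 e, h.2, ENNReal.ofReal_one]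
  · simp

/-- The law on path space of the (time-inhomogeneous) Markov chain on `ℤ^d` started at `x` whose
step from time `n` to time `n + 1` has the probabilities `w n (s, ·)`, as a kernel in the frozen
variables `s` and the starting point `x`.  (The pair (frozen variables, position) is run by the
Ionescu-Tulcea construction, with the first component kept constant.) -/
def chainLaw (w : ℕ → E × Site d → Dir d → ℝ) (hw : ∀ n, Measurable (w n)) :
    Kernel (E × Site d) (ℕ → Site d) :=
  ((Kernel.traj (X := fun _ => E × Site d)
      (fun n => ((Kernel.deterministic Prod.fst measurable_fst) ×ₖ
          (stepKernel (w n) (hw n))).comap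
        (fun h : (Π _ : Finset.Iic n, E × Site d) => h ⟨n, by simp⟩)
        (measurable_pi_apply _)) 0).comap
    (fun s _ => s) (measurable_pi_lambda _ fun _ => measurable_id)).map
    (fun t n => (t n).2)

instance instMarkovChain (w : ℕ → E × Site d → Dir d → ℝ) (hw : ∀ n, Measurable (w n)) :
    IsMarkovKernel (chainLaw w hw) := by
  unfold chainLaw
  exact Kernel.IsMarkovKernel.map _
    (measurable_pi_lambda _ fun n => measurable_snd.comp (measurable_pi_apply n))

end Chain

/-! ### The random walk in random environment -/

lemma measurable_env {d : ℕ} :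
    Measurable fun s : Env d × Site d => fun e : Dir d => s.1 s.2 e := by
  refine measurable_from_prod_countable_left fun x => ?_
  exact measurable_subtype_coe.comp (measurable_pi_apply x)

/-- The quenched laws `P_ω^x`. -/
def quenched (d : ℕ) : Kernel (Env d × Site d) (ℕ → Site d) :=
  chainLaw (fun _ s e => s.1 s.2 e) (fun _ => measurable_env)

/-- The law `ℙ^o = P ⊗ P_ω^o` of the environment and the walk started at the origin. -/
def annealed {d : ℕ} (P : Measure (Env d)) : Measure (Env d × (ℕ → Site d)) :=
  P ⊗ₘ ((quenched d).comap (fun ω => (ω, 0)) (measurable_id.prodMk measurable_const))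

/-! ### The extended probability space -/

/-- `𝓔 = {sgn(ℓᵢ) eᵢ} \ {0}`. -/
def calE {d : ℕ} (l : Site d) : Finset (Site d) :=
  (Finset.univ.image fun i : Fin d => Pi.single i (l i).sign).erase 0

/-- `W = {0} ∪ 𝓔`. -/
abbrev Letter {d : ℕ} (l : Site d) : Type := ↥(insert 0 (calE l))

/-- The law of one letter: `κ` for each element of `𝓔`, and `1 - κ |𝓔|` for `0`.
(If these numbers are not probabilities, a point mass; this is excluded by ellipticity.) -/
def letterLaw {d : ℕ} (l : Site d) (κ : ℝ) : Measure (Letter l) := by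
  classical
  exact if 0 ≤ κ ∧ κ * (calE l).card ≤ 1 then
      ∑ a : Letter l, ENNReal.ofReal (if (a : Site d) = 0 then 1 - κ * (calE l).card else κ) •
        Measure.dirac a
    else Measure.dirac ⟨0, Finset.mem_insert_self _ _⟩

instance instProbLetter {d : ℕ} (l : Site d) (κ : ℝ) : IsProbabilityMeasure (letterLaw l κ) := by
  classical
  refine ⟨?_⟩
  unfold letterLaw
  split_ifs with h
  · simp only [Measure.finsetSum_apply, Measure.smul_apply, smul_eq_mul, measure_univ, mul_one]
    rw [← ENNReal.ofReal_sum_of_nonneg]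
    · have h0 : (0 : Site d) ∉ calE l := by simp [calE]
      rw [Finset.sum_coe_sort (insert 0 (calE l))
        (fun a : Site d => if a = 0 then 1 - κ * ((calE l).card : ℝ) else κ),
        Finset.sum_insert h0]
      have : ∑ x ∈ calE l, (if x = 0 then 1 - κ * ((calE l).card : ℝ) else κ)
          = ∑ x ∈ calE l, κ := by
        refine Finset.sum_congr rfl fun x hx => ?_
        rw [if_neg]
        rintro rfl
        exact h0 hx
      rw [this]
      simp [mul_comm]
    · intro a _
      split_ifs
      · linarith [h.2]
      · exact h.1
  · simp

/-- The product law `Q` of the letters.  Letters are numbered from `0`: the letter `ε n` drives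
the step of the walk from time `n` to time `n + 1`. -/
def letterProd {d : ℕ} (l : Site d) (κ : ℝ) : Measure (ℕ → Letter l) :=
  Measure.infinitePi fun _ : ℕ => letterLaw l κ

instance instProbLetterProd {d : ℕ} (l : Site d) (κ : ℝ) :
    IsProbabilityMeasure (letterProd l κ) := by
  unfold letterProd; infer_instance

open scoped Classical in
/-- Transition probabilities given environment and letters:
`1{ε = e} + 1{ε = 0} (1 - κ|𝓔|)⁻¹ (ω(x, x+e) - κ 1{e ∈ 𝓔})`, with `ε = ε n`. -/
def extWeight {d : ℕ} (l : Site d) (κ : ℝ) (n : ℕ)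
    (s : (Env d × (ℕ → Letter l)) × Site d) (e : Dir d) : ℝ :=
  (if (s.1.2 n : Site d) = e then 1 else 0) +
    (if (s.1.2 n : Site d) = 0 then 1 else 0) / (1 - κ * (calE l).card) *
      (s.1.1 s.2 e - κ * (if (e : Site d) ∈ calE l then 1 else 0))

lemma measurable_extWeight {d : ℕ} (l : Site d) (κ : ℝ) (n : ℕ) :
    Measurable (extWeight l κ n) := by
  classical
  refine measurable_pi_lambda _ fun e => ?_
  have h1 : Measurable fun s : (Env d × (ℕ → Letter l)) × Site d => s.1.2 n :=
    (measurable_pi_apply n).comp (measurable_snd.comp measurable_fst)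
  have h2 : Measurable fun s : (Env d × (ℕ → Letter l)) × Site d => (s.1.1 s.2 e : ℝ) :=
    ((measurable_pi_apply e).comp measurable_env).comp
      ((measurable_fst.comp measurable_fst).prodMk measurable_snd)
  have h3 : Measurable fun s : (Env d × (ℕ → Letter l)) × Site d =>
      (if (s.1.2 n : Site d) = e then (1 : ℝ) else 0) :=
    (measurable_of_countable
      (fun a : Letter l => if (a : Site d) = e then (1 : ℝ) else 0)).comp h1
  have h4 : Measurable fun s : (Env d × (ℕ → Letter l)) × Site d =>
      (if (s.1.2 n : Site d) = 0 then (1 : ℝ) else 0) :=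
    (measurable_of_countable
      (fun a : Letter l => if (a : Site d) = 0 then (1 : ℝ) else 0)).comp h1
  exact h3.add ((h4.div_const _).mul (h2.sub_const _))

/-- The laws `P̄_{ω,ε}^x`. -/
def extQuenched {d : ℕ} (l : Site d) (κ : ℝ) :
    Kernel ((Env d × (ℕ → Letter l)) × Site d) (ℕ → Site d) :=
  chainLaw (extWeight l κ) (measurable_extWeight l κ)

instance instMarkovExtQuenched {d : ℕ} (l : Site d) (κ : ℝ) :
    IsMarkovKernel (extQuenched l κ) := by
  unfold extQuenched; infer_instance

/-- Environment, letters, path. -/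
abbrev Space {d : ℕ} (l : Site d) : Type := (Env d × (ℕ → Letter l)) × (ℕ → Site d)

/-- The measure `ℙ̄^o = P ⊗ Q ⊗ P̄_{ω,ε}^o`. -/
def extAnnealed {d : ℕ} (P : Measure (Env d)) (l : Site d) (κ : ℝ) : Measure (Space l) :=
  (P.prod (letterProd l κ)) ⊗ₘ
    ((extQuenched l κ).comap (fun s => (s, 0)) (measurable_id.prodMk measurable_const))

instance instProbExtAnnealed {d : ℕ} (P : Measure (Env d)) [IsProbabilityMeasure P]
    (l : Site d) (κ : ℝ) : IsProbabilityMeasure (extAnnealed P l κ) := by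
  unfold extAnnealed; infer_instance

/-! ### The approximate regeneration times -/

/-- The sequence `ε̄` of length `|ℓ|₁`: `|ℓ₁|` times `sgn(ℓ₁) e₁`, then `|ℓ₂|` times
`sgn(ℓ₂) e₂`, and so on. -/
def epsBarList {d : ℕ} (l : Site d) : List (Site d) :=
  (List.ofFn fun i : Fin d => List.replicate (l i).natAbs (Pi.single i (l i).sign)).flatten

/-- The `i`-th letter (from `0`) of the periodic repetition of `ε̄`; the first `L` of them form
`ε̄^(L)`. -/
def epsBar {d : ℕ} (l : Site d) (i : ℕ) : Site d :=
  (epsBarList l).getD (i % normOne l) 0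

/-- All partial sums of `ε̄` lie in `C(0, ℓ, ζ)`. -/
def StaysInCone {d : ℕ} (l : Site d) (ζ : ℝ) : Prop :=
  ∀ m ∈ Finset.Icc 1 (normOne l),
    toReal (∑ i ∈ Finset.range m, epsBar l i) ∈ cone 0 (toReal l) ζ

/-- The first time with property `p`, `∞` if there is none. -/
def firstTime (p : ℕ → Prop) : ℕ∞ := ⨅ (n : ℕ) (_ : p n), (n : ℕ∞)

/-- `D' = inf {n ≥ 0 : X_n ∉ C(X_0, ℓ, ζ)}`. -/
def exitCone {d : ℕ} (l : Site d) (ζ : ℝ) (X : ℕ → Site d) : ℕ∞ :=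
  firstTime fun n => toReal (X n) ∉ cone (toReal (X 0)) (toReal l) ζ

/-- At time `n` the last `L` letters were `ε̄^(L)`, and at time `n - L` the walk was at a strict
record in direction `ℓ`. -/
def IsCandidate {d : ℕ} (l : Site d) (L : ℕ) (ε : ℕ → Letter l) (X : ℕ → Site d) (n : ℕ) : Prop :=
  L ≤ n ∧ (∀ m < n - L, X m ⬝ᵥ l < X (n - L) ⬝ᵥ l) ∧
    ∀ i < L, (ε (n - L + i) : Site d) = epsBar l i

/-- The pair `(S̄_k, R̄_k)`, with `S̄_0 = R̄_0 = 0`. -/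
def SR {d : ℕ} (l : Site d) (ζ : ℝ) (L : ℕ) (ε : ℕ → Letter l) (X : ℕ → Site d) :
    ℕ → ℕ∞ × ℕ∞
  | 0 => (0, 0)
  | k + 1 =>
    let S : ℕ∞ := firstTime fun n => (SR l ζ L ε X k).2 ≤ n ∧ IsCandidate l L ε X n
    (S, exitCone l ζ (fun m => X (S.toNat + m)) + S)

/-- `τ_1^(L) = S̄_K` with `K = inf {k ≥ 1 : S̄_k < ∞, R̄_k = ∞}`. -/
def tauOne {d : ℕ} (l : Site d) (ζ : ℝ) (L : ℕ) (ε : ℕ → Letter l) (X : ℕ → Site d) : ℕ∞ :=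
  let K : ℕ∞ := firstTime fun k =>
    1 ≤ k ∧ (SR l ζ L ε X k).1 < ⊤ ∧ (SR l ζ L ε X k).2 = ⊤
  if K = ⊤ then ⊤ else (SR l ζ L ε X K.toNat).1

/-- `τ_0^(L) = 0` and `τ_{k+1}^(L) = τ_k^(L) + τ_1^(L)(X_{τ_k + ·} - X_{τ_k})`, where the letters
are shifted along. -/
def tau {d : ℕ} (l : Site d) (ζ : ℝ) (L : ℕ) : ℕ → Space l → ℕ∞
  | 0, _ => 0
  | k + 1, p =>
    let T : ℕ∞ := tau l ζ L k p
    T + tauOne l ζ L (fun n => p.1.2 (T.toNat + n)) (fun n => p.2 (T.toNat + n) - p.2 T.toNat)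

/-- The event `{D' = ∞}`. -/
def neverExits {d : ℕ} (l : Site d) (ζ : ℝ) : Set (Space l) := {p | exitCone l ζ p.2 = ⊤}

open scoped Classical in
/-- The `σ`-algebra `𝓗_k` generated by `τ_1, …, τ_k`, by the path up to time `τ_k`, by the letters
that drive its steps, and by the `ω(y, ·)` with `ℓ·y < ℓ·X_{τ_k} - L|ℓ|²/|ℓ|₁`. -/
abbrev calH {d : ℕ} (l : Site d) (ζ : ℝ) (L k : ℕ) : MeasurableSpace (Space l) :=
  (⨆ i ∈ Finset.Icc 1 k, MeasurableSpace.comap (tau l ζ L i) inferInstance) ⊔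
  (⨆ n : ℕ, MeasurableSpace.comap
    (fun p : Space l => p.2 (min (n : ℕ∞) (tau l ζ L k p)).toNat) inferInstance) ⊔
  (⨆ n : ℕ, MeasurableSpace.comap
    (fun p : Space l => if (n : ℕ∞) < tau l ζ L k p then (p.1.2 n : Site d) else 0)
    inferInstance) ⊔
  (⨆ y : Site d, MeasurableSpace.comap
    (fun p : Space l =>
      if ((y ⬝ᵥ l : ℤ) : ℝ) < ((p.2 (tau l ζ L k p).toNat ⬝ᵥ l : ℤ) : ℝ)
          - (L : ℝ) * ‖toReal l‖ ^ 2 / (normOne l : ℝ)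
      then fun e : Dir d => p.1.1 y e else 0) inferInstance)

/-- `𝓕_0^L = σ(ω(y, ·) : ℓ·y < -L)`, on the extended space. -/
abbrev calF {d : ℕ} (l : Site d) (L : ℕ) : MeasurableSpace (Space l) :=
  (envSigma {y : Site d | y ⬝ᵥ l < -(L : ℤ)}).comap fun p => p.1.1

/-! ### The assumptions -/

/-- `P` is stationary and ergodic with respect to the shifts of `ℤ^d`. -/
def StationaryErgodic {d : ℕ} (P : Measure (Env d)) : Prop :=
  (∀ x : Site d, MeasurePreserving (shift x) P P) ∧
    ∀ A : Set (Env d), MeasurableSet A → (∀ x : Site d, shift x ⁻¹' A = A) → P A = 0 ∨ P A = 1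

/-- Mixing on `ℓ`-cones of parameter `ζ`, with rate function `φ`. -/
def ConeMixing {d : ℕ} (P : Measure (Env d)) (l : Site d) (ζ : ℝ) (φ : ℝ → ℝ) : Prop :=
  Tendsto φ atTop (𝓝 0) ∧
    ∀ r : ℝ, 0 < r → ∀ A B : Set (Env d), 0 < P A →
      MeasurableSet[envSigma {z : Site d | z ⬝ᵥ l ≤ 0}] A →
      MeasurableSet[envSigma {z : Site d | toReal z ∈ cone (r • toReal l) (toReal l) ζ}] B →
      |P.real (A ∩ B) / P.real A - P.real B| ≤ φ (r * ‖toReal l‖)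

/-- `P` is elliptic, and uniformly elliptic with respect to `ℓ` with constant `κ`. -/
def Elliptic {d : ℕ} (P : Measure (Env d)) (l : Site d) (κ : ℝ) : Prop :=
  (∀ᵐ ω ∂P, ∀ e : Dir d, 0 < ω 0 e) ∧
    ∀ᵐ ω ∂P, ∀ e : Dir d, (e : Site d) ∈ calE l → κ ≤ ω 0 e

/-- The variational distance `sup {μ(A) - ν(A) : A measurable}` of two probability measures. -/
def varDist {Ω : Type*} [MeasurableSpace Ω] (μ ν : Measure Ω) : ℝ :=
  ⨆ A : {A : Set Ω // MeasurableSet A}, (μ.real A - ν.real A)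

/-- `φ'(L) = 2 [ℙ̄^o(D' = ∞) - φ(L)]⁻¹ φ(L)`. -/
def phiPrime {d : ℕ} (P : Measure (Env d)) (l : Site d) (κ ζ : ℝ) (φ : ℝ → ℝ) (L : ℕ) : ℝ :=
  2 * ((extAnnealed P l κ).real (neverExits l ζ) - φ L)⁻¹ * φ L

/-- The approximate renewal property: for all large `L ∈ |ℓ|₁ ℕ`, `φ(L) < ℙ̄^o(D' = ∞)`, all the
times `τ_k^(L)` are a.s. finite, and a.s. the conditional law of the walk after time `τ_k^(L)`
given `𝓗_k` is within `φ'(L)`, in variational distance, of the law of the walk given `D' = ∞`. -/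
def ApproxRenewal {d : ℕ} (P : Measure (Env d)) [IsProbabilityMeasure P] (l : Site d) (κ ζ : ℝ)
    (φ : ℝ → ℝ) : Prop :=
  ∀ᶠ j : ℕ in atTop, ∀ L : ℕ, L = j * normOne l →
    φ L < (extAnnealed P l κ).real (neverExits l ζ) ∧
    ∀ k : ℕ, 1 ≤ k →
      (∀ᵐ p ∂(extAnnealed P l κ), tau l ζ L k p < ⊤) ∧
      ∀ᵐ p ∂(extAnnealed P l κ),
        varDist
          ((condExpKernel (extAnnealed P l κ) (calH l ζ L k) p).map
            fun q : Space l => fun n : ℕ =>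
              q.2 ((tau l ζ L k q).toNat + n) - q.2 (tau l ζ L k q).toNat)
          ((ProbabilityTheory.cond (extAnnealed P l κ) (neverExits l ζ)).map
            fun q : Space l => q.2)
        ≤ phiPrime P l κ ζ φ L

/-- The integrability condition: for some `α > 1` and `M = M(L)` with
`φ'(L)^{1/α'} M(L)^{1/α} → 0`, where `1/α' = 1 - 1/α`, for all large `L ∈ |ℓ|₁ ℕ` almost surely
`Ē^o((κ^L τ_1^(L))^α | D' = ∞, 𝓕_0^L) ≤ M(L)`. -/
def MomentCondition {d : ℕ} (P : Measure (Env d)) (l : Site d) (κ ζ : ℝ) (φ : ℝ → ℝ) : Prop :=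
  ∃ (α : ℝ) (M : ℕ → ℝ), 1 < α ∧
    Tendsto (fun j : ℕ => phiPrime P l κ ζ φ (j * normOne l) ^ (1 - 1 / α) *
      M (j * normOne l) ^ (1 / α)) atTop (𝓝 0) ∧
    ∀ᶠ j : ℕ in atTop, ∀ L : ℕ, L = j * normOne l →
      ∀ᵐ p ∂(ProbabilityTheory.cond (extAnnealed P l κ) (neverExits l ζ)),
        condLExp (calF l L) (ProbabilityTheory.cond (extAnnealed P l κ) (neverExits l ζ))
          (fun q => (ENNReal.ofReal κ ^ L * (tau l ζ L 1 q : ℝ≥0∞)) ^ α) p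
        ≤ ENNReal.ofReal (M L)

end

end RWRE

/-!
The walk is cut at the regeneration times `τ_k`.  The pieces are only approximately independent,
but the approximation becomes exact as `L → ∞`, and it is enough to find, for each coordinate of the
walk and each `ε`, a constant that the empirical speed approaches up to `ε`
(`exists_tendsto_of_approx`).

Fix `L` and a window length `N`, and write `ξ_k = τ_{k+1} - τ_k`.  Instead of comparing the pieces
between regenerations with independent ones, their displacements are smoothed: `N` times the
displacement up to `τ_K` is, up to a bounded error, the sum over `t < τ_K` of the window increments
`x_{t+N} - x_t`, and for `t` in `[τ_k, τ_{k+1})` the window increment differs from that at `τ_{k+1}`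
by at most `2 ξ_k` and at most `2 N` (`abs_smoothing_le`).  So the displacement is close to
`N⁻¹ ∑ ξ_k (x_{τ_{k+1}+N} - x_{τ_{k+1}})`, where the weight `ξ_k` is known at time `τ_{k+1}` while
the second factor is a bounded function of the path after `τ_{k+1}`.  By approximate renewal its
conditional mean is `N c_N` up to `2 N φ'(L)`, where `c_N` (`windowSpeed`) is a constant.

Truncate the weights at a level `B`.  The bounded summands obey a strong law, proved by
orthogonality of martingale increments (`ae_tendsto_sum_sub_condExp_lag`).  The weights above `B`
have a sum of order `M B^(1-α) K`, by a strong law for adapted sequences with conditional moments of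
an order `α > 1` (`ae_sum_tail_le`).  Together, `limsup |x_n / n - c_N|` is at most a constant times
`φ'(L) + B / N + M B^(1-α)` (`ae_eventually_abs_sub_le`), which is small for suitable `L`, then `B`,
then `N`.  Only `φ'(L) → 0` and the finiteness of `M(L)` enter, not the rate at which `M(L)` grows.

The conditional moment bound at later times, given the history, comes from the bound at `τ_1` given
`D' = ∞` and the environment behind the origin (`setLIntegral_atom_le`): given the history up to
`n`, the event `τ_k = n` means that the walk never leaves the cone at its position at time `n`
(`walkTau_agree`), and the probability of the history is a function of the environment at sites `y`
with `y·ℓ < X_n·ℓ - L`, since the last `L` steps were dictated by the letters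
(`measurable_cylWeight`).

Finally `X_{τ_k}·ℓ` increases by at least one at each regeneration, and `τ_k` grows at most linearly
(`ae_eventually_le_mul`), so `v·ℓ > 0`.
-/

namespace RWRE

noncomputable section

/-! ### Cylinder probabilities of the quenched chains -/

section ChainCylinder

variable {d : ℕ} {E : Type*} [MeasurableSpace E]

/-- The transition kernel of the pair (frozen variables, position) that underlies `chainLaw`. -/
def pairStep (w : ℕ → E × Site d → Dir d → ℝ) (hw : ∀ n, Measurable (w n)) (n : ℕ) :
    Kernel (Π _ : Finset.Iic n, E × Site d) (E × Site d) :=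
  ((Kernel.deterministic Prod.fst measurable_fst) ×ₖ (stepKernel (w n) (hw n))).comap
    (fun h : (Π _ : Finset.Iic n, E × Site d) => h ⟨n, by simp⟩) (measurable_pi_apply _)

instance instMarkovPairStep (w : ℕ → E × Site d → Dir d → ℝ) (hw : ∀ n, Measurable (w n))
    (n : ℕ) : IsMarkovKernel (pairStep w hw n) := by
  unfold pairStep; infer_instance

lemma pairStep_apply_prod (w : ℕ → E × Site d → Dir d → ℝ) (hw : ∀ n, Measurable (w n)) (n : ℕ)
    (h : Π _ : Finset.Iic n, E × Site d) {A : Set E} (hA : MeasurableSet A) (B : Set (Site d)) :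
    pairStep w hw n h (A ×ˢ B) =
      A.indicator 1 (h ⟨n, by simp⟩).1 * stepKernel (w n) (hw n) (h ⟨n, by simp⟩) B := by
  rw [pairStep, Kernel.comap_apply, Kernel.prod_apply, Measure.prod_prod,
    Kernel.deterministic_apply, Measure.dirac_apply' _ hA]

/-- The law of the pair (frozen variables, position), on trajectories. -/
def pairLaw (w : ℕ → E × Site d → Dir d → ℝ) (hw : ∀ n, Measurable (w n)) (s : E) (x : Site d) :
    Measure (ℕ → E × Site d) :=
  Kernel.traj (X := fun _ => E × Site d) (pairStep w hw) 0 (fun _ => (s, x))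

instance (w : ℕ → E × Site d → Dir d → ℝ) (hw : ∀ n, Measurable (w n)) (s : E) (x : Site d) :
    IsProbabilityMeasure (pairLaw w hw s x) := by
  unfold pairLaw; infer_instance

lemma measurable_snd_traj : Measurable (fun (t : ℕ → E × Site d) n => (t n).2) :=
  measurable_pi_lambda _ fun n => measurable_snd.comp (measurable_pi_apply n)

lemma chainLaw_eq_map (w : ℕ → E × Site d → Dir d → ℝ) (hw : ∀ n, Measurable (w n)) (s : E)
    (x : Site d) :
    chainLaw w hw (s, x) = (pairLaw w hw s x).map (fun t n => (t n).2) := by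
  unfold chainLaw
  rw [Kernel.map_apply _ measurable_snd_traj]
  rfl

lemma pairLaw_zero (w : ℕ → E × Site d → Dir d → ℝ) (hw : ∀ n, Measurable (w n)) (s : E)
    (x : Site d) {A : Set (E × Site d)} (hA : MeasurableSet A) :
    pairLaw w hw s x {t | t 0 ∈ A} = A.indicator 1 (s, x) := by
  have h := Kernel.traj_map_frestrictLe_apply (X := fun _ => E × Site d) (κ := pairStep w hw) 0 0
    (fun _ => (s, x))
  rw [Kernel.partialTraj_self, Kernel.id_apply] at h
  have hm : MeasurableSet {h : Π _ : Finset.Iic 0, E × Site d | h ⟨0, by simp⟩ ∈ A} :=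
    measurable_pi_apply (X := fun _ : Finset.Iic 0 => E × Site d) ⟨0, by simp⟩ hA
  have h2 := congrArg (fun μ => μ {h : Π _ : Finset.Iic 0, E × Site d | h ⟨0, by simp⟩ ∈ A}) h
  beta_reduce at h2
  rw [Measure.map_apply (by fun_prop) hm, Measure.dirac_apply' _ hm] at h2
  exact h2

/-- One more step, on an event of the past on which the step probability does not depend on the
past. -/
lemma pairLaw_succ (w : ℕ → E × Site d → Dir d → ℝ) (hw : ∀ n, Measurable (w n)) (s : E)
    (x : Site d) (n : ℕ) {A : Set (Π _ : Finset.Iic n, E × Site d)} (hA : MeasurableSet A)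
    {B : Set (E × Site d)} (hB : MeasurableSet B) (c : ℝ≥0∞)
    (hc : ∀ h ∈ A, pairStep w hw n h B = c) :
    pairLaw w hw s x {t | Preorder.frestrictLe n t ∈ A ∧ t (n + 1) ∈ B} =
      pairLaw w hw s x {t | Preorder.frestrictLe n t ∈ A} * c := by
  have h := Kernel.partialTraj_compProd_eq_map_traj (X := fun _ => E × Site d)
    (κ := pairStep w hw) (Nat.zero_le n) (x₀ := fun _ => (s, x))
  have h2 := congrArg (fun μ => μ (A ×ˢ B)) h
  beta_reduce at h2
  rw [Measure.compProd_apply_prod hA hB, Measure.map_apply (by fun_prop) (hA.prod hB),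
    setLIntegral_congr_fun hA hc, setLIntegral_const,
    ← Kernel.traj_map_frestrictLe_apply, Measure.map_apply (by fun_prop) hA, mul_comm] at h2
  exact h2.symm

variable [MeasurableSingletonClass E]

/-- The frozen variables stay frozen. -/
lemma pairLaw_ae_fst (w : ℕ → E × Site d → Dir d → ℝ) (hw : ∀ n, Measurable (w n)) (s : E)
    (x : Site d) : ∀ᵐ t ∂(pairLaw w hw s x), ∀ n, (t n).1 = s := by
  rw [ae_all_iff]
  intro n
  have hm : ∀ n, MeasurableSet {t : ℕ → E × Site d | (t n).1 = s} := fun n =>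
    (measurable_fst.comp (measurable_pi_apply n)) (measurableSet_singleton s)
  have key : pairLaw w hw s x {t | (t n).1 = s} = 1 := by
    -- the step kernel copies the first component, so the event has probability one at each time
    induction n with
    | zero =>
      have := pairLaw_zero w hw s x (A := {s} ×ˢ Set.univ)
        ((measurableSet_singleton s).prod MeasurableSet.univ)
      simpa using this
    | succ n ih =>
      have hA : MeasurableSet {h : Π _ : Finset.Iic n, E × Site d | (h ⟨n, by simp⟩).1 = s} :=
        (measurable_fst.comp (measurable_pi_apply (X := fun _ : Finset.Iic n => E × Site d)
          ⟨n, by simp⟩)) (measurableSet_singleton s)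
      have h1 := pairLaw_succ w hw s x n hA
        ((measurableSet_singleton s).prod (MeasurableSet.univ (α := Site d))) 1 (by
          intro h hh
          have hh' : (h ⟨n, by simp⟩).1 = s := hh
          rw [pairStep_apply_prod w hw n h (measurableSet_singleton s)]
          simp [hh'])
      refine le_antisymm prob_le_one ?_
      have h2 : pairLaw w hw s x {t | Preorder.frestrictLe n t ∈
          {h : Π _ : Finset.Iic n, E × Site d | (h ⟨n, by simp⟩).1 = s}} = 1 := ih
      rw [h2, one_mul] at h1
      rw [← h1]
      exact measure_mono fun t ht => ht.2.1
  exact (prob_compl_eq_zero_iff (hm n)).2 key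

lemma pairLaw_cylinder (w : ℕ → E × Site d → Dir d → ℝ) (hw : ∀ n, Measurable (w n)) (s : E)
    (x : Site d) (y : ℕ → Site d) (n : ℕ) :
    pairLaw w hw s x {t | ∀ i ≤ n, t i = (s, y i)} =
      ({x} : Set (Site d)).indicator 1 (y 0) *
        ∏ i ∈ Finset.range n, stepKernel (w i) (hw i) (s, y i) {y (i + 1)} := by
  induction n with
  | zero =>
    have := pairLaw_zero w hw s x (A := {(s, y 0)}) (measurableSet_singleton _)
    simp only [Set.mem_singleton_iff] at this
    simp only [Nat.le_zero, forall_eq, Finset.range_zero, Finset.prod_empty, mul_one, this]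
    by_cases h : y 0 = x
    · simp [h]
    · simp [h, Ne.symm h]
  | succ n ih =>
    have h1 := pairLaw_succ w hw s x n
      (A := {fun i : Finset.Iic n => (s, y i)}) (measurableSet_singleton _)
      (B := {s} ×ˢ {y (n + 1)}) ((measurableSet_singleton s).prod (measurableSet_singleton _))
      (stepKernel (w n) (hw n) (s, y n) {y (n + 1)}) (by
        rintro h rfl
        rw [pairStep_apply_prod w hw n _ (measurableSet_singleton s)]
        simp)
    have e1 : {t : ℕ → E × Site d | Preorder.frestrictLe n t ∈
        ({fun i : Finset.Iic n => (s, y i)} : Set _)} = {t | ∀ i ≤ n, t i = (s, y i)} := by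
      ext t
      simp only [Set.mem_singleton_iff, Set.mem_ofPred_eq, funext_iff]
      constructor
      · intro h i hi; exact h ⟨i, by simpa using hi⟩
      · rintro h ⟨i, hi⟩; exact h i (by simpa using hi)
    have e2 : {t : ℕ → E × Site d | Preorder.frestrictLe n t ∈
        ({fun i : Finset.Iic n => (s, y i)} : Set _) ∧ t (n + 1) ∈
          ({s} ×ˢ {y (n + 1)} : Set (E × Site d))} = {t | ∀ i ≤ n + 1, t i = (s, y i)} := by
      ext t
      have := Set.ext_iff.1 e1 t
      simp only [Set.mem_ofPred_eq] at this ⊢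
      rw [this]
      constructor
      · rintro ⟨h, h'⟩ i hi
        rcases Nat.le_succ_iff.1 hi with hi | rfl
        · exact h i hi
        · exact Prod.ext h'.1 h'.2
      · intro h
        refine ⟨fun i hi => h i (by omega), ?_⟩
        rw [h (n + 1) le_rfl]; exact ⟨rfl, rfl⟩
    rw [e1, e2, ih] at h1
    rw [h1, Finset.prod_range_succ, mul_assoc]

lemma chainLaw_cylinder (w : ℕ → E × Site d → Dir d → ℝ) (hw : ∀ n, Measurable (w n)) (s : E)
    (x : Site d) (y : ℕ → Site d) (n : ℕ) :
    chainLaw w hw (s, x) {X | ∀ i ≤ n, X i = y i} =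
      ({x} : Set (Site d)).indicator 1 (y 0) *
        ∏ i ∈ Finset.range n, stepKernel (w i) (hw i) (s, y i) {y (i + 1)} := by
  have hm : MeasurableSet {X : ℕ → Site d | ∀ i ≤ n, X i = y i} := by
    simp only [Set.ofPred_forall]
    exact MeasurableSet.iInter fun i => MeasurableSet.iInter fun _ =>
      measurableSet_eq_fun (measurable_pi_apply i) measurable_const
  rw [← pairLaw_cylinder w hw s x y n, chainLaw_eq_map, Measure.map_apply measurable_snd_traj hm]
  refine measure_congr ?_
  filter_upwards [pairLaw_ae_fst w hw s x] with t ht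
  refine propext (forall₂_congr fun i _ => ?_)
  rw [Prod.ext_iff]
  simp [ht]

end ChainCylinder

/-! ### The joint law of letters and path in a frozen environment -/

section WalkLaw

variable {d : ℕ} {l : Site d}

/-- A sequence of letters and a path.  The regeneration times are functions of these two alone. -/
abbrev Walk {d : ℕ} (l : Site d) : Type := (ℕ → Letter l) × (ℕ → Site d)

/-- The law of letters and path in the environment `ω`, for the walk started at `x`. -/
def walkLaw (l : Site d) (κ : ℝ) : Kernel (Env d × Site d) (Walk l) :=
  (Kernel.const _ (letterProd l κ)) ⊗ₖ
    ((extQuenched l κ).comap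
      (fun p : (Env d × Site d) × (ℕ → Letter l) => ((p.1.1, p.2), p.1.2)) (by fun_prop))

instance (l : Site d) (κ : ℝ) : IsMarkovKernel (walkLaw l κ) := by
  unfold walkLaw; infer_instance

lemma lintegral_extAnnealed (P : Measure (Env d)) [IsProbabilityMeasure P] (κ : ℝ)
    {F : Space l → ℝ≥0∞} (hF : Measurable F) :
    ∫⁻ p, F p ∂(extAnnealed P l κ) =
      ∫⁻ ω, ∫⁻ z, F ((ω, z.1), z.2) ∂(walkLaw l κ (ω, 0)) ∂P := by
  unfold extAnnealed
  rw [Measure.lintegral_compProd hF, lintegral_prod _ hF.lintegral_kernel_prod_right'.aemeasurable]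
  refine lintegral_congr fun ω => ?_
  rw [walkLaw, Kernel.lintegral_compProd _ _ _ (by fun_prop)]
  rfl

lemma extAnnealed_apply (P : Measure (Env d)) [IsProbabilityMeasure P] (κ : ℝ)
    {A : Set (Space l)} (hA : MeasurableSet A) :
    extAnnealed P l κ A = ∫⁻ ω, walkLaw l κ (ω, 0) {z | ((ω, z.1), z.2) ∈ A} ∂P := by
  rw [← lintegral_indicator_one hA, lintegral_extAnnealed P κ (measurable_one.indicator hA)]
  refine lintegral_congr fun ω => ?_
  have hm : MeasurableSet {z : Walk l | ((ω, z.1), z.2) ∈ A} :=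
    hA.preimage (f := fun z : Walk l => ((ω, z.1), z.2)) (by fun_prop)
  rw [← lintegral_indicator_one hm]
  rfl

/-- The event that the first `n` letters are those of `u` and the first `n + 1` positions those
of `y`. -/
def cyl (n : ℕ) (u : ℕ → Letter l) (y : ℕ → Site d) : Set (Walk l) :=
  {z | (∀ i < n, z.1 i = u i) ∧ ∀ i ≤ n, z.2 i = y i}

lemma measurableSet_agree {α : Type*} [MeasurableSpace α] [MeasurableSingletonClass α]
    (p : ℕ → Prop) (u : ℕ → α) : MeasurableSet {z : ℕ → α | ∀ i, p i → z i = u i} := by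
  simp only [Set.ofPred_forall]
  exact MeasurableSet.iInter fun i => MeasurableSet.iInter fun _ =>
    (measurableSet_singleton (u i)).preimage (measurable_pi_apply i)

lemma measurableSet_cyl (n : ℕ) (u : ℕ → Letter l) (y : ℕ → Site d) :
    MeasurableSet (cyl n u y) :=
  (measurable_fst (measurableSet_agree (fun i => i < n) u)).inter
    (measurable_snd (measurableSet_agree (fun i => i ≤ n) y))

/-- The probability, in the environment `ω` and with the letter `a`, of a jump from `x` to `z`.
The time `0` and the constant sequence of letters are immaterial: a step only looks at the current
letter. -/
def jumpProb (κ : ℝ) (ω : Env d) (a : Letter l) (x z : Site d) : ℝ≥0∞ :=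
  stepKernel (extWeight l κ 0) (measurable_extWeight l κ 0) ((ω, fun _ => a), x) {z}

/-- The probability that the letters `u` occur and the walk follows the path `y`, for `n` steps. -/
def cylWeight (κ : ℝ) (n : ℕ) (u : ℕ → Letter l) (y : ℕ → Site d) (ω : Env d) : ℝ≥0∞ :=
  ∏ i ∈ Finset.range n, (letterLaw l κ {u i} * jumpProb κ ω (u i) (y i) (y (i + 1)))

lemma extQuenched_path_cylinder (κ : ℝ) (n : ℕ) (ε : ℕ → Letter l) (y : ℕ → Site d) (ω : Env d)
    (x : Site d) :
    extQuenched l κ ((ω, ε), x) {X | ∀ i ≤ n, X i = y i} =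
      ({x} : Set (Site d)).indicator 1 (y 0) *
        ∏ i ∈ Finset.range n, jumpProb κ ω (ε i) (y i) (y (i + 1)) := by
  rw [extQuenched, chainLaw_cylinder]
  rfl

lemma walkLaw_cyl (κ : ℝ) (n : ℕ) (u : ℕ → Letter l) (y : ℕ → Site d) (ω : Env d) (x : Site d) :
    walkLaw l κ (ω, x) (cyl n u y) =
      ({x} : Set (Site d)).indicator 1 (y 0) * cylWeight κ n u y ω := by
  rw [walkLaw, Kernel.compProd_apply (measurableSet_cyl n u y), Kernel.const_apply]
  have hA := measurableSet_agree (fun i => i < n) u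
  have h1 : ∀ ε : ℕ → Letter l, ((extQuenched l κ).comap
      (fun p : (Env d × Site d) × (ℕ → Letter l) => ((p.1.1, p.2), p.1.2)) (by fun_prop))
        ((ω, x), ε) (Prod.mk ε ⁻¹' cyl n u y) =
      {ε : ℕ → Letter l | ∀ i, i < n → ε i = u i}.indicator (fun _ =>
        ({x} : Set (Site d)).indicator 1 (y 0) *
          ∏ i ∈ Finset.range n, jumpProb κ ω (u i) (y i) (y (i + 1))) ε := by
    intro ε
    rw [Kernel.comap_apply]
    by_cases hε : ∀ i, i < n → ε i = u i
    · rw [Set.indicator_of_mem (show ε ∈ {ε : ℕ → Letter l | ∀ i, i < n → ε i = u i} from hε)]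
      have : Prod.mk ε ⁻¹' cyl n u y = {X : ℕ → Site d | ∀ i ≤ n, X i = y i} := by
        ext X; exact and_iff_right hε
      rw [this, extQuenched_path_cylinder]
      congr 1
      exact Finset.prod_congr rfl fun i hi => by
        rw [← hε i (Finset.mem_range.1 hi)]
    · rw [Set.indicator_of_notMem (show ε ∉ {ε : ℕ → Letter l | ∀ i, i < n → ε i = u i} from hε)]
      have : Prod.mk ε ⁻¹' cyl n u y = ∅ :=
        Set.eq_empty_of_forall_notMem fun X hX => hε hX.1
      rw [this, measure_empty]
  rw [lintegral_congr h1, lintegral_indicator hA, setLIntegral_const]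
  have h2 : letterProd l κ {ε : ℕ → Letter l | ∀ i, i < n → ε i = u i} =
      ∏ i ∈ Finset.range n, letterLaw l κ {u i} := by
    have := Measure.infinitePi_pi (fun _ : ℕ => letterLaw l κ) (s := Finset.range n)
      (t := fun i => {u i}) (fun i _ => measurableSet_singleton _)
    rw [← this, letterProd]
    congr 1
    ext ε
    simp [Set.mem_pi]
  rw [h2, cylWeight, Finset.prod_mul_distrib, mul_assoc, mul_comm (∏ i ∈ _, letterLaw l κ _)]

/-- The letters and the positions of a walk up to time `n`.  This type is countable, and indexes the
cylinders of length `n`. -/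
abbrev Word (l : Site d) (n : ℕ) : Type := (Fin n → Letter l) × (Fin (n + 1) → Site d)

/-- The walks with a given word. -/
def wordCyl (n : ℕ) (k : Word l n) : Set (Walk l) :=
  {z | (∀ i : Fin n, z.1 i = k.1 i) ∧ ∀ i : Fin (n + 1), z.2 i = k.2 i}

/-- The word of length `n` of a walk. -/
def word (n : ℕ) (z : Walk l) : Word l n := (fun i => z.1 i, fun i => z.2 i)

lemma mem_wordCyl {n : ℕ} {k : Word l n} {z : Walk l} : z ∈ wordCyl n k ↔ word n z = k := by
  simp [wordCyl, word, Prod.ext_iff, funext_iff]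

lemma mem_cyl_iff_word {n : ℕ} {z z' : Walk l} :
    z' ∈ cyl n z.1 z.2 ↔ word n z' = word n z := by
  simp only [cyl, word, Prod.ext_iff, funext_iff, Set.mem_ofPred_eq]
  constructor
  · rintro ⟨h1, h2⟩; exact ⟨fun i => h1 i i.2, fun i => h2 i (by omega)⟩
  · rintro ⟨h1, h2⟩; exact ⟨fun i hi => h1 ⟨i, hi⟩, fun i hi => h2 ⟨i, by omega⟩⟩

lemma wordCyl_word (n : ℕ) (z : Walk l) : wordCyl n (word n z) = cyl n z.1 z.2 := by
  ext z'; rw [mem_wordCyl, mem_cyl_iff_word]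

lemma exists_wordCyl_eq (n : ℕ) (k : Word l n) : ∃ u y, wordCyl n k = cyl n u y := by
  classical
  refine ⟨fun i => if h : i < n then k.1 ⟨i, h⟩ else ⟨0, Finset.mem_insert_self _ _⟩,
    fun i => if h : i < n + 1 then k.2 ⟨i, h⟩ else 0, ?_⟩
  ext z
  constructor
  · rintro ⟨h1, h2⟩
    refine ⟨fun i hi => ?_, fun i hi => ?_⟩
    · simp only [dif_pos hi]; exact h1 ⟨i, hi⟩
    · simp only [dif_pos (Nat.lt_succ_of_le hi)]; exact h2 ⟨i, Nat.lt_succ_of_le hi⟩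
  · rintro ⟨h1, h2⟩
    refine ⟨fun i => ?_, fun i => ?_⟩
    · simp [h1 i i.2]
    · rw [h2 i (Nat.le_of_lt_succ i.2)]; beta_reduce; rw [dif_pos i.2]

lemma measurableSet_wordCyl (n : ℕ) (k : Word l n) : MeasurableSet (wordCyl n k) := by
  obtain ⟨u, y, h⟩ := exists_wordCyl_eq n k
  rw [h]; exact measurableSet_cyl n u y

/-- A measure on walks is determined by the cylinders. -/
lemma walk_measure_ext {μ ν : Measure (Walk l)} [IsFiniteMeasure μ]
    (h : ∀ n u y, μ (cyl n u y) = ν (cyl n u y)) : μ = ν := by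
  set C : Set (Set (Walk l)) := {A | ∃ n u y, A = cyl n u y} with hC
  have hmem : ∀ n (z : Walk l), MeasurableSet[MeasurableSpace.generateFrom C]
      (cyl n z.1 z.2) := fun n z => MeasurableSpace.measurableSet_generateFrom ⟨n, _, _, rfl⟩
  have hword : ∀ n (S : Set (Word l n)), MeasurableSet[MeasurableSpace.generateFrom C]
      {z | word n z ∈ S} := by
    intro n S
    have : {z : Walk l | word n z ∈ S} = ⋃ k ∈ S, wordCyl n k := by
      ext z; simp [mem_wordCyl]
    rw [this]
    refine MeasurableSet.biUnion S.to_countable fun k _ => ?_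
    obtain ⟨u, y, h⟩ := exists_wordCyl_eq n k
    rw [h]
    exact MeasurableSpace.measurableSet_generateFrom ⟨n, _, _, rfl⟩
  refine Measure.ext_of_generateFrom_of_cover_subset (S := C) (T := Set.range (wordCyl 0)) ?_ ?_
    ?_ (Set.countable_range _) ?_ ?_ ?_
  · apply le_antisymm
    · refine sup_le ?_ ?_
      · rw [MeasurableSpace.comap_le_iff_le_map]
        refine iSup_le fun i => ?_
        rw [MeasurableSpace.comap_le_iff_le_map]
        intro S _
        exact hword (i + 1) {k | k.1 ⟨i, by omega⟩ ∈ S}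
      · rw [MeasurableSpace.comap_le_iff_le_map]
        refine iSup_le fun i => ?_
        rw [MeasurableSpace.comap_le_iff_le_map]
        intro S _
        exact hword i {k | k.2 ⟨i, by omega⟩ ∈ S}
    · refine MeasurableSpace.generateFrom_le ?_
      rintro A ⟨n, u, y, rfl⟩
      exact measurableSet_cyl n u y
  · rintro _ ⟨n, u, y, rfl⟩ _ ⟨m, u', y', rfl⟩ ⟨z, ⟨h1, h2⟩, h3, h4⟩
    refine ⟨max n m, z.1, z.2, ?_⟩
    ext z'
    constructor
    · rintro ⟨⟨g1, g2⟩, g3, g4⟩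
      refine ⟨fun i hi => ?_, fun i hi => ?_⟩
      · rcases lt_max_iff.1 hi with hi | hi
        · rw [g1 i hi, h1 i hi]
        · rw [g3 i hi, h3 i hi]
      · rcases le_max_iff.1 hi with hi | hi
        · rw [g2 i hi, h2 i hi]
        · rw [g4 i hi, h4 i hi]
    · rintro ⟨g1, g2⟩
      exact ⟨⟨fun i hi => by rw [g1 i (lt_max_of_lt_left hi), h1 i hi],
          fun i hi => by rw [g2 i (le_max_of_le_left hi), h2 i hi]⟩,
        fun i hi => by rw [g1 i (lt_max_of_lt_right hi), h3 i hi],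
          fun i hi => by rw [g2 i (le_max_of_le_right hi), h4 i hi]⟩
  · rintro _ ⟨k, rfl⟩
    obtain ⟨u, y, h⟩ := exists_wordCyl_eq 0 k
    exact ⟨0, u, y, h⟩
  · refine Set.eq_univ_of_forall fun z => Set.mem_sUnion.2 ⟨_, ⟨word 0 z, rfl⟩, ?_⟩
    exact mem_wordCyl.2 rfl
  · exact fun s _ => measure_ne_top μ s
  · rintro _ ⟨n, u, y, rfl⟩
    exact h n u y

/-- The walk after time `n`. -/
def after (n : ℕ) (z : Walk l) : Walk l := (fun i => z.1 (n + i), fun i => z.2 (n + i))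

lemma measurable_after (n : ℕ) : Measurable (after (l := l) n) := by
  unfold after; fun_prop

/-- The Markov property at time `n`, on a cylinder. -/
lemma walkLaw_markov (κ : ℝ) (n : ℕ) (u : ℕ → Letter l) (y : ℕ → Site d) (ω : Env d) (x : Site d)
    {F : Walk l → ℝ≥0∞} (hF : Measurable F) :
    ∫⁻ z in cyl n u y, F (after n z) ∂(walkLaw l κ (ω, x)) =
      ({x} : Set (Site d)).indicator 1 (y 0) * cylWeight κ n u y ω *
        ∫⁻ z, F z ∂(walkLaw l κ (ω, y n)) := by
  rw [← lintegral_map hF (measurable_after n), ← smul_eq_mul (a := _ * _), ← lintegral_smul_measure]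
  congr 1
  refine walk_measure_ext fun m u' y' => ?_
  rw [Measure.map_apply (measurable_after n) (measurableSet_cyl m u' y'),
    Measure.restrict_apply (measurable_after n (measurableSet_cyl m u' y')),
    Measure.smul_apply, smul_eq_mul, walkLaw_cyl]
  -- a cylinder in the future and one in the past concatenate if they match at time `n`
  by_cases hy : y' 0 = y n
  · have e : after n ⁻¹' cyl m u' y' ∩ cyl n u y =
        cyl (n + m) (fun i => if i < n then u i else u' (i - n))
          (fun i => if i ≤ n then y i else y' (i - n)) := by
      ext z
      constructor
      · rintro ⟨⟨h1, h2⟩, h3, h4⟩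
        refine ⟨fun i hi => ?_, fun i hi => ?_⟩
        · by_cases h : i < n
          · simp only [h, if_true]; exact h3 i h
          · simp only [h, if_false]
            have e : n + (i - n) = i := by omega
            rw [← h1 (i - n) (by omega)]
            simp only [after, e]
        · by_cases h : i ≤ n
          · simp only [h, if_true]; exact h4 i h
          · simp only [h, if_false]
            have e : n + (i - n) = i := by omega
            rw [← h2 (i - n) (by omega)]
            simp only [after, e]
      · rintro ⟨h1, h2⟩
        refine ⟨⟨fun i hi => ?_, fun i hi => ?_⟩, fun i hi => ?_, fun i hi => ?_⟩
        · have := h1 (n + i) (by omega)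
          simp only [after]; rw [this]
          simp
        · have := h2 (n + i) (by omega)
          simp only [after]; rw [this]
          rcases Nat.eq_zero_or_pos i with rfl | hi'
          · simp [hy]
          · beta_reduce
            rw [if_neg (by omega), Nat.add_sub_cancel_left]
        · have := h1 i (by omega)
          rw [this]; simp [hi]
        · have := h2 i (by omega)
          rw [this]; simp [hi]
    rw [e, walkLaw_cyl]
    have e2 : cylWeight κ (n + m) (fun i => if i < n then u i else u' (i - n))
          (fun i => if i ≤ n then y i else y' (i - n)) ω =
        cylWeight κ n u y ω * cylWeight κ m u' y' ω := by
      unfold cylWeight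
      rw [Finset.prod_range_add]
      congr 1
      · refine Finset.prod_congr rfl fun i hi => ?_
        have := Finset.mem_range.1 hi
        beta_reduce
        rw [if_pos this, if_pos this.le, if_pos (by omega)]
      · refine Finset.prod_congr rfl fun i hi => ?_
        beta_reduce
        rw [if_neg (by omega : ¬ n + i < n), if_neg (by omega : ¬ n + i + 1 ≤ n)]
        have a1 : n + i - n = i := by omega
        have a2 : n + i + 1 - n = i + 1 := by omega
        have a3 : (if n + i ≤ n then y (n + i) else y' (n + i - n)) = y' i := by
          rcases Nat.eq_zero_or_pos i with rfl | hi'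
          · simp [hy]
          · rw [if_neg (by omega), a1]
        rw [a3, a1, a2]
    rw [e2]
    simp [hy, mul_assoc]
  · have e : after n ⁻¹' cyl m u' y' ∩ cyl n u y = ∅ := by
      refine Set.eq_empty_of_forall_notMem ?_
      rintro z ⟨⟨_, h2⟩, _, h4⟩
      have h2' := h2 0 (Nat.zero_le _)
      simp only [after, add_zero] at h2'
      exact hy (h2'.symm.trans (h4 n le_rfl))
    rw [e, measure_empty]
    simp [hy]

end WalkLaw

/-! ### Translation, locality, and the law of the path -/

section Local

variable {d : ℕ} {l : Site d}

open scoped Classical in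
lemma stepKernel_apply {E : Type*} [MeasurableSpace E] (w : E × Site d → Dir d → ℝ)
    (hw : Measurable w) (s : E × Site d) (A : Set (Site d)) :
    stepKernel w hw s A =
      if (∀ e, 0 ≤ w s e) ∧ ∑ e, w s e = 1 then
        ∑ e : Dir d, ENNReal.ofReal (w s e) * A.indicator 1 (s.2 + (e : Site d))
      else A.indicator 1 s.2 := by
  change (if (∀ e, 0 ≤ w s e) ∧ ∑ e, w s e = 1 then
        ∑ e : Dir d, ENNReal.ofReal (w s e) • Measure.dirac (s.2 + (e : Site d))
      else Measure.dirac s.2) A = _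
  have hA : MeasurableSet A := A.to_countable.measurableSet
  split_ifs
  · simp only [Measure.finsetSum_apply, Measure.smul_apply, smul_eq_mul,
      Measure.dirac_apply' _ hA]
  · exact Measure.dirac_apply' _ hA

lemma jumpProb_translate (κ : ℝ) (ω : Env d) (a : Letter l) (v x z : Site d) :
    jumpProb κ ω a (v + x) (v + z) = jumpProb κ (shift v ω) a x z := by
  unfold jumpProb
  rw [stepKernel_apply, stepKernel_apply]
  have h : ∀ e, extWeight l κ 0 ((ω, fun _ => a), v + x) e =
      extWeight l κ 0 ((shift v ω, fun _ => a), x) e := fun e => rfl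
  have h2 : ∀ y : Site d, ({v + z} : Set (Site d)).indicator (1 : Site d → ℝ≥0∞) (v + y) =
      ({z} : Set (Site d)).indicator 1 y := by
    intro y
    simp [Set.indicator_apply]
  simp only [h, h2, add_assoc]

lemma cylWeight_translate (κ : ℝ) (n : ℕ) (u : ℕ → Letter l) (y : ℕ → Site d) (ω : Env d)
    (v : Site d) :
    cylWeight κ n u (fun i => v + y i) ω = cylWeight κ n u y (shift v ω) := by
  unfold cylWeight
  exact Finset.prod_congr rfl fun i _ => by rw [jumpProb_translate]

/-- The walk seen from the site `v`. -/
def translate (v : Site d) (z : Walk l) : Walk l := (z.1, fun i => z.2 i - v)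

lemma measurable_translate (v : Site d) : Measurable (translate (l := l) v) := by
  unfold translate
  refine measurable_fst.prodMk (measurable_pi_lambda _ fun i => ?_)
  exact (measurable_of_countable (fun x : Site d => x - v)).comp
    ((measurable_pi_apply i).comp measurable_snd)

/-- Translation covariance: moving the walk is moving the environment. -/
lemma walkLaw_translate (κ : ℝ) (ω : Env d) (v : Site d) :
    (walkLaw l κ (ω, v)).map (translate v) = walkLaw l κ (shift v ω, 0) := by
  refine walk_measure_ext fun n u y => ?_
  rw [Measure.map_apply (measurable_translate v) (measurableSet_cyl n u y)]
  have e : translate v ⁻¹' cyl n u y = cyl n u (fun i => v + y i) := by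
    ext z
    refine and_congr_right fun _ => forall₂_congr fun i _ => ?_
    simp only [translate]
    rw [sub_eq_iff_eq_add, add_comm]
  rw [e, walkLaw_cyl, walkLaw_cyl, cylWeight_translate]
  simp [Set.indicator_apply]

lemma jumpProb_measurable_env (κ : ℝ) (a : Letter l) (x z : Site d) :
    Measurable fun ω : Env d => jumpProb κ ω a x z := by
  unfold jumpProb
  exact (Kernel.measurable_coe _ (measurableSet_singleton z)).comp (by fun_prop)

/-- A jump from `x` only looks at the environment at `x`. -/
lemma jumpProb_measurable_site (κ : ℝ) (a : Letter l) (x z : Site d) {A : Set (Site d)}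
    (hx : x ∈ A) : Measurable[envSigma A] fun ω : Env d => jumpProb κ ω a x z := by
  have h1 : (fun ω : Env d => jumpProb κ ω a x z) =
      (fun σ : stdSimplex ℝ (Dir d) => jumpProb κ (fun _ => σ) a x z) ∘ fun ω => ω x := by
    funext ω
    simp only [Function.comp, jumpProb]
    rw [stepKernel_apply, stepKernel_apply]
    rfl
  have h2 : Measurable fun σ : stdSimplex ℝ (Dir d) => jumpProb κ (fun _ => σ) a x z :=
    (jumpProb_measurable_env κ a x z).comp (measurable_pi_lambda _ fun _ => measurable_id)
  rw [h1]
  have h3 : Measurable[envSigma A] fun ω : Env d => ω x := by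
    rw [measurable_iff_comap_le]
    exact le_iSup₂_of_le x hx le_rfl
  exact h2.comp h3

lemma calE_subset {l : Site d} {e : Site d} (he : e ∈ calE l) : e ∈ unitVectors d := by
  classical
  rw [calE, Finset.mem_erase, Finset.mem_image] at he
  obtain ⟨h0, i, -, rfl⟩ := he
  rcases lt_trichotomy (l i) 0 with h | h | h
  · rw [Int.sign_eq_neg_one_of_neg h]
    exact Finset.mem_union_right _ (Finset.mem_image_of_mem _ (Finset.mem_univ i))
  · simp [h] at h0
  · rw [Int.sign_eq_one_of_pos h]
    exact Finset.mem_union_left _ (Finset.mem_image_of_mem _ (Finset.mem_univ i))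

lemma letter_mem_calE {a : Letter l} (ha : (a : Site d) ≠ 0) : (a : Site d) ∈ calE l :=
  (Finset.mem_insert.1 a.2).resolve_left ha

lemma zero_notMem_unitVectors : (0 : Site d) ∉ unitVectors d := by
  classical
  intro h
  rcases Finset.mem_union.1 h with h | h <;>
  · obtain ⟨i, -, h⟩ := Finset.mem_image.1 h
    simp at h

/-- A nonzero letter forces the step. -/
lemma jumpProb_of_ne_zero (κ : ℝ) (ω : Env d) {a : Letter l} (ha : (a : Site d) ≠ 0)
    (x z : Site d) :
    jumpProb κ ω a x z = if z = x + a then 1 else 0 := by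
  classical
  have hw : ∀ e : Dir d, extWeight l κ 0 ((ω, fun _ => a), x) e =
      if e = ⟨a, calE_subset (letter_mem_calE ha)⟩ then 1 else 0 := by
    intro e
    simp only [extWeight, ha, if_false, zero_div, zero_mul, add_zero, Subtype.ext_iff,
      eq_comm (a := (a : Site d))]
  unfold jumpProb
  rw [stepKernel_apply, if_pos]
  · simp only [hw]
    rw [Finset.sum_eq_single ⟨a, calE_subset (letter_mem_calE ha)⟩]
    · simp [Set.indicator_apply, eq_comm]
    · intro e _ he; simp [he]
    · simp
  · simp only [hw]
    refine ⟨fun e => by split_ifs <;> norm_num, by simp⟩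

/-- The walk moves by unit vectors or stays put. -/
lemma jumpProb_eq_zero (κ : ℝ) (ω : Env d) (a : Letter l) {x z : Site d} (h0 : z ≠ x)
    (h : z - x ∉ unitVectors d) : jumpProb κ ω a x z = 0 := by
  classical
  unfold jumpProb
  rw [stepKernel_apply]
  split_ifs
  · refine Finset.sum_eq_zero fun e _ => ?_
    rw [Set.indicator_of_notMem, mul_zero]
    intro he
    rw [Set.mem_singleton_iff] at he
    exact h (by rw [← he]; simp)
  · rw [Set.indicator_of_notMem]
    exact fun he => h0 he.symm

lemma letterLaw_singleton {κ : ℝ} (h0 : 0 ≤ κ) (h1 : κ * (calE l).card ≤ 1) (a : Letter l) :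
    letterLaw l κ {a} =
      ENNReal.ofReal (if (a : Site d) = 0 then 1 - κ * (calE l).card else κ) := by
  classical
  unfold letterLaw
  rw [if_pos ⟨h0, h1⟩]
  simp only [Measure.finsetSum_apply, Measure.smul_apply, smul_eq_mul,
    Measure.dirac_apply' _ (measurableSet_singleton _)]
  rw [Finset.sum_eq_single a]
  · simp
  · intro b _ hb; simp [hb]
  · exact fun h => absurd (Finset.mem_univ a) h

/-- Averaging over the letters gives back the quenched transition probabilities. -/
lemma sum_letter_jumpProb {κ : ℝ} (h0 : 0 ≤ κ) (h1 : κ * (calE l).card < 1) (ω : Env d)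
    (x z : Site d) (hω : ∀ e : Dir d, (e : Site d) ∈ calE l → κ ≤ ω x e) :
    ∑ a : Letter l, letterLaw l κ {a} * jumpProb κ ω a x z =
      stepKernel (fun (s : Env d × Site d) e => (s.1 s.2 e : ℝ)) measurable_env (ω, x) {z} := by
  classical
  set q : ℝ := 1 - κ * (calE l).card with hq
  have hq0 : 0 < q := by linarith
  have hcard : ∑ e : Dir d, (if (e : Site d) ∈ calE l then (1 : ℝ) else 0) = (calE l).card := by
    rw [Finset.sum_coe_sort (unitVectors d) (fun e => if e ∈ calE l then (1 : ℝ) else 0),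
      Finset.sum_ite_mem, Finset.inter_eq_right.2 fun e he => calE_subset he]
    simp
  have hsum : ∑ e : Dir d, (ω x e : ℝ) = 1 := (ω x).2.2
  have hw : ∀ e : Dir d, extWeight l κ 0 ((ω, fun _ => ⟨0, Finset.mem_insert_self _ _⟩), x) e =
      q⁻¹ * (ω x e - κ * (if (e : Site d) ∈ calE l then 1 else 0)) := by
    intro e
    have : (0 : Site d) ≠ e := fun h => zero_notMem_unitVectors (h ▸ e.2)
    simp [extWeight, this, hq]
  have hnn : ∀ e : Dir d, 0 ≤ (ω x e : ℝ) - κ * (if (e : Site d) ∈ calE l then 1 else 0) := by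
    intro e
    split_ifs with h
    · linarith [hω e h]
    · simp
  have hz : letterLaw l κ {(⟨0, Finset.mem_insert_self _ _⟩ : Letter l)} *
      jumpProb κ ω (⟨0, Finset.mem_insert_self _ _⟩ : Letter l) x z =
      ∑ e : Dir d, ENNReal.ofReal (ω x e - κ * (if (e : Site d) ∈ calE l then 1 else 0)) *
        ({z} : Set (Site d)).indicator 1 (x + e) := by
    rw [letterLaw_singleton h0 h1.le, if_pos rfl]
    unfold jumpProb
    rw [stepKernel_apply, if_pos]
    · simp only [hw]
      rw [Finset.mul_sum]
      refine Finset.sum_congr rfl fun e _ => ?_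
      rw [← mul_assoc, ← ENNReal.ofReal_mul hq0.le, ← mul_assoc, mul_inv_cancel₀ hq0.ne', one_mul]
    · simp only [hw]
      refine ⟨fun e => mul_nonneg (inv_nonneg.2 hq0.le) (hnn e), ?_⟩
      rw [← Finset.mul_sum, Finset.sum_sub_distrib, ← Finset.mul_sum, hcard, hsum]
      exact inv_mul_cancel₀ hq0.ne'
  have hnz : ∑ a ∈ (Finset.univ.erase (⟨0, Finset.mem_insert_self _ _⟩ : Letter l)),
      letterLaw l κ {a} * jumpProb κ ω a x z =
      ∑ e : Dir d, ENNReal.ofReal (κ * (if (e : Site d) ∈ calE l then 1 else 0)) *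
        ({z} : Set (Site d)).indicator 1 (x + e) := by
    have e1 : ∀ a ∈ (Finset.univ.erase (⟨0, Finset.mem_insert_self _ _⟩ : Letter l)),
        letterLaw l κ {a} * jumpProb κ ω a x z =
        (fun a : Site d => ENNReal.ofReal κ * ({z} : Set (Site d)).indicator 1 (x + a)) a := by
      intro a ha
      have ha' : (a : Site d) ≠ 0 := fun h => (Finset.mem_erase.1 ha).1 (Subtype.ext h)
      rw [letterLaw_singleton h0 h1.le, if_neg ha', jumpProb_of_ne_zero κ ω ha']
      simp [Set.indicator_apply, eq_comm]
    rw [Finset.sum_congr rfl e1]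
    have e2 : ∑ a ∈ (Finset.univ.erase (⟨0, Finset.mem_insert_self _ _⟩ : Letter l)),
        (fun a : Site d => ENNReal.ofReal κ * ({z} : Set (Site d)).indicator 1 (x + a)) a =
        ∑ a ∈ calE l, ENNReal.ofReal κ * ({z} : Set (Site d)).indicator 1 (x + a) := by
      refine Finset.sum_bij (fun a _ => (a : Site d)) ?_ ?_ ?_ ?_
      · intro a ha
        exact letter_mem_calE fun h => (Finset.mem_erase.1 ha).1 (Subtype.ext h)
      · intro a _ b _ h; exact Subtype.ext h
      · intro b hb
        refine ⟨⟨b, Finset.mem_insert_of_mem hb⟩, Finset.mem_erase.2 ⟨?_, Finset.mem_univ _⟩, rfl⟩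
        intro h
        have h' : b = 0 := congrArg Subtype.val h
        rw [h'] at hb
        simp [calE] at hb
      · intro a _; rfl
    rw [e2, Finset.sum_coe_sort (unitVectors d) (fun e => ENNReal.ofReal
      (κ * (if e ∈ calE l then 1 else 0)) * ({z} : Set (Site d)).indicator 1 (x + e)),
      ← Finset.sum_subset (fun e he => calE_subset (l := l) he)]
    · exact Finset.sum_congr rfl fun e he => by simp [he]
    · intro e _ he; simp [he]
  rw [← Finset.add_sum_erase _ _ (Finset.mem_univ (⟨0, Finset.mem_insert_self _ _⟩ : Letter l)),
    hz, hnz, ← Finset.sum_add_distrib, stepKernel_apply, if_pos ⟨(ω x).2.1, hsum⟩]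
  refine Finset.sum_congr rfl fun e _ => ?_
  rw [← add_mul, ← ENNReal.ofReal_add (hnn e) (by split_ifs <;> simp [h0])]
  simp

/-- A measure on paths is determined by the cylinders. -/
lemma path_measure_ext {μ ν : Measure (ℕ → Site d)} [IsFiniteMeasure μ]
    (h : ∀ n (y : ℕ → Site d), μ {X | ∀ i ≤ n, X i = y i} = ν {X | ∀ i ≤ n, X i = y i}) :
    μ = ν := by
  set c : ℕ → Letter (0 : Site d) := fun _ => ⟨0, Finset.mem_insert_self _ _⟩
  have hm : Measurable fun X : ℕ → Site d => ((c, X) : Walk (0 : Site d)) := by fun_prop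
  have key : μ.map (fun X => ((c, X) : Walk (0 : Site d))) =
      ν.map (fun X => ((c, X) : Walk (0 : Site d))) := by
    refine walk_measure_ext fun n u y => ?_
    rw [Measure.map_apply hm (measurableSet_cyl n u y),
      Measure.map_apply hm (measurableSet_cyl n u y)]
    by_cases hu : ∀ i < n, c i = u i
    · have : (fun X : ℕ → Site d => ((c, X) : Walk (0 : Site d))) ⁻¹' cyl n u y =
          {X | ∀ i ≤ n, X i = y i} := by
        ext X; exact and_iff_right hu
      rw [this, h]
    · have : (fun X : ℕ → Site d => ((c, X) : Walk (0 : Site d))) ⁻¹' cyl n u y = ∅ :=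
        Set.eq_empty_of_forall_notMem fun X hX => hu hX.1
      rw [this, measure_empty, measure_empty]
  have := congrArg (Measure.map Prod.snd) key
  rw [Measure.map_map measurable_snd hm, Measure.map_map measurable_snd hm] at this
  simpa [Function.comp_def] using this

/-- In an elliptic environment the path has the quenched law. -/
lemma walkLaw_map_snd {κ : ℝ} (h0 : 0 ≤ κ) (h1 : κ * (calE l).card < 1) (ω : Env d) (x : Site d)
    (hω : ∀ x, ∀ e : Dir d, (e : Site d) ∈ calE l → κ ≤ ω x e) :
    (walkLaw l κ (ω, x)).map Prod.snd = quenched d (ω, x) := by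
  refine path_measure_ext fun n y => ?_
  have hm : MeasurableSet {X : ℕ → Site d | ∀ i ≤ n, X i = y i} :=
    measurableSet_agree (fun i => i ≤ n) y
  rw [Measure.map_apply measurable_snd hm, quenched, chainLaw_cylinder, walkLaw,
    Kernel.compProd_apply (measurable_snd hm), Kernel.const_apply]
  have e1 : ∀ ε : ℕ → Letter l, ((extQuenched l κ).comap
      (fun p : (Env d × Site d) × (ℕ → Letter l) => ((p.1.1, p.2), p.1.2)) (by fun_prop))
        ((ω, x), ε) (Prod.mk ε ⁻¹' (Prod.snd ⁻¹' {X : ℕ → Site d | ∀ i ≤ n, X i = y i})) =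
      ({x} : Set (Site d)).indicator 1 (y 0) *
        ∏ i ∈ Finset.range n, jumpProb κ ω (ε i) (y i) (y (i + 1)) := fun ε => by
    rw [Kernel.comap_apply]
    exact extQuenched_path_cylinder κ n ε y ω x
  have hmeas : ∀ i, Measurable fun a : Letter l => jumpProb κ ω a (y i) (y (i + 1)) :=
    fun i => measurable_of_countable _
  rw [lintegral_congr e1, lintegral_const_mul _ (by
    refine Finset.measurable_prod _ fun i _ => ?_
    exact (hmeas i).comp (measurable_pi_apply i))]
  congr 1
  have hind := iIndepFun_infinitePi (P := fun _ : ℕ => letterLaw l κ)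
    (X := fun i a => jumpProb κ ω a (y i) (y (i + 1))) hmeas
  rw [letterProd, lintegral_prod_eq_prod_lintegral_of_indepFun (Finset.range n)
    (fun i (ε : ℕ → Letter l) => jumpProb κ ω (ε i) (y i) (y (i + 1))) hind
    (fun i => (hmeas i).comp (measurable_pi_apply i))]
  refine Finset.prod_congr rfl fun i _ => ?_
  have e2 := Measure.infinitePi_map_eval (fun _ : ℕ => letterLaw l κ) i
  rw [← sum_letter_jumpProb h0 h1 ω (y i) (y (i + 1)) (hω _)]
  have e3 := lintegral_map (μ := Measure.infinitePi fun _ : ℕ => letterLaw l κ) (hmeas i)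
    (measurable_pi_apply (X := fun _ : ℕ => Letter l) i)
  rw [← e3]
  have e4 : (Measure.infinitePi fun _ : ℕ => letterLaw l κ).map
    (fun c : ℕ → Letter l => c i) = letterLaw l κ := e2
  rw [e4, lintegral_fintype]
  exact Finset.sum_congr rfl fun a _ => mul_comm _ _

end Local

/-! ### Regeneration times as functions of letters and path -/

section Regeneration

variable {d : ℕ} {l : Site d} {ζ : ℝ} {L : ℕ}

lemma firstTime_eq_top {p : ℕ → Prop} : firstTime p = ⊤ ↔ ∀ n, ¬ p n := by
  simp [firstTime, iInf_eq_top]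

lemma firstTime_eq_coe {p : ℕ → Prop} {n : ℕ} :
    firstTime p = n ↔ p n ∧ ∀ m < n, ¬ p m := by
  classical
  have hle : ∀ m, p m → firstTime p ≤ m := fun m hm => iInf₂_le m hm
  have key : ∀ n, p n → (∀ m < n, ¬ p m) → firstTime p = n := by
    intro n hn hm
    refine le_antisymm (hle n hn) (le_iInf₂ fun m hpm => ?_)
    by_contra h
    exact hm m (by exact_mod_cast not_le.1 h) hpm
  constructor
  · intro h
    have hex : ∃ n, p n := by
      by_contra hne
      rw [firstTime_eq_top.2 (not_exists.1 hne)] at h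
      exact ENat.top_ne_natCast n h
    have h2 := key (Nat.find hex) (Nat.find_spec hex) (fun m hm => Nat.find_min hex hm)
    have h3 : Nat.find hex = n := by
      rw [h2] at h; exact_mod_cast h
    rw [← h3]
    exact ⟨Nat.find_spec hex, fun m hm => Nat.find_min hex hm⟩
  · exact fun h => key n h.1 h.2

/-- `y` lies in the cone with apex `x`. -/
def InCone (l : Site d) (ζ : ℝ) (x y : Site d) : Prop :=
  toReal y ∈ cone (toReal x) (toReal l) ζ

lemma toReal_sub (x y : Site d) : toReal (x - y) = toReal x - toReal y := by
  ext i; simp [toReal]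

lemma inner_toReal (x y : Site d) : inner ℝ (toReal x) (toReal y) = ((x ⬝ᵥ y : ℤ) : ℝ) := by
  simp [toReal, dotProduct, PiLp.inner_apply, mul_comm]

lemma inCone_iff {x y : Site d} :
    InCone l ζ x y ↔ ζ * ‖toReal (y - x)‖ * ‖toReal l‖ ≤ (((y - x) ⬝ᵥ l : ℤ) : ℝ) := by
  rw [← inner_toReal, toReal_sub]; rfl

lemma inCone_sub {x y v : Site d} : InCone l ζ (x - v) (y - v) ↔ InCone l ζ x y := by
  rw [inCone_iff, inCone_iff, sub_sub_sub_cancel_right]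

/-- The cones are convex, so they are nested along a chain of apexes. -/
lemma InCone.trans (hζ : 0 ≤ ζ) {x y z : Site d} (h1 : InCone l ζ x y) (h2 : InCone l ζ y z) :
    InCone l ζ x z := by
  rw [inCone_iff] at *
  have e : z - x = (z - y) + (y - x) := by abel
  have e2 : toReal (z - x) = toReal (z - y) + toReal (y - x) := by
    simp only [toReal_sub]; abel
  rw [e2, e, add_dotProduct]
  push_cast
  calc ζ * ‖toReal (z - y) + toReal (y - x)‖ * ‖toReal l‖
      ≤ ζ * (‖toReal (z - y)‖ + ‖toReal (y - x)‖) * ‖toReal l‖ := by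
        gcongr; exact norm_add_le _ _
    _ ≤ _ := by linarith

lemma exitCone_eq_top {X : ℕ → Site d} : exitCone l ζ X = ⊤ ↔ ∀ n, InCone l ζ (X 0) (X n) := by
  simp [exitCone, firstTime_eq_top, InCone]

lemma exitCone_sub (X : ℕ → Site d) (v : Site d) :
    exitCone l ζ (fun n => X n - v) = exitCone l ζ X := by
  unfold exitCone
  congr 1
  funext n
  have := inCone_sub (l := l) (ζ := ζ) (x := X 0) (y := X n) (v := v)
  unfold InCone at this
  rw [this]

/-- Two walks with the same first `n` letters and the same first `n + 1` positions. -/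
def Agree (n : ℕ) (z z' : Walk l) : Prop :=
  (∀ i < n, z.1 i = z'.1 i) ∧ ∀ i ≤ n, z.2 i = z'.2 i

lemma Agree.symm {n : ℕ} {z z' : Walk l} (h : Agree n z z') : Agree n z' z :=
  ⟨fun i hi => (h.1 i hi).symm, fun i hi => (h.2 i hi).symm⟩

lemma Agree.mono {m n : ℕ} (hmn : m ≤ n) {z z' : Walk l} (h : Agree n z z') : Agree m z z' :=
  ⟨fun i hi => h.1 i (hi.trans_le hmn), fun i hi => h.2 i (hi.trans hmn)⟩

lemma IsCandidate.agree {n m : ℕ} (hm : m ≤ n) {z z' : Walk l} (h : Agree n z z')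
    (hc : IsCandidate l L z.1 z.2 m) : IsCandidate l L z'.1 z'.2 m := by
  refine ⟨hc.1, fun j hj => ?_, fun i hi => ?_⟩
  · rw [← h.2 j (by omega), ← h.2 (m - L) (by omega)]; exact hc.2.1 j hj
  · have := hc.1
    rw [← h.1 (m - L + i) (by omega)]; exact hc.2.2 i hi

lemma SR_succ_fst (ε : ℕ → Letter l) (X : ℕ → Site d) (k : ℕ) :
    (SR l ζ L ε X (k + 1)).1 =
      firstTime fun n => (SR l ζ L ε X k).2 ≤ n ∧ IsCandidate l L ε X n := rfl

lemma SR_succ_snd (ε : ℕ → Letter l) (X : ℕ → Site d) (k : ℕ) :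
    (SR l ζ L ε X (k + 1)).2 =
      exitCone l ζ (fun m => X ((SR l ζ L ε X (k + 1)).1.toNat + m)) +
        (SR l ζ L ε X (k + 1)).1 := rfl

/-- `S̄_k` and `R̄_k` are stopping times: that they take a value `m ≤ n` can be seen from the first
`n` steps. -/
lemma SR_agree {n : ℕ} {z z' : Walk l} (h : Agree n z z') (k : ℕ) :
    (∀ m : ℕ, m ≤ n → (SR l ζ L z.1 z.2 k).1 = m → (SR l ζ L z'.1 z'.2 k).1 = m) ∧
      ∀ m : ℕ, m ≤ n → (SR l ζ L z.1 z.2 k).2 = m → (SR l ζ L z'.1 z'.2 k).2 = m := by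
  induction k with
  | zero => exact ⟨fun m _ hm => hm, fun m _ hm => hm⟩
  | succ k ih =>
    have hS : ∀ m : ℕ, m ≤ n → (SR l ζ L z.1 z.2 (k + 1)).1 = m →
        (SR l ζ L z'.1 z'.2 (k + 1)).1 = m := by
      intro m hm hSm
      rw [SR_succ_fst, firstTime_eq_coe] at hSm ⊢
      obtain ⟨⟨h1, h2⟩, h3⟩ := hSm
      obtain ⟨r, hr⟩ := ENat.ne_top_iff_exists.1 (ne_top_of_le_ne_top (ENat.natCast_ne_top m) h1)
      have hrm : r ≤ m := by rw [← hr] at h1; exact_mod_cast h1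
      have hr' := ih.2 r (hrm.trans hm) hr.symm
      rw [hr']
      rw [← hr] at h3
      exact ⟨⟨by exact_mod_cast hrm, h2.agree hm h⟩, fun j hj hjc =>
        h3 j hj ⟨hjc.1, hjc.2.agree (hj.le.trans hm) h.symm⟩⟩
    refine ⟨hS, fun m hm hR => ?_⟩
    rw [SR_succ_snd] at hR ⊢
    have hne : (SR l ζ L z.1 z.2 (k + 1)).1 ≠ ⊤ := by
      intro ht; rw [ht, add_top] at hR; exact ENat.top_ne_natCast m hR
    obtain ⟨s, hs⟩ := ENat.ne_top_iff_exists.1 hne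
    rw [← hs] at hR
    have hne2 : exitCone l ζ (fun j => z.2 ((s : ℕ∞).toNat + j)) ≠ ⊤ := by
      intro ht; rw [ht, top_add] at hR; exact ENat.top_ne_natCast m hR
    obtain ⟨e, he⟩ := ENat.ne_top_iff_exists.1 hne2
    rw [← he] at hR
    have hsum : e + s = m := by exact_mod_cast hR
    rw [hS s (by omega) hs.symm]
    have he' : exitCone l ζ (fun j => z'.2 ((s : ℕ∞).toNat + j)) = e := by
      have he1 := he.symm
      unfold exitCone at he1 ⊢
      rw [firstTime_eq_coe] at he1 ⊢
      simp only [ENat.toNat_natCast] at he1 ⊢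
      refine ⟨?_, fun j hj => ?_⟩
      · rw [← h.2 (s + e) (by omega), ← h.2 (s + 0) (by omega)]; exact he1.1
      · rw [← h.2 (s + j) (by omega), ← h.2 (s + 0) (by omega)]; exact he1.2 j hj
    rw [he']
    exact_mod_cast hsum

lemma SR_fst_eq_top_of_snd {ε : ℕ → Letter l} {X : ℕ → Site d} {k : ℕ}
    (h : (SR l ζ L ε X k).2 = ⊤) : (SR l ζ L ε X (k + 1)).1 = ⊤ := by
  rw [SR_succ_fst, firstTime_eq_top]
  rintro n ⟨h1, -⟩
  rw [h] at h1
  exact absurd h1 (by simp)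

lemma SR_eq_top_of_lt {ε : ℕ → Letter l} {X : ℕ → Site d} {j : ℕ}
    (h : (SR l ζ L ε X j).2 = ⊤) (i : ℕ) : (SR l ζ L ε X (j + 1 + i)).1 = ⊤ := by
  induction i with
  | zero => exact SR_fst_eq_top_of_snd h
  | succ i ih =>
    refine SR_fst_eq_top_of_snd (k := j + 1 + i) ?_
    have e : j + 1 + i = (j + i) + 1 := by omega
    rw [e] at ih ⊢
    rw [SR_succ_snd, ih, add_top]

lemma SR_snd_eq_top_iff {ε : ℕ → Letter l} {X : ℕ → Site d} {k n : ℕ}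
    (h : (SR l ζ L ε X (k + 1)).1 = n) :
    (SR l ζ L ε X (k + 1)).2 = ⊤ ↔ exitCone l ζ (fun m => X (n + m)) = ⊤ := by
  rw [SR_succ_snd, h, ENat.toNat_natCast]
  simp

/-- `τ_1` is the one time `S̄_k` after which the walk never leaves its cone: once this happens,
`R̄_k = ∞` and all later `S̄` are infinite. -/
lemma tauOne_eq_coe {ε : ℕ → Letter l} {X : ℕ → Site d} {n : ℕ} :
    tauOne l ζ L ε X = n ↔
      (∃ k, (SR l ζ L ε X (k + 1)).1 = n) ∧ exitCone l ζ (fun m => X (n + m)) = ⊤ := by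
  constructor
  · intro h
    unfold tauOne at h
    simp only at h
    split_ifs at h with hK
    · exact absurd h (ENat.top_ne_natCast n)
    · obtain ⟨K, hK'⟩ := ENat.ne_top_iff_exists.1 hK
      rw [← hK', ENat.toNat_natCast] at h
      obtain ⟨⟨h1, h2, h3⟩, -⟩ := firstTime_eq_coe.1 hK'.symm
      obtain ⟨k, rfl⟩ : ∃ k, K = k + 1 := ⟨K - 1, by omega⟩
      exact ⟨⟨k, h⟩, (SR_snd_eq_top_iff h).1 h3⟩
  · rintro ⟨⟨k, hk⟩, hex⟩
    have hK : firstTime (fun k => 1 ≤ k ∧ (SR l ζ L ε X k).1 < ⊤ ∧ (SR l ζ L ε X k).2 = ⊤) =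
        ((k + 1 : ℕ) : ℕ∞) := by
      rw [firstTime_eq_coe]
      refine ⟨⟨by omega, by rw [hk]; exact ENat.natCast_lt_top n, (SR_snd_eq_top_iff hk).2 hex⟩, ?_⟩
      rintro j hj ⟨-, -, hj3⟩
      have := SR_eq_top_of_lt hj3 (k - j)
      have e : j + 1 + (k - j) = k + 1 := by omega
      rw [e, hk] at this
      exact ENat.natCast_ne_top n this
    unfold tauOne
    simp only [hK]
    rw [if_neg (ENat.natCast_ne_top _), ENat.toNat_natCast, hk]

lemma tauOne_agree {n : ℕ} {z z' : Walk l} (h : Agree n z z')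
    (ht : tauOne l ζ L z.1 z.2 = n) (hex : exitCone l ζ (fun m => z'.2 (n + m)) = ⊤) :
    tauOne l ζ L z'.1 z'.2 = n := by
  rw [tauOne_eq_coe] at ht ⊢
  obtain ⟨⟨k, hk⟩, -⟩ := ht
  exact ⟨⟨k, (SR_agree h (k + 1)).1 n le_rfl hk⟩, hex⟩

lemma isCandidate_tauOne {ε : ℕ → Letter l} {X : ℕ → Site d} {n : ℕ}
    (h : tauOne l ζ L ε X = n) : IsCandidate l L ε X n := by
  obtain ⟨⟨k, hk⟩, -⟩ := tauOne_eq_coe.1 h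
  rw [SR_succ_fst, firstTime_eq_coe] at hk
  exact hk.1.2

/-- The walk after time `n`, seen from its position at time `n`. -/
def recenter (n : ℕ) (z : Walk l) : Walk l :=
  (fun i => z.1 (n + i), fun i => z.2 (n + i) - z.2 n)

/-- The times `τ_k` as functions of letters and path alone. -/
def walkTau (l : Site d) (ζ : ℝ) (L : ℕ) : ℕ → Walk l → ℕ∞
  | 0, _ => 0
  | k + 1, z => walkTau l ζ L k z +
      tauOne l ζ L (recenter (walkTau l ζ L k z).toNat z).1
        (recenter (walkTau l ζ L k z).toNat z).2

lemma tau_eq_walkTau (k : ℕ) (p : Space l) : tau l ζ L k p = walkTau l ζ L k (p.1.2, p.2) := by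
  induction k with
  | zero => rfl
  | succ k ih =>
    have : tau l ζ L (k + 1) p = tau l ζ L k p +
      tauOne l ζ L (fun n => p.1.2 ((tau l ζ L k p).toNat + n))
        (fun n => p.2 ((tau l ζ L k p).toNat + n) - p.2 (tau l ζ L k p).toNat) := rfl
    rw [this, ih]
    rfl

lemma walkTau_succ_eq_coe {k n : ℕ} {z : Walk l} :
    walkTau l ζ L (k + 1) z = n ↔ ∃ m : ℕ, m ≤ n ∧ walkTau l ζ L k z = m ∧
      tauOne l ζ L (recenter m z).1 (recenter m z).2 = ((n - m : ℕ) : ℕ∞) := by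
  rw [walkTau]
  constructor
  · intro h
    have hne : walkTau l ζ L k z ≠ ⊤ := by
      intro ht; rw [ht, top_add] at h; exact ENat.top_ne_natCast n h
    obtain ⟨m, hm⟩ := ENat.ne_top_iff_exists.1 hne
    rw [← hm, ENat.toNat_natCast] at h
    have hne2 : tauOne l ζ L (recenter m z).1 (recenter m z).2 ≠ ⊤ := by
      intro ht; rw [ht, add_top] at h; exact ENat.top_ne_natCast n h
    obtain ⟨j, hj⟩ := ENat.ne_top_iff_exists.1 hne2
    rw [← hj] at h
    have hs : m + j = n := by exact_mod_cast h
    refine ⟨m, by omega, hm.symm, ?_⟩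
    rw [← hj]
    congr 1; omega
  · rintro ⟨m, hm, h1, h2⟩
    rw [h1, ENat.toNat_natCast, h2]
    norm_cast
    omega

/-- After a regeneration time the walk never leaves its cone. -/
lemma exitCone_walkTau {k n : ℕ} {z : Walk l} (h : walkTau l ζ L (k + 1) z = n) :
    exitCone l ζ (fun i => z.2 (n + i)) = ⊤ := by
  obtain ⟨m, hm, -, h2⟩ := walkTau_succ_eq_coe.1 h
  have h3 := (tauOne_eq_coe.1 h2).2
  have e : (fun i => (recenter m z).2 (n - m + i)) = fun i => z.2 (n + i) - z.2 m := by
    funext i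
    simp only [recenter]
    rw [← add_assoc, Nat.add_sub_cancel' hm]
  rw [e, exitCone_sub (fun i => z.2 (n + i))] at h3
  exact h3

/-- Since the walk is recentered at `τ_k`, the record required of `τ_{k+1}` only concerns the
path after `τ_k`. -/
lemma walkTau_candidate {k m n : ℕ} {z : Walk l} (hm : walkTau l ζ L k z = m)
    (h : walkTau l ζ L (k + 1) z = n) :
    m + L ≤ n ∧ (∀ j, m ≤ j → j < n - L → z.2 j ⬝ᵥ l < z.2 (n - L) ⬝ᵥ l) ∧
      ∀ i < L, (z.1 (n - L + i) : Site d) = epsBar l i := by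
  obtain ⟨m', hm', h1, h2⟩ := walkTau_succ_eq_coe.1 h
  obtain rfl : m' = m := by rw [hm] at h1; exact_mod_cast h1.symm
  obtain ⟨c1, c2, c3⟩ := isCandidate_tauOne h2
  have hle : m' + L ≤ n := by omega
  refine ⟨hle, fun j hj1 hj2 => ?_, fun i hi => ?_⟩
  · have := c2 (j - m') (by omega)
    simp only [recenter, sub_dotProduct] at this
    rw [show m' + (j - m') = j by omega, show m' + (n - m' - L) = n - L by omega] at this
    linarith
  · have := c3 i hi
    simp only [recenter] at this
    rw [show m' + (n - m' - L + i) = n - L + i by omega] at this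
    exact this

lemma Agree.recenter {m n : ℕ} (hmn : m ≤ n) {z z' : Walk l} (h : Agree n z z') :
    Agree (n - m) (recenter m z) (recenter m z') := by
  refine ⟨fun i hi => ?_, fun i hi => ?_⟩
  · exact h.1 (m + i) (by omega)
  · change z.2 (m + i) - z.2 m = z'.2 (m + i) - z'.2 m
    rw [h.2 (m + i) (by omega), h.2 m hmn]

/-- On the event that the walk never leaves its cone after time `n`, the event `τ_k = n`, and then
all of `τ_1, …, τ_k`, are determined by the letters and the path up to time `n`. -/
lemma walkTau_agree (hζ : 0 ≤ ζ) (k : ℕ) : ∀ {n : ℕ} {z z' : Walk l}, Agree n z z' →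
    walkTau l ζ L k z = n → exitCone l ζ (fun i => z'.2 (n + i)) = ⊤ →
    ∀ j ≤ k, walkTau l ζ L j z' = walkTau l ζ L j z := by
  induction k with
  | zero =>
    intro n z z' _ _ _ j hj
    obtain rfl : j = 0 := by omega
    rfl
  | succ k ih =>
    intro n z z' hag ht hex j hj
    obtain ⟨m, hm, h1, h2⟩ := walkTau_succ_eq_coe.1 ht
    -- the walk `z'` does not leave its cone after the previous regeneration time `m` either: up to
    -- time `n` it follows `z`, and after `n` it stays in a smaller cone
    have hexm : k ≠ 0 → exitCone l ζ (fun i => z'.2 (m + i)) = ⊤ := by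
      intro hk
      obtain ⟨k, rfl⟩ := Nat.exists_eq_succ_of_ne_zero hk
      have e1 := exitCone_eq_top.1 (exitCone_walkTau h1)
      rw [exitCone_eq_top] at hex ⊢
      intro i
      have hle : ∀ i, m + i ≤ n → InCone l ζ (z'.2 m) (z'.2 (m + i)) := fun i hi => by
        have := e1 i
        simp only [add_zero] at this
        rwa [hag.2 m hm, hag.2 (m + i) hi] at this
      simp only [add_zero] at hex ⊢
      rcases le_total (m + i) n with hi | hi
      · exact hle i hi
      · have a := hle (n - m) (by omega)
        have b := hex (m + i - n)
        rw [show m + (n - m) = n by omega] at a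
        rw [show n + (m + i - n) = m + i by omega] at b
        exact a.trans hζ b
    have hIH : ∀ j ≤ k, walkTau l ζ L j z' = walkTau l ζ L j z := by
      rcases Nat.eq_zero_or_pos k with rfl | hk
      · intro j hj
        obtain rfl : j = 0 := by omega
        rfl
      · exact ih (hag.mono hm) h1 (hexm hk.ne')
    rcases Nat.le_succ_iff.1 hj with hj | rfl
    · exact hIH j hj
    · rw [ht, walkTau_succ_eq_coe]
      refine ⟨m, hm, (hIH k le_rfl).trans h1, tauOne_agree (hag.recenter hm) h2 ?_⟩
      have e : (fun i => (recenter m z').2 (n - m + i)) = fun i => z'.2 (n + i) - z'.2 m := by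
        funext i
        simp only [recenter]
        rw [← add_assoc, Nat.add_sub_cancel' hm]
      rw [e, exitCone_sub (fun i => z'.2 (n + i))]
      exact hex

end Regeneration

/-! ### Measurability of the regeneration times -/

section Measurability

variable {d : ℕ} {l : Site d} {ζ : ℝ} {L : ℕ}

lemma measurable_firstTime {α : Type*} [MeasurableSpace α] {p : α → ℕ → Prop}
    (hp : ∀ n, MeasurableSet {a | p a n}) : Measurable fun a => firstTime (p a) := by
  rw [ENat.measurable_iff]
  intro n
  have : (fun a => firstTime (p a)) ⁻¹' {(n : ℕ∞)} =
      {a | p a n} ∩ ⋂ m, ⋂ (_ : m < n), {a | p a m}ᶜ := by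
    ext a
    simp [firstTime_eq_coe]
  rw [this]
  exact (hp n).inter (MeasurableSet.iInter fun m => MeasurableSet.iInter fun _ => (hp m).compl)

/-- Evaluation of a sequence of functions at a random index. -/
lemma measurable_random_index {α β : Type*} [MeasurableSpace α] [MeasurableSpace β]
    {f : ℕ → α → β} (hf : ∀ n, Measurable (f n)) {T : α → ℕ} (hT : Measurable T) :
    Measurable fun a => f (T a) a := by
  have h : Measurable fun q : ℕ × α => f q.1 q.2 := measurable_from_prod_countable_right hf
  exact h.comp (hT.prodMk measurable_id)

lemma measurable_toNat {α : Type*} [MeasurableSpace α] {f : α → ℕ∞} (hf : Measurable f) :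
    Measurable fun a => (f a).toNat :=
  (measurable_of_countable ENat.toNat).comp hf

lemma measurable_position (n : ℕ) : Measurable fun z : Walk l => z.2 n :=
  (measurable_pi_apply n).comp measurable_snd

lemma measurable_letter (n : ℕ) : Measurable fun z : Walk l => z.1 n :=
  (measurable_pi_apply n).comp measurable_fst

lemma measurable_exitCone : Measurable fun X : ℕ → Site d => exitCone l ζ X := by
  unfold exitCone
  refine measurable_firstTime fun n => ?_
  have h : Measurable fun X : ℕ → Site d => (X 0, X n) := by fun_prop
  exact h (MeasurableSet.of_discrete
    (s := {q : Site d × Site d | toReal q.2 ∉ cone (toReal q.1) (toReal l) ζ}))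

lemma measurableSet_isCandidate (n : ℕ) :
    MeasurableSet {z : Walk l | IsCandidate l L z.1 z.2 n} := by
  have : {z : Walk l | IsCandidate l L z.1 z.2 n} = {_z | L ≤ n} ∩
      ((⋂ m, ⋂ (_ : m < n - L), {z | z.2 m ⬝ᵥ l < z.2 (n - L) ⬝ᵥ l}) ∩
        ⋂ i, ⋂ (_ : i < L), {z | (z.1 (n - L + i) : Site d) = epsBar l i}) := by
    ext z; simp [IsCandidate]
  rw [this]
  refine (MeasurableSet.const _).inter (MeasurableSet.inter ?_ ?_)
  · refine MeasurableSet.iInter fun m => MeasurableSet.iInter fun _ => ?_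
    exact ((measurable_position m).prodMk (measurable_position (n - L))) (MeasurableSet.of_discrete
      (s := {q : Site d × Site d | q.1 ⬝ᵥ l < q.2 ⬝ᵥ l}))
  · refine MeasurableSet.iInter fun i => MeasurableSet.iInter fun _ => ?_
    exact measurable_letter (n - L + i) (MeasurableSet.of_discrete
      (s := {a : Letter l | (a : Site d) = epsBar l i}))

lemma measurable_path_shift (n : ℕ) : Measurable fun z : Walk l => fun m => z.2 (n + m) := by
  fun_prop

lemma measurable_exitCone_comp {S : Walk l → ℕ → Site d} (hS : Measurable S) :
    Measurable (fun z => exitCone l ζ (S z)) :=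
  (measurable_exitCone (l := l) (ζ := ζ)).comp hS

lemma measurable_exitCone_after {S : Walk l → ℕ∞} (hS : Measurable S) :
    Measurable fun z : Walk l => exitCone l ζ (fun m => z.2 ((S z).toNat + m)) :=
  measurable_exitCone_comp (measurable_random_index (f := fun n (z : Walk l) => fun m => z.2 (n + m))
    measurable_path_shift (measurable_toNat hS))

lemma measurable_SR (k : ℕ) : Measurable fun z : Walk l => SR l ζ L z.1 z.2 k := by
  induction k with
  | zero => exact measurable_const
  | succ k ih =>
    have hS : Measurable fun z : Walk l => (SR l ζ L z.1 z.2 (k + 1)).1 := by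
      simp only [SR_succ_fst]
      refine measurable_firstTime fun n => ?_
      have h2 : Measurable fun z : Walk l => (SR l ζ L z.1 z.2 k).2 := measurable_snd.comp ih
      have h3 : MeasurableSet {z : Walk l | (SR l ζ L z.1 z.2 k).2 ≤ n} :=
        h2 (MeasurableSet.of_discrete (s := {m : ℕ∞ | m ≤ n}))
      exact h3.inter (measurableSet_isCandidate n)
    have hE := measurable_exitCone_after (ζ := ζ) hS
    have hR : Measurable fun z : Walk l => (SR l ζ L z.1 z.2 (k + 1)).2 :=
      (measurable_of_countable fun q : ℕ∞ × ℕ∞ => q.1 + q.2).comp (hE.prodMk hS)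
    exact hS.prodMk hR

lemma measurable_tauOne : Measurable fun z : Walk l => tauOne l ζ L z.1 z.2 := by
  have hK : Measurable fun z : Walk l => firstTime fun k =>
      1 ≤ k ∧ (SR l ζ L z.1 z.2 k).1 < ⊤ ∧ (SR l ζ L z.1 z.2 k).2 = ⊤ := by
    refine measurable_firstTime fun k => ?_
    exact measurable_SR k (MeasurableSet.of_discrete
      (s := {q : ℕ∞ × ℕ∞ | 1 ≤ k ∧ q.1 < ⊤ ∧ q.2 = ⊤}))
  unfold tauOne
  refine Measurable.ite (hK (measurableSet_singleton ⊤)) measurable_const ?_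
  exact measurable_random_index (f := fun k (z : Walk l) => (SR l ζ L z.1 z.2 k).1)
    (fun k => measurable_fst.comp (measurable_SR k)) (measurable_toNat hK)

lemma measurable_recenter (n : ℕ) : Measurable (recenter (l := l) n) := by
  unfold recenter
  refine (by fun_prop : Measurable fun z : Walk l => fun i => z.1 (n + i)).prodMk
    (measurable_pi_lambda _ fun i => ?_)
  exact (measurable_of_countable (fun q : Site d × Site d => q.1 - q.2)).comp
    ((measurable_position (n + i)).prodMk (measurable_position n))

lemma measurable_walkTau (k : ℕ) : Measurable (walkTau l ζ L k) := by
  induction k with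
  | zero => exact measurable_const
  | succ k ih =>
    have h : Measurable fun z : Walk l =>
        tauOne l ζ L (recenter (walkTau l ζ L k z).toNat z).1
          (recenter (walkTau l ζ L k z).toNat z).2 :=
      measurable_random_index
        (f := fun n (z : Walk l) => tauOne l ζ L (recenter n z).1 (recenter n z).2)
        (fun n => measurable_tauOne.comp (measurable_recenter n)) (measurable_toNat ih)
    exact (measurable_of_countable fun q : ℕ∞ × ℕ∞ => q.1 + q.2).comp (ih.prodMk h)

/-- The walks that never leave the cone at their starting point. -/
def confined (l : Site d) (ζ : ℝ) : Set (Walk l) := {z | exitCone l ζ z.2 = ⊤}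

lemma measurableSet_confined : MeasurableSet (confined l ζ) :=
  (measurable_exitCone.comp measurable_snd) (measurableSet_singleton ⊤)

/-- Letters and path of a point of the extended space. -/
def toWalk (p : Space l) : Walk l := (p.1.2, p.2)

lemma measurable_toWalk : Measurable (toWalk (l := l)) := by
  unfold toWalk; fun_prop

lemma tau_eq (k : ℕ) (p : Space l) : tau l ζ L k p = walkTau l ζ L k (toWalk p) :=
  tau_eq_walkTau k p

end Measurability

/-! ### Records at regeneration times -/

section Records

variable {d : ℕ} {l : Site d} {ζ : ℝ} {L : ℕ}

lemma normOne_pos (hl : l ≠ 0) : 0 < normOne l := by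
  obtain ⟨j, hj⟩ := Function.ne_iff.1 hl
  exact Finset.sum_pos' (fun _ _ => Nat.zero_le _) ⟨j, Finset.mem_univ j, Int.natAbs_pos.2 hj⟩

/-- Each step along `ε̄` gains at least one in direction `ℓ`, the coordinates of `ℓ` being integers. -/
lemma one_le_epsBar_dotProduct (hl : l ≠ 0) (i : ℕ) : 1 ≤ epsBar l i ⬝ᵥ l := by
  have hlen : (epsBarList l).length = normOne l := by
    simp [epsBarList, normOne, List.sum_ofFn, Function.comp_def]
  have hlt : i % normOne l < (epsBarList l).length := by
    rw [hlen]; exact Nat.mod_lt _ (normOne_pos hl)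
  have hmem : epsBar l i ∈ epsBarList l := by
    rw [epsBar, List.getD_eq_getElem _ _ hlt]
    exact List.getElem_mem hlt
  obtain ⟨s, hs, hs2⟩ := List.mem_flatten.1 hmem
  obtain ⟨j, rfl⟩ := List.mem_ofFn.1 hs
  obtain ⟨h1, h2⟩ := List.mem_replicate.1 hs2
  rw [h2, single_dotProduct, Int.sign_mul_self_eq_natAbs]
  omega

lemma epsBar_ne_zero (hl : l ≠ 0) (i : ℕ) : epsBar l i ≠ 0 := by
  intro h
  have := one_le_epsBar_dotProduct hl i
  rw [h, zero_dotProduct] at this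
  omega

/-- During the first `n` steps the walk obeys the nonzero letters. -/
def Obeys (n : ℕ) (z : Walk l) : Prop :=
  ∀ i < n, (z.1 i : Site d) ≠ 0 → z.2 (i + 1) = z.2 i + z.1 i

/-- While the letters spell `ε̄^(L)`, the walk climbs in direction `ℓ` at each step. -/
lemma dotProduct_climb (hl : l ≠ 0) {a : ℕ} {z : Walk l} (hz : Obeys (a + L) z)
    (h : ∀ i < L, (z.1 (a + i) : Site d) = epsBar l i) (i j : ℕ) (hij : i + j ≤ L) :
    z.2 (a + i) ⬝ᵥ l + j ≤ z.2 (a + i + j) ⬝ᵥ l := by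
  induction j with
  | zero => simp
  | succ j ih =>
    have h1 := h (i + j) (by omega)
    have h2 := hz (a + (i + j)) (by omega) (by rw [h1]; exact epsBar_ne_zero hl _)
    have h3 := one_le_epsBar_dotProduct hl (i + j)
    have h4 := ih (by omega)
    rw [h1] at h2
    rw [show a + i + (j + 1) = a + (i + j) + 1 by omega, h2, add_dotProduct,
      show a + (i + j) = a + i + j by omega]
    push_cast
    linarith

/-- At a regeneration time the walk is at a strict record in direction `ℓ`, and so it was `L`
steps before. -/
lemma walkTau_record (hl : l ≠ 0) (hL : 0 < L) (k : ℕ) : ∀ {n : ℕ} {z : Walk l}, Obeys n z →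
    walkTau l ζ L (k + 1) z = n →
    L ≤ n ∧ (∀ j < n - L, z.2 j ⬝ᵥ l < z.2 (n - L) ⬝ᵥ l) ∧
      z.2 (n - L) ⬝ᵥ l + L ≤ z.2 n ⬝ᵥ l ∧ ∀ j < n, z.2 j ⬝ᵥ l < z.2 n ⬝ᵥ l := by
  induction k with
  | zero =>
    intro n z hz ht
    obtain ⟨c1, c2, c3⟩ := walkTau_candidate (k := 0) (m := 0) (by rfl) ht
    have hn : n - L + L = n := by omega
    have hcl := dotProduct_climb (a := n - L) hl (by rwa [hn]) c3
    have h3 : z.2 (n - L) ⬝ᵥ l + L ≤ z.2 n ⬝ᵥ l := by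
      have := hcl 0 L (by omega)
      rwa [add_zero, hn] at this
    refine ⟨by omega, fun j hj => c2 j (Nat.zero_le _) hj, h3, fun j hj => ?_⟩
    rcases lt_or_ge j (n - L) with h | h
    · have := c2 j (Nat.zero_le _) h
      omega
    · have := hcl (j - (n - L)) (n - j) (by omega)
      rw [show n - L + (j - (n - L)) = j by omega, show j + (n - j) = n by omega] at this
      push_cast [hj.le] at this
      omega
  | succ k ih =>
    intro n z hz ht
    obtain ⟨m, hm, h1, h2⟩ := walkTau_succ_eq_coe.1 ht
    obtain ⟨c1, c2, c3⟩ := walkTau_candidate h1 ht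
    obtain ⟨-, -, -, i4⟩ := ih (fun i hi => hz i (by omega)) h1
    have hn : n - L + L = n := by omega
    have hcl := dotProduct_climb (a := n - L) hl (by rwa [hn]) c3
    have h3 : z.2 (n - L) ⬝ᵥ l + L ≤ z.2 n ⬝ᵥ l := by
      have := hcl 0 L (by omega)
      rwa [add_zero, hn] at this
    have h5 : ∀ j < n - L, z.2 j ⬝ᵥ l < z.2 (n - L) ⬝ᵥ l := by
      intro j hj
      -- before the previous regeneration time `m`, use that `m` was a record of the whole path
      rcases lt_or_ge j m with h | h
      · have h6 := i4 j h
        rcases Nat.eq_or_lt_of_le (show m ≤ n - L by omega) with h7 | h7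
        · rwa [← h7]
        · exact h6.trans (c2 m le_rfl h7)
      · exact c2 j h hj
    refine ⟨by omega, h5, h3, fun j hj => ?_⟩
    rcases lt_or_ge j (n - L) with h | h
    · have := h5 j h
      omega
    · have := hcl (j - (n - L)) (n - j) (by omega)
      rw [show n - L + (j - (n - L)) = j by omega, show j + (n - j) = n by omega] at this
      push_cast [hj.le] at this
      omega

lemma cylWeight_eq_zero_of_not_obeys (κ : ℝ) {n : ℕ} {z : Walk l} (hz : ¬ Obeys n z) (ω : Env d) :
    cylWeight κ n z.1 z.2 ω = 0 := by
  unfold Obeys at hz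
  push Not at hz
  obtain ⟨i, hi, h0, h1⟩ := hz
  refine Finset.prod_eq_zero (Finset.mem_range.2 hi) ?_
  rw [jumpProb_of_ne_zero κ ω h0, if_neg h1, mul_zero]

/-- The probability of a history that ends at a regeneration time depends only on the environment
strictly behind the record made `L` steps earlier, since the last `L` letters are nonzero. -/
lemma measurable_cylWeight (hl : l ≠ 0) (hL : 0 < L) (κ : ℝ) {k n : ℕ} {z : Walk l}
    (ht : walkTau l ζ L (k + 1) z = n) :
    Measurable[envSigma {x : Site d | x ⬝ᵥ l < z.2 n ⬝ᵥ l - L}] (cylWeight κ n z.1 z.2) := by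
  by_cases hz : Obeys n z
  · obtain ⟨r1, r2, r3, -⟩ := walkTau_record hl hL k hz ht
    obtain ⟨m, -, h1, -⟩ := walkTau_succ_eq_coe.1 ht
    obtain ⟨-, -, c3⟩ := walkTau_candidate h1 ht
    unfold cylWeight
    refine Finset.measurable_prod _ fun i hi => Measurable.const_mul ?_ _
    -- steps before the record start at sites behind it; the later ones are forced by the letters
    rcases lt_or_ge i (n - L) with h | h
    · refine jumpProb_measurable_site κ _ _ _ ?_
      have := r2 i h
      rw [Set.mem_ofPred_eq]
      omega
    · have hi' := Finset.mem_range.1 hi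
      have := c3 (i - (n - L)) (by omega)
      rw [show n - L + (i - (n - L)) = i by omega] at this
      have h0 : (z.1 i : Site d) ≠ 0 := by rw [this]; exact epsBar_ne_zero hl _
      simp only [jumpProb_of_ne_zero κ _ h0]
      exact measurable_const
  -- histories that disobey the letters have probability zero in every environment
  · have : cylWeight κ n z.1 z.2 = fun _ => 0 :=
      funext fun ω => cylWeight_eq_zero_of_not_obeys κ hz ω
    rw [this]
    exact measurable_const

end Records

/-! ### Conditional estimates at a regeneration time -/

section Renewal

variable {d : ℕ} {l : Site d} {ζ : ℝ} {L : ℕ}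

lemma envSigma_le (A : Set (Site d)) : envSigma A ≤ (inferInstance : MeasurableSpace (Env d)) :=
  iSup₂_le fun z _ => (measurable_pi_apply z).comap_le

lemma measurable_shift_envSigma (v : Site d) {A B : Set (Site d)} (h : ∀ y ∈ A, v + y ∈ B) :
    Measurable[envSigma B, envSigma A] (shift v : Env d → Env d) := by
  rw [measurable_iff_comap_le]
  simp only [MeasurableSpace.comap_iSup, MeasurableSpace.comap_comp]
  exact iSup₂_le fun y hy => le_iSup₂_of_le (v + y) (h y hy) le_rfl

lemma shift_shift_neg (v : Site d) (ω : Env d) : shift (-v) (shift v ω) = ω := by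
  funext y; simp [shift]

/-- The event that `τ_k = n` and that letters and path up to time `n` are those of `z`. -/
def atom (l : Site d) (ζ : ℝ) (L k n : ℕ) (z : Walk l) : Set (Space l) :=
  toWalk ⁻¹' (cyl n z.1 z.2 ∩ {z' | walkTau l ζ L k z' = n})

lemma measurableSet_atom (k n : ℕ) (z : Walk l) : MeasurableSet (atom l ζ L k n z) :=
  measurable_toWalk ((measurableSet_cyl n z.1 z.2).inter
    ((measurable_walkTau k) (measurableSet_singleton (n : ℕ∞))))

lemma agree_of_mem_cyl {n : ℕ} {z z' : Walk l} (h : z' ∈ cyl n z.1 z.2) : Agree n z z' :=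
  ⟨fun i hi => (h.1 i hi).symm, fun i hi => (h.2 i hi).symm⟩

/-- Given the history, `τ_k = n` is the event that the walk never leaves its cone after `n`. -/
lemma atom_eq (hζ : 0 ≤ ζ) {k n : ℕ} {z : Walk l} (ht : walkTau l ζ L (k + 1) z = n) :
    atom l ζ L (k + 1) n z = toWalk ⁻¹' (cyl n z.1 z.2 ∩ after n ⁻¹' confined l ζ) := by
  unfold atom
  congr 1
  ext z'
  refine and_congr_right fun hz' => ⟨fun h => exitCone_walkTau h, fun h => ?_⟩
  have := walkTau_agree hζ (k + 1) (agree_of_mem_cyl hz') ht h (k + 1) le_rfl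
  exact this.trans ht

lemma mem_confined_translate {v : Site d} {z : Walk l} :
    translate v z ∈ confined l ζ ↔ z ∈ confined l ζ := by
  change exitCone l ζ (fun i => z.2 i - v) = ⊤ ↔ exitCone l ζ z.2 = ⊤
  rw [exitCone_sub]

/-- The history contributes its probability in the given environment, and the rest of the walk is
a walk confined to its cone, in the environment seen from its position at the regeneration time. -/
lemma setLIntegral_atom (P : Measure (Env d)) [IsProbabilityMeasure P] (κ : ℝ) (hζ : 0 ≤ ζ)
    {f : Walk l → ℝ≥0∞} (hf : Measurable f) {k n : ℕ} {z : Walk l}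
    (ht : walkTau l ζ L (k + 1) z = n) :
    ∫⁻ p in atom l ζ L (k + 1) n z, f (recenter n (toWalk p)) ∂(extAnnealed P l κ) =
      ∫⁻ ω, ({0} : Set (Site d)).indicator 1 (z.2 0) * cylWeight κ n z.1 z.2 ω *
        ∫⁻ z' in confined l ζ, f z' ∂(walkLaw l κ (shift (z.2 n) ω, 0)) ∂P := by
  have hmc : MeasurableSet (confined l ζ) := measurableSet_confined
  have hfm : Measurable fun p : Space l => f (recenter n (toWalk p)) :=
    hf.comp ((measurable_recenter n).comp measurable_toWalk)
  rw [← lintegral_indicator (measurableSet_atom _ _ _), lintegral_extAnnealed P κ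
    (hfm.indicator (measurableSet_atom _ _ _)), atom_eq hζ ht]
  refine lintegral_congr fun ω => ?_
  have hF : Measurable ((confined l ζ).indicator f ∘ translate (z.2 n)) :=
    (hf.indicator hmc).comp (measurable_translate _)
  have hM := walkLaw_markov κ n z.1 z.2 ω 0 hF
  have e1 : ∫⁻ z', ((confined l ζ).indicator f ∘ translate (z.2 n)) z' ∂(walkLaw l κ (ω, z.2 n)) =
      ∫⁻ z' in confined l ζ, f z' ∂(walkLaw l κ (shift (z.2 n) ω, 0)) := by
    rw [← walkLaw_translate, ← lintegral_indicator hmc,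
      lintegral_map (hf.indicator hmc) (measurable_translate _)]
    rfl
  rw [← e1, ← hM, ← lintegral_indicator (measurableSet_cyl n z.1 z.2)]
  refine lintegral_congr fun z' => ?_
  by_cases h1 : z' ∈ cyl n z.1 z.2
  · rw [Set.indicator_of_mem h1]
    have e2 : recenter n z' = translate (z.2 n) (after n z') := by
      unfold recenter translate after
      rw [h1.2 n le_rfl]
    by_cases h2 : after n z' ∈ confined l ζ
    · have h3 : ((ω, z'.1), z'.2) ∈ toWalk ⁻¹' (cyl n z.1 z.2 ∩ after n ⁻¹' confined l ζ) :=
        ⟨h1, h2⟩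
      rw [Set.indicator_of_mem h3, Function.comp_apply,
        Set.indicator_of_mem (mem_confined_translate.2 h2)]
      exact congrArg f e2
    · have h3 : ((ω, z'.1), z'.2) ∉ toWalk ⁻¹' (cyl n z.1 z.2 ∩ after n ⁻¹' confined l ζ) :=
        fun h => h2 h.2
      rw [Set.indicator_of_notMem h3, Function.comp_apply,
        Set.indicator_of_notMem (mem_confined_translate.not.2 h2)]
  · have h3 : ((ω, z'.1), z'.2) ∉ toWalk ⁻¹' (cyl n z.1 z.2 ∩ after n ⁻¹' confined l ζ) :=
      fun h => h1 h.1
    rw [Set.indicator_of_notMem h1, Set.indicator_of_notMem h3]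

/-- A conditional bound on the walk given that it never leaves its cone and given the environment
far behind the origin carries over to the walk after a regeneration time, given its history. -/
lemma setLIntegral_atom_le (P : Measure (Env d)) [IsProbabilityMeasure P]
    (hP : ∀ x : Site d, MeasurePreserving (shift x) P P) (hl : l ≠ 0) (hL : 0 < L) (hζ : 0 ≤ ζ)
    (κ : ℝ) {f : Walk l → ℝ≥0∞} (hf : Measurable f) (C : ℝ≥0∞)
    (hC : ∀ h : Env d → ℝ≥0∞, Measurable[envSigma {y : Site d | y ⬝ᵥ l < -(L : ℤ)}] h →
      ∫⁻ ω, h ω * ∫⁻ z in confined l ζ, f z ∂(walkLaw l κ (ω, 0)) ∂P ≤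
        C * ∫⁻ ω, h ω * walkLaw l κ (ω, 0) (confined l ζ) ∂P)
    {k n : ℕ} {z : Walk l} (ht : walkTau l ζ L (k + 1) z = n) :
    ∫⁻ p in atom l ζ L (k + 1) n z, f (recenter n (toWalk p)) ∂(extAnnealed P l κ) ≤
      C * extAnnealed P l κ (atom l ζ L (k + 1) n z) := by
  have hmc : MeasurableSet (confined l ζ) := measurableSet_confined
  -- the probability of the history, as seen from its end point
  set h : Env d → ℝ≥0∞ := fun ω => ({0} : Set (Site d)).indicator 1 (z.2 0) *
    cylWeight κ n z.1 z.2 (shift (-z.2 n) ω) with hh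
  have hmeas : Measurable[envSigma {y : Site d | y ⬝ᵥ l < -(L : ℤ)}] h := by
    refine Measurable.const_mul ?_ _
    refine (measurable_cylWeight hl hL κ ht).comp (measurable_shift_envSigma _ fun y hy => ?_)
    rw [Set.mem_ofPred_eq] at hy ⊢
    rw [add_dotProduct, neg_dotProduct]
    linarith
  have key : ∀ g : Walk l → ℝ≥0∞, Measurable g →
      ∫⁻ p in atom l ζ L (k + 1) n z, g (recenter n (toWalk p)) ∂(extAnnealed P l κ) =
        ∫⁻ ω, h ω * ∫⁻ z in confined l ζ, g z ∂(walkLaw l κ (ω, 0)) ∂P := by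
    intro g hg
    rw [setLIntegral_atom P κ hζ hg ht]
    have hG : Measurable fun ω : Env d => ∫⁻ z in confined l ζ, g z ∂(walkLaw l κ (ω, 0)) := by
      simp only [← lintegral_indicator hmc]
      exact (hg.indicator hmc).lintegral_kernel.comp (measurable_id.prodMk measurable_const)
    have hm : Measurable fun ω => h ω * ∫⁻ z in confined l ζ, g z ∂(walkLaw l κ (ω, 0)) :=
      (hmeas.mono (envSigma_le _) le_rfl).mul hG
    rw [← (hP (z.2 n)).lintegral_comp hm]
    refine lintegral_congr fun ω => ?_
    simp only [hh, shift_shift_neg]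
  have k1 := key f hf
  have k2 := key (fun _ => 1) measurable_const
  simp only [setLIntegral_one] at k2
  rw [k1, k2]
  exact hC h hmeas

end Renewal

/-! ### Renewal and integrability in integrated form -/

section Hypotheses

variable {d : ℕ} {l : Site d} {ζ : ℝ} {L : ℕ}

lemma calF_le : calF l L ≤ (inferInstance : MeasurableSpace (Space l)) := by
  intro s hs
  obtain ⟨A, hA, rfl⟩ := hs
  have h : Measurable fun p : Space l => p.1.1 := by fun_prop
  exact h (envSigma_le _ A hA)

/-- The integrability hypothesis, integrated against functions of the environment far behind the
origin. -/
lemma lintegral_mul_le_of_condLExp_le (P : Measure (Env d)) [IsProbabilityMeasure P] (κ : ℝ)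
    (hD : extAnnealed P l κ (neverExits l ζ) ≠ 0) {f : Walk l → ℝ≥0∞} (hf : Measurable f)
    {C : ℝ≥0∞}
    (hM : ∀ᵐ p ∂(cond (extAnnealed P l κ) (neverExits l ζ)),
      condLExp (calF l L) (cond (extAnnealed P l κ) (neverExits l ζ)) (fun q => f (toWalk q)) p
        ≤ C)
    (h : Env d → ℝ≥0∞) (hh : Measurable[envSigma {y : Site d | y ⬝ᵥ l < -(L : ℤ)}] h) :
    ∫⁻ ω, h ω * ∫⁻ z in confined l ζ, f z ∂(walkLaw l κ (ω, 0)) ∂P ≤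
      C * ∫⁻ ω, h ω * walkLaw l κ (ω, 0) (confined l ζ) ∂P := by
  have hle := envSigma_le {y : Site d | y ⬝ᵥ l < -(L : ℤ)}
  have hmc : MeasurableSet (confined l ζ) := measurableSet_confined
  have hmD : MeasurableSet (neverExits l ζ) := measurable_toWalk hmc
  have := cond_isProbabilityMeasure hD
  set G : Env d → ℝ≥0∞ := fun ω => ∫⁻ z in confined l ζ, f z ∂(walkLaw l κ (ω, 0)) with hG
  set g : Env d → ℝ≥0∞ := fun ω => walkLaw l κ (ω, 0) (confined l ζ) with hg
  have hGm : Measurable G := by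
    simp only [hG, ← lintegral_indicator hmc]
    exact (hf.indicator hmc).lintegral_kernel.comp (measurable_id.prodMk measurable_const)
  have hgm : Measurable g :=
    (Kernel.measurable_coe _ hmc).comp (measurable_id.prodMk measurable_const)
  have hset : ∀ A, MeasurableSet[envSigma {y : Site d | y ⬝ᵥ l < -(L : ℤ)}] A →
      ∫⁻ ω in A, G ω ∂P ≤ C * ∫⁻ ω in A, g ω ∂P := by
    intro A hA
    have hA' : MeasurableSet A := hle A hA
    set A' : Set (Space l) := (fun p : Space l => p.1.1) ⁻¹' A with hA'd
    have hAm : MeasurableSet A' := (by fun_prop : Measurable fun p : Space l => p.1.1) hA'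
    have h1 : ∫⁻ q in A', f (toWalk q) ∂(cond (extAnnealed P l κ) (neverExits l ζ)) ≤
        C * cond (extAnnealed P l κ) (neverExits l ζ) A' := by
      rw [← setLIntegral_condLExp calF_le _ _ (⟨A, hA, rfl⟩ : MeasurableSet[calF l L] A'),
        ← setLIntegral_const]
      exact setLIntegral_mono_ae measurable_const.aemeasurable (hM.mono fun p hp _ => hp)
    have hfm : Measurable fun q : Space l => f (toWalk q) := hf.comp measurable_toWalk
    have e1 : ∫⁻ q in A', f (toWalk q) ∂(cond (extAnnealed P l κ) (neverExits l ζ)) =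
        (extAnnealed P l κ (neverExits l ζ))⁻¹ * ∫⁻ ω in A, G ω ∂P := by
      unfold ProbabilityTheory.cond
      rw [Measure.restrict_smul, lintegral_smul_measure, smul_eq_mul,
        Measure.restrict_restrict hAm, ← lintegral_indicator (hAm.inter hmD),
        lintegral_extAnnealed P κ (hfm.indicator (hAm.inter hmD)),
        ← lintegral_indicator hA']
      congr 1
      refine lintegral_congr fun ω => ?_
      by_cases hω : ω ∈ A
      · rw [Set.indicator_of_mem hω, hG]
        beta_reduce
        rw [← lintegral_indicator hmc]
        refine lintegral_congr fun z => ?_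
        by_cases hz : z ∈ confined l ζ
        · rw [Set.indicator_of_mem hz, Set.indicator_of_mem (by exact ⟨hω, hz⟩)]; rfl
        · rw [Set.indicator_of_notMem hz, Set.indicator_of_notMem (by exact fun h => hz h.2)]
      · rw [Set.indicator_of_notMem hω, ← lintegral_zero]
        refine lintegral_congr fun z => ?_
        rw [Set.indicator_of_notMem (by exact fun h => hω h.1)]
    have e2 : cond (extAnnealed P l κ) (neverExits l ζ) A' =
        (extAnnealed P l κ (neverExits l ζ))⁻¹ * ∫⁻ ω in A, g ω ∂P := by
      rw [cond_apply hmD, Set.inter_comm, extAnnealed_apply P κ (hAm.inter hmD),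
        ← lintegral_indicator hA']
      congr 1
      refine lintegral_congr fun ω => ?_
      by_cases hω : ω ∈ A
      · rw [Set.indicator_of_mem hω, hg]
        congr 1
        ext z
        exact and_iff_right hω
      · rw [Set.indicator_of_notMem hω]
        have he : {z : Walk l | ((ω, z.1), z.2) ∈ A' ∩ neverExits l ζ} = ∅ :=
          Set.eq_empty_of_forall_notMem fun z hz => hω hz.1
        rw [he, measure_empty]
    rw [e1, e2, mul_left_comm] at h1
    exact (ENNReal.mul_le_mul_iff_right (ENNReal.inv_ne_zero.2 (measure_ne_top _ _))
      (ENNReal.inv_ne_top.2 hD)).1 h1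
  -- from indicators to functions: the inequality is one between measures on the small `σ`-algebra
  have hmeas : (P.withDensity G).trim hle ≤ (P.withDensity fun ω => C * g ω).trim hle := by
    refine Measure.le_iff.2 fun A hA => ?_
    rw [trim_measurableSet_eq hle hA, trim_measurableSet_eq hle hA,
      withDensity_apply _ (hle A hA), withDensity_apply _ (hle A hA), lintegral_const_mul _ hgm]
    exact hset A hA
  have hh' : Measurable h := hh.mono hle le_rfl
  have i1 : ∫⁻ ω, h ω * G ω ∂P = ∫⁻ ω, h ω ∂((P.withDensity G).trim hle) := by
    rw [lintegral_trim hle hh, lintegral_withDensity_eq_lintegral_mul _ hGm hh']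
    exact lintegral_congr fun ω => mul_comm _ _
  have i2 : C * ∫⁻ ω, h ω * g ω ∂P =
      ∫⁻ ω, h ω ∂((P.withDensity fun ω => C * g ω).trim hle) := by
    rw [lintegral_trim hle hh, lintegral_withDensity_eq_lintegral_mul _ (hgm.const_mul C) hh',
      ← lintegral_const_mul C (f := fun ω => h ω * g ω) (hh'.mul hgm)]
    refine lintegral_congr fun ω => ?_
    simp only [Pi.mul_apply]
    ring
  rw [i1, i2]
  exact lintegral_mono' hmeas le_rfl

lemma measurable_tau (k : ℕ) : Measurable (tau l ζ L k) := by
  have : tau l ζ L k = walkTau l ζ L k ∘ toWalk := funext fun p => tau_eq k p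
  rw [this]
  exact (measurable_walkTau k).comp measurable_toWalk

lemma measurable_position_random {T : Space l → ℕ} (hT : Measurable T) :
    Measurable fun p : Space l => p.2 (T p) :=
  measurable_random_index (f := fun n (p : Space l) => p.2 n) (fun n => by fun_prop) hT

lemma calH_le (k : ℕ) : calH l ζ L k ≤ (inferInstance : MeasurableSpace (Space l)) := by
  classical
  have ht := measurable_tau (l := l) (ζ := ζ) (L := L) k
  refine sup_le (sup_le (sup_le ?_ ?_) ?_) ?_
  · exact iSup₂_le fun i _ => (measurable_tau i).comap_le
  · refine iSup_le fun n => Measurable.comap_le ?_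
    exact measurable_position_random
      ((measurable_of_countable fun t : ℕ∞ => (min (n : ℕ∞) t).toNat).comp ht)
  · refine iSup_le fun n => Measurable.comap_le ?_
    refine Measurable.ite (ht (MeasurableSet.of_discrete (s := {t : ℕ∞ | (n : ℕ∞) < t}))) ?_
      measurable_const
    exact (measurable_of_countable fun a : Letter l => (a : Site d)).comp
      ((measurable_pi_apply n).comp (measurable_snd.comp measurable_fst))
  · refine iSup_le fun y => Measurable.comap_le ?_
    refine Measurable.ite ?_ ?_ measurable_const
    · exact (measurable_position_random (measurable_toNat ht)) (MeasurableSet.of_discrete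
        (s := {x : Site d | ((y ⬝ᵥ l : ℤ) : ℝ) < ((x ⬝ᵥ l : ℤ) : ℝ)
          - (L : ℝ) * ‖toReal l‖ ^ 2 / (normOne l : ℝ)}))
    · exact measurable_subtype_coe.comp
        ((measurable_pi_apply y).comp (measurable_fst.comp measurable_fst))

lemma measurableSet_calH_atom {k : ℕ} (hk : 1 ≤ k) (n : ℕ) (z : Walk l) :
    MeasurableSet[calH l ζ L k] (atom l ζ L k n z) := by
  classical
  have ht : Measurable[calH l ζ L k] (tau l ζ L k) := by
    rw [measurable_iff_comap_le]
    refine le_trans ?_ (le_sup_of_le_left (le_sup_of_le_left le_sup_left))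
    exact le_iSup₂_of_le k (Finset.mem_Icc.2 ⟨hk, le_rfl⟩) le_rfl
  have hx : ∀ i : ℕ, Measurable[calH l ζ L k]
      fun p : Space l => p.2 (min (i : ℕ∞) (tau l ζ L k p)).toNat := by
    intro i
    rw [measurable_iff_comap_le]
    refine le_trans ?_ (le_sup_of_le_left (le_sup_of_le_left le_sup_right))
    exact le_iSup_of_le i le_rfl
  have he : ∀ i : ℕ, Measurable[calH l ζ L k]
      fun p : Space l => if (i : ℕ∞) < tau l ζ L k p then (p.1.2 i : Site d) else 0 := by
    intro i
    rw [measurable_iff_comap_le]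
    refine le_trans ?_ (le_sup_of_le_left le_sup_right)
    exact le_iSup_of_le i le_rfl
  have : atom l ζ L k n z = tau l ζ L k ⁻¹' {(n : ℕ∞)} ∩
      ((⋂ i, ⋂ (_ : i < n), (fun p : Space l =>
          if (i : ℕ∞) < tau l ζ L k p then (p.1.2 i : Site d) else 0) ⁻¹' {(z.1 i : Site d)}) ∩
        ⋂ i, ⋂ (_ : i ≤ n), (fun p : Space l =>
          p.2 (min (i : ℕ∞) (tau l ζ L k p)).toNat) ⁻¹' {z.2 i}) := by
    ext p
    simp only [Set.mem_inter_iff, Set.mem_preimage, Set.mem_singleton_iff, Set.mem_iInter]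
    rw [show p ∈ atom l ζ L k n z ↔ tau l ζ L k p = n ∧ toWalk p ∈ cyl n z.1 z.2 by
      rw [tau_eq, and_comm]; rfl]
    refine and_congr_right fun hp => and_congr ?_ ?_
    · refine forall₂_congr fun i hi => ?_
      rw [hp, if_pos (by exact_mod_cast hi), Subtype.ext_iff]
      rfl
    · refine forall₂_congr fun i hi => ?_
      rw [hp, min_eq_left (by exact_mod_cast hi), ENat.toNat_natCast]
      rfl
  rw [this]
  refine MeasurableSet.inter (ht (measurableSet_singleton _)) (MeasurableSet.inter ?_ ?_)
  · exact MeasurableSet.iInter fun i => MeasurableSet.iInter fun _ =>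
      he i (measurableSet_singleton _)
  · exact MeasurableSet.iInter fun i => MeasurableSet.iInter fun _ =>
      hx i (measurableSet_singleton _)

/-- The supremum in `varDist` is one-sided; the other side comes from the complement. -/
lemma abs_sub_le_of_varDist_le {α : Type*} [MeasurableSpace α] {μ ν : Measure α}
    [IsProbabilityMeasure μ] [IsProbabilityMeasure ν] {c : ℝ} (h : varDist μ ν ≤ c) {B : Set α}
    (hB : MeasurableSet B) : |μ.real B - ν.real B| ≤ c := by
  have hb : BddAbove (Set.range fun A : {A : Set α // MeasurableSet A} =>
      μ.real A - ν.real A) := by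
    refine ⟨1, ?_⟩
    rintro _ ⟨A, rfl⟩
    have h1 : μ.real A ≤ 1 := measureReal_le_one
    have h2 : 0 ≤ ν.real A := measureReal_nonneg
    simp only
    linarith
  have h1 : μ.real B - ν.real B ≤ varDist μ ν := le_ciSup hb ⟨B, hB⟩
  have h2 : μ.real Bᶜ - ν.real Bᶜ ≤ varDist μ ν := le_ciSup hb ⟨Bᶜ, hB.compl⟩
  rw [probReal_compl_eq_one_sub hB, probReal_compl_eq_one_sub hB] at h2
  rw [abs_le]
  constructor <;> linarith

/-- The law of the path given that it never leaves its cone. -/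
def confinedPathLaw (P : Measure (Env d)) (l : Site d) (κ ζ : ℝ) : Measure (ℕ → Site d) :=
  (cond (extAnnealed P l κ) (neverExits l ζ)).map fun q : Space l => q.2

/-- The path after `τ_k`, seen from the position at `τ_k`. -/
def pathAfter (l : Site d) (ζ : ℝ) (L k : ℕ) (q : Space l) : ℕ → Site d := fun n =>
  q.2 ((tau l ζ L k q).toNat + n) - q.2 (tau l ζ L k q).toNat

lemma measurable_pathAfter (k : ℕ) : Measurable (pathAfter l ζ L k) := by
  refine measurable_pi_lambda _ fun n => ?_
  have ht := measurable_toNat (measurable_tau (l := l) (ζ := ζ) (L := L) k)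
  exact (measurable_of_countable (fun q : Site d × Site d => q.1 - q.2)).comp
    ((measurable_position_random ((measurable_of_countable fun t : ℕ => t + n).comp ht)).prodMk
      (measurable_position_random ht))

/-- The approximate renewal hypothesis on a single history. -/
lemma abs_atom_inter_sub_le (P : Measure (Env d)) [IsProbabilityMeasure P] (κ : ℝ)
    (hD : extAnnealed P l κ (neverExits l ζ) ≠ 0) {k : ℕ} (hk : 1 ≤ k) {c : ℝ}
    (hR : ∀ᵐ p ∂(extAnnealed P l κ),
      varDist ((condExpKernel (extAnnealed P l κ) (calH l ζ L k) p).map (pathAfter l ζ L k))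
        (confinedPathLaw P l κ ζ) ≤ c)
    (n : ℕ) (z : Walk l) {B : Set (ℕ → Site d)} (hB : MeasurableSet B) :
    |(extAnnealed P l κ).real (atom l ζ L k n z ∩ pathAfter l ζ L k ⁻¹' B) -
      (extAnnealed P l κ).real (atom l ζ L k n z) * (confinedPathLaw P l κ ζ).real B| ≤
      c * (extAnnealed P l κ).real (atom l ζ L k n z) := by
  have := cond_isProbabilityMeasure hD
  have hsnd : Measurable fun q : Space l => q.2 := measurable_snd
  have : IsProbabilityMeasure (confinedPathLaw P l κ ζ) :=
    Measure.isProbabilityMeasure_map hsnd.aemeasurable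
  have hpm := measurable_pathAfter (l := l) (ζ := ζ) (L := L) k
  set μ := extAnnealed P l κ
  set A := atom l ζ L k n z
  have hA : MeasurableSet A := measurableSet_atom k n z
  have hB' : MeasurableSet (pathAfter l ζ L k ⁻¹' B) := hpm hB
  have h1 := condExpKernel_ae_eq_condExp (μ := μ) (calH_le (l := l) (ζ := ζ) (L := L) k) hB'
  have h2 : ∀ᵐ p ∂μ, |(μ⟦pathAfter l ζ L k ⁻¹' B | calH l ζ L k⟧) p -
      (confinedPathLaw P l κ ζ).real B| ≤ c := by
    filter_upwards [h1, hR] with p hp1 hp2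
    rw [← hp1]
    have : IsProbabilityMeasure ((condExpKernel μ (calH l ζ L k) p).map (pathAfter l ζ L k)) :=
      Measure.isProbabilityMeasure_map hpm.aemeasurable
    have h3 := abs_sub_le_of_varDist_le hp2 hB
    rwa [map_measureReal_apply hpm hB] at h3
  have h3 : ∫ p in A, (μ⟦pathAfter l ζ L k ⁻¹' B | calH l ζ L k⟧) p ∂μ =
      μ.real (A ∩ pathAfter l ζ L k ⁻¹' B) := by
    rw [setIntegral_condExp (calH_le k) ((integrable_const (1 : ℝ)).indicator hB')
      (measurableSet_calH_atom hk n z), setIntegral_indicator hB', setIntegral_const, smul_eq_mul,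
      mul_one]
  have h4 : ∫ p in A, ((μ⟦pathAfter l ζ L k ⁻¹' B | calH l ζ L k⟧) p -
      (confinedPathLaw P l κ ζ).real B) ∂μ =
      μ.real (A ∩ pathAfter l ζ L k ⁻¹' B) - μ.real A * (confinedPathLaw P l κ ζ).real B := by
    rw [integral_sub integrable_condExp.integrableOn (integrable_const _), h3, setIntegral_const,
      smul_eq_mul]
  rw [← h4, ← Real.norm_eq_abs]
  exact norm_setIntegral_le_of_norm_le_const_ae (measure_lt_top _ _)
    (ae_restrict_of_ae (h2.mono fun p hp => hp))

end Hypotheses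

/-! ### Strong laws for adapted sequences -/

section StrongLaw

/-- Kronecker's lemma. -/
lemma sum_div_tendsto_zero {a : ℕ → ℝ} {s : ℝ}
    (h : Tendsto (fun n : ℕ => ∑ k ∈ Finset.range n, a k / (k + 1)) atTop (𝓝 s)) :
    Tendsto (fun n : ℕ => (n : ℝ)⁻¹ * ∑ k ∈ Finset.range n, a k) atTop (𝓝 0) := by
  set S : ℕ → ℝ := fun n => ∑ k ∈ Finset.range n, a k / (k + 1) with hS
  have key : ∀ n : ℕ, ∑ k ∈ Finset.range n, a k = n * S n - ∑ k ∈ Finset.range n, S k := by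
    intro n
    induction n with
    | zero => simp
    | succ n ih =>
      have e : S (n + 1) = S n + a n / (n + 1) := by simp only [hS]; rw [Finset.sum_range_succ]
      rw [Finset.sum_range_succ, Finset.sum_range_succ, ih, e]
      push_cast
      field_simp
      ring
  have h2 := h.sub h.cesaro
  rw [sub_self] at h2
  refine h2.congr' ?_
  filter_upwards [eventually_gt_atTop 0] with n hn
  have hn' : (n : ℝ) ≠ 0 := by exact_mod_cast hn.ne'
  rw [key n]
  field_simp

variable {Ω : Type*} {mΩ : MeasurableSpace Ω} {μ : Measure Ω} [IsProbabilityMeasure μ]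

/-- The strong law for martingale increments with summable weighted variances: the weighted sums
are a martingale bounded in `L²`, hence converge, and Kronecker's lemma applies. -/
lemma ae_tendsto_sum_sub_condExp (𝒢 : Filtration ℕ mΩ) {V : ℕ → Ω → ℝ}
    (hV : ∀ k, StronglyMeasurable[𝒢 (k + 1)] (V k)) (hV2 : ∀ k, MemLp (V k) 2 μ) {b : ℕ → ℝ}
    (hb : ∀ k, ∫ ω, V k ω ^ 2 ∂μ ≤ b k) (hsum : Summable fun k : ℕ => b k / ((k : ℝ) + 1) ^ 2) :
    ∀ᵐ ω ∂μ, Tendsto (fun n : ℕ => (n : ℝ)⁻¹ *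
      ∑ k ∈ Finset.range n, (V k ω - (μ[V k | 𝒢 k]) ω)) atTop (𝓝 0) := by
  set D : ℕ → Ω → ℝ := fun k => ((k : ℝ) + 1)⁻¹ • (V k - μ[V k | 𝒢 k]) with hD
  have hD2 : ∀ k, MemLp (D k) 2 μ := fun k =>
    ((hV2 k).sub ((hV2 k).condExp one_le_two)).const_smul _
  have hDm : ∀ k, StronglyMeasurable[𝒢 (k + 1)] (D k) := fun k =>
    ((hV k).sub (stronglyMeasurable_condExp.mono (𝒢.mono k.le_succ))).const_smul _
  have hDi : ∀ k, Integrable (D k) μ := fun k => (hD2 k).integrable one_le_two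
  have hDc : ∀ k, μ[D k | 𝒢 k] =ᵐ[μ] 0 := by
    intro k
    have hVi := (hV2 k).integrable one_le_two
    have h1 := condExp_smul (μ := μ) ((k : ℝ) + 1)⁻¹ (V k - μ[V k | 𝒢 k]) (𝒢 k)
    have h2 := condExp_sub hVi (integrable_condExp (μ := μ) (m := 𝒢 k) (f := V k)) (𝒢 k)
    have h3 : μ[μ[V k | 𝒢 k] | 𝒢 k] = μ[V k | 𝒢 k] :=
      condExp_of_stronglyMeasurable (𝒢.le k) stronglyMeasurable_condExp integrable_condExp
    filter_upwards [h1, h2] with ω g1 g2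
    rw [g1, Pi.smul_apply, g2, h3]
    simp
  set M : ℕ → Ω → ℝ := fun n => ∑ k ∈ Finset.range n, D k with hM
  have hMs : ∀ n, M (n + 1) = M n + D n := fun n => Finset.sum_range_succ _ _
  have hM2 : ∀ n, MemLp (M n) 2 μ := fun n => memLp_finsetSum' _ fun k _ => hD2 k
  have hMm : ∀ n, StronglyMeasurable[𝒢 n] (M n) := fun n =>
    Finset.stronglyMeasurable_sum _ fun k hk =>
      (hDm k).mono (𝒢.mono (Finset.mem_range.1 hk))
  have hMi : ∀ n, Integrable (M n) μ := fun n => (hM2 n).integrable one_le_two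
  have hmart : Martingale M 𝒢 μ := by
    refine martingale_nat hMm hMi fun n => ?_
    rw [hMs]
    have h1 := condExp_add (hMi n) (hDi n) (𝒢 n)
    filter_upwards [h1, hDc n] with ω g1 g2
    rw [g1, Pi.add_apply, g2, condExp_of_stronglyMeasurable (𝒢.le n) (hMm n) (hMi n)]
    simp
  -- increments are orthogonal to the past
  have horth : ∀ n, ∫ ω, M n ω * D n ω ∂μ = 0 := by
    intro n
    have h1 := condExp_mul_of_stronglyMeasurable_left (hMm n) ((hM2 n).integrable_mul (hD2 n))
      (hDi n)
    have h2 : ∫ ω, (μ[M n * D n | 𝒢 n]) ω ∂μ = ∫ ω, M n ω * D n ω ∂μ := integral_condExp (𝒢.le n)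
    rw [← h2, ← integral_zero Ω ℝ (μ := μ)]
    refine integral_congr_ae ?_
    filter_upwards [h1, hDc n] with ω g1 g2
    rw [g1, Pi.mul_apply, g2]
    simp
  have hDsq : ∀ k : ℕ, ∫ ω, D k ω ^ 2 ∂μ ≤ b k / ((k : ℝ) + 1) ^ 2 := by
    intro k
    have e : ∀ ω, D k ω ^ 2 = (((k : ℝ) + 1) ^ 2)⁻¹ * (V k ω - (μ[V k | 𝒢 k]) ω) ^ 2 := by
      intro ω
      simp only [hD, Pi.smul_apply, Pi.sub_apply, smul_eq_mul, mul_pow, inv_pow]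
    simp only [e]
    rw [integral_const_mul, div_eq_inv_mul]
    refine mul_le_mul_of_nonneg_left ?_ (by positivity)
    have h1 := integral_condVar_add_variance_condExp (μ := μ) (𝒢.le k) (hV2 k)
    have h2 : ∫ ω, (Var[V k; μ | 𝒢 k]) ω ∂μ = ∫ ω, (V k ω - (μ[V k | 𝒢 k]) ω) ^ 2 ∂μ :=
      integral_condExp (𝒢.le k)
    have h3 : Var[V k; μ] ≤ ∫ ω, V k ω ^ 2 ∂μ :=
      variance_le_expectation_sq (hV2 k).aestronglyMeasurable
    have h4 := variance_nonneg (μ[V k | 𝒢 k]) μ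
    rw [h2] at h1
    linarith [hb k]
  set S : ℝ := ∑' k : ℕ, b k / ((k : ℝ) + 1) ^ 2 with hSdef
  have hnn : ∀ k : ℕ, 0 ≤ b k / ((k : ℝ) + 1) ^ 2 := fun k =>
    le_trans (integral_nonneg fun ω => sq_nonneg _) (hDsq k)
  have hMsq : ∀ n, ∫ ω, M n ω ^ 2 ∂μ ≤ ∑ k ∈ Finset.range n, b k / ((k : ℝ) + 1) ^ 2 := by
    intro n
    induction n with
    | zero => simp [hM]
    | succ n ih =>
      rw [Finset.sum_range_succ]
      have e : ∀ ω, M (n + 1) ω ^ 2 = M n ω ^ 2 + 2 * (M n ω * D n ω) + D n ω ^ 2 := by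
        intro ω; rw [hMs, Pi.add_apply]; ring
      simp only [e]
      have i1 : Integrable (fun ω => M n ω ^ 2) μ := (hM2 n).integrable_sq
      have i2 : Integrable (fun ω => 2 * (M n ω * D n ω)) μ :=
        ((hM2 n).integrable_mul (hD2 n)).const_mul 2
      have i3 : Integrable (fun ω => D n ω ^ 2) μ := (hD2 n).integrable_sq
      have i12 : Integrable (fun ω => M n ω ^ 2 + 2 * (M n ω * D n ω)) μ := i1.add i2
      rw [integral_add i12 i3, integral_add i1 i2, integral_const_mul, horth n]
      linarith [hDsq n]
  have hbd : ∀ n, eLpNorm (M n) 1 μ ≤ ((1 + S).toNNReal : ℝ≥0∞) := by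
    intro n
    have h1 : ∫ ω, ‖M n ω‖ ∂μ ≤ 1 + S := by
      calc ∫ ω, ‖M n ω‖ ∂μ ≤ ∫ ω, (1 + M n ω ^ 2) ∂μ := by
            refine integral_mono (hMi n).norm ((integrable_const 1).add (hM2 n).integrable_sq) ?_
            intro ω
            change |M n ω| ≤ 1 + M n ω ^ 2
            nlinarith [sq_abs (M n ω), sq_nonneg (|M n ω| - 1), abs_nonneg (M n ω)]
        _ = 1 + ∫ ω, M n ω ^ 2 ∂μ := by
            rw [integral_add (integrable_const 1) (hM2 n).integrable_sq]; simp
        _ ≤ 1 + S := by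
            have := hsum.sum_le_tsum (Finset.range n) (fun k _ => hnn k)
            linarith [hMsq n]
    rw [eLpNorm_one_eq_lintegral_enorm, ← ofReal_integral_norm_eq_lintegral_enorm (hMi n)]
    exact ENNReal.ofReal_le_ofReal h1
  filter_upwards [hmart.submartingale.exists_ae_tendsto_of_bdd hbd] with ω hω
  obtain ⟨c, hc⟩ := hω
  refine sum_div_tendsto_zero (s := c) ?_
  convert! hc using 2 with n
  simp only [hM, hD, Finset.sum_apply, Pi.smul_apply, Pi.sub_apply, smul_eq_mul]
  exact Finset.sum_congr rfl fun k _ => by rw [div_eq_inv_mul]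

lemma summable_const_div_sq (c : ℝ) : Summable fun k : ℕ => c / ((k : ℝ) + 1) ^ 2 := by
  have := (summable_nat_add_iff 1).2 (Real.summable_one_div_nat_pow.2 one_lt_two)
  refine (this.mul_left c).congr fun k => ?_
  push_cast
  rw [mul_one_div]

/-- The strong law for bounded sequences whose `k`-th term is known at time `k + N`, by telescoping
the conditional expectations at the times `k, k + 1, …, k + N`. -/
lemma ae_tendsto_sum_sub_condExp_lag (𝒢 : Filtration ℕ mΩ) {D : ℕ → Ω → ℝ} {C : ℝ} {N : ℕ}
    (hD : ∀ k, StronglyMeasurable[𝒢 (k + N)] (D k)) (hC : ∀ k ω, |D k ω| ≤ C) :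
    ∀ᵐ ω ∂μ, Tendsto (fun n : ℕ => (n : ℝ)⁻¹ *
      ∑ k ∈ Finset.range n, (D k ω - (μ[D k | 𝒢 k]) ω)) atTop (𝓝 0) := by
  have hDm : ∀ k, AEStronglyMeasurable (D k) μ := fun k =>
    ((hD k).mono (𝒢.le _)).aestronglyMeasurable
  have hD2 : ∀ k, MemLp (D k) 2 μ := fun k =>
    MemLp.of_bound (hDm k) C (Eventually.of_forall fun ω => hC k ω)
  have hstep : ∀ i : ℕ, ∀ᵐ ω ∂μ, Tendsto (fun n : ℕ => (n : ℝ)⁻¹ *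
      ∑ k ∈ Finset.range n, ((μ[D k | 𝒢 (k + i)]) ω - (μ[D k | 𝒢 k]) ω)) atTop (𝓝 0) := by
    intro i
    induction i with
    | zero => exact Eventually.of_forall fun ω => by simp
    | succ i ih =>
      set 𝒢' : Filtration ℕ mΩ := ⟨fun k => 𝒢 (k + i),
        fun a b hab => 𝒢.mono (Nat.add_le_add_right hab i), fun k => 𝒢.le _⟩ with h𝒢'
      have hV2 : ∀ k, MemLp (μ[D k | 𝒢 (k + i + 1)]) 2 μ := fun k => (hD2 k).condExp one_le_two
      have hbound : ∀ k, ∫ ω, (μ[D k | 𝒢 (k + i + 1)]) ω ^ 2 ∂μ ≤ |C| ^ 2 := by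
        intro k
        have h1 : ∀ᵐ ω ∂μ, |(μ[D k | 𝒢 (k + i + 1)]) ω| ≤ |C| := by
          exact ae_bdd_abs_condExp_of_ae_bdd_abs (μ := μ) (m := 𝒢 (k + i + 1)) (R := |C|)
            (f := D k) (Eventually.of_forall fun ω => (hC k ω).trans (le_abs_self C))
        calc ∫ ω, (μ[D k | 𝒢 (k + i + 1)]) ω ^ 2 ∂μ ≤ ∫ _, |C| ^ 2 ∂μ := by
              refine integral_mono_ae (hV2 k).integrable_sq (integrable_const _) ?_
              filter_upwards [h1] with ω hω
              exact sq_le_sq.2 (by rwa [abs_abs])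
          _ = |C| ^ 2 := by simp
      have h := ae_tendsto_sum_sub_condExp (μ := μ) 𝒢' (V := fun k => μ[D k | 𝒢 (k + i + 1)])
        (fun k => by
          have e : 𝒢' (k + 1) = 𝒢 (k + i + 1) := congrArg 𝒢 (by omega)
          rw [e]; exact stronglyMeasurable_condExp) hV2 hbound (summable_const_div_sq _)
      have hc : ∀ᵐ ω ∂μ, ∀ k,
          (μ[μ[D k | 𝒢 (k + i + 1)] | 𝒢' k]) ω = (μ[D k | 𝒢 (k + i)]) ω := by
        rw [ae_all_iff]
        intro k
        exact condExp_condExp_of_le (𝒢.mono (Nat.le_succ _)) (𝒢.le _)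
      filter_upwards [ih, h, hc] with ω g1 g2 g3
      have g4 := g1.add g2
      rw [add_zero] at g4
      refine g4.congr fun n => ?_
      rw [← mul_add, ← Finset.sum_add_distrib]
      congr 1
      refine Finset.sum_congr rfl fun k _ => ?_
      rw [g3 k, ← add_assoc k i 1]
      ring
  filter_upwards [hstep N] with ω hω
  refine hω.congr fun n => ?_
  congr 1
  refine Finset.sum_congr rfl fun k _ => ?_
  rw [condExp_of_stronglyMeasurable (𝒢.le _) (hD k) ((hD2 k).integrable one_le_two)]

lemma condExp_le_const_of_setIntegral_le {m : MeasurableSpace Ω} (hm : m ≤ mΩ) {V : Ω → ℝ}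
    (hV : Integrable V μ) {c : ℝ}
    (h : ∀ A, MeasurableSet[m] A → ∫ ω in A, V ω ∂μ ≤ c * μ.real A) :
    ∀ᵐ ω ∂μ, (μ[V | m]) ω ≤ c := by
  have hms : MeasurableSet[m] {ω | c < (μ[V | m]) ω} :=
    stronglyMeasurable_condExp.measurable measurableSet_Ioi
  have h1 := h _ hms
  rw [← setIntegral_condExp hm hV hms] at h1
  have hi : IntegrableOn (fun ω => (μ[V | m]) ω - c) {ω | c < (μ[V | m]) ω} μ :=
    (integrable_condExp.sub (integrable_const c)).integrableOn
  have h2 : ∫ ω in {ω | c < (μ[V | m]) ω}, ((μ[V | m]) ω - c) ∂μ ≤ 0 := by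
    rw [integral_sub integrable_condExp.integrableOn (integrable_const c).integrableOn,
      setIntegral_const, smul_eq_mul]
    linarith
  have h3 : μ {ω | c < (μ[V | m]) ω} = 0 := by
    by_contra hne
    have hpos : 0 < ∫ ω in {ω | c < (μ[V | m]) ω}, ((μ[V | m]) ω - c) ∂μ := by
      rw [setIntegral_pos_iff_support_of_nonneg_ae _ hi]
      · refine lt_of_lt_of_le (pos_iff_ne_zero.2 hne) (measure_mono fun ω hω => ⟨?_, hω⟩)
        exact (sub_pos.2 hω).ne'
      · filter_upwards [ae_restrict_mem (hm _ hms)] with ω hω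
        exact (sub_pos.2 hω).le
    linarith
  rw [ae_iff]
  simpa using h3

lemma const_le_condExp_of_le_setIntegral {m : MeasurableSpace Ω} (hm : m ≤ mΩ) {V : Ω → ℝ}
    (hV : Integrable V μ) {c : ℝ}
    (h : ∀ A, MeasurableSet[m] A → c * μ.real A ≤ ∫ ω in A, V ω ∂μ) :
    ∀ᵐ ω ∂μ, c ≤ (μ[V | m]) ω := by
  have h1 := condExp_le_const_of_setIntegral_le hm hV.neg (c := -c) fun A hA => by
    simp only [Pi.neg_apply, integral_neg]
    linarith [h A hA]
  filter_upwards [h1, condExp_neg V m (μ := μ)] with ω g1 g2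
  rw [g2, Pi.neg_apply] at g1
  linarith

/-- A strong law for the large terms of a sequence with bounded conditional moments of an order
`α > 1`: terms larger than the index are absent from some point on, and the others are square
integrable with a summable weighted variance. -/
lemma ae_sum_tail_le (𝒢 : Filtration ℕ mΩ) {ξ : ℕ → Ω → ℝ} (h0 : ∀ k ω, 0 ≤ ξ k ω)
    (hξ : ∀ k, StronglyMeasurable[𝒢 (k + 1)] (ξ k)) {α M : ℝ} (hα : 1 < α) (hα2 : α ≤ 2)
    (hM : 0 ≤ M)
    (hmom : ∀ k A, MeasurableSet[𝒢 k] A →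
      ∫⁻ ω in A, ENNReal.ofReal (ξ k ω ^ α) ∂μ ≤ ENNReal.ofReal M * μ A)
    {B : ℝ} (hB : 0 < B) :
    ∀ᵐ ω ∂μ, ∀ δ, M * B ^ (1 - α) < δ → ∀ᶠ n : ℕ in atTop,
      ∑ k ∈ Finset.range n, (if B < ξ k ω then ξ k ω else 0) ≤ δ * n := by
  have hα0 : 0 < α := by linarith
  -- the large terms, truncated at the index to make them square integrable
  set V : ℕ → Ω → ℝ := fun k ω => if B < ξ k ω ∧ ξ k ω ≤ k + 1 then ξ k ω else 0 with hV
  have hξm : ∀ k, Measurable (ξ k) := fun k => ((hξ k).mono (𝒢.le _)).measurable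
  have hVm : ∀ k, StronglyMeasurable[𝒢 (k + 1)] (V k) := by
    intro k
    have hm := (hξ k).measurable
    refine (Measurable.ite ?_ hm measurable_const).stronglyMeasurable
    exact (hm measurableSet_Ioi).inter (hm measurableSet_Iic)
  have hV0 : ∀ k ω, 0 ≤ V k ω := by
    intro k ω; simp only [hV]; split_ifs; exacts [h0 k ω, le_rfl]
  have hVb : ∀ k ω, V k ω ≤ k + 1 := by
    intro k ω; simp only [hV]; split_ifs with h; exacts [h.2, by positivity]
  have hV2 : ∀ k, MemLp (V k) 2 μ := fun k =>
    MemLp.of_bound ((hVm k).mono (𝒢.le _)).aestronglyMeasurable (k + 1)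
      (Eventually.of_forall fun ω => by
        rw [Real.norm_eq_abs, abs_of_nonneg (hV0 k ω)]; exact hVb k ω)
  have hpm : ∀ k, Measurable fun ω => ξ k ω ^ α := fun k => (hξm k).pow_const α
  have hp0 : ∀ k ω, 0 ≤ ξ k ω ^ α := fun k ω => Real.rpow_nonneg (h0 k ω) α
  have hpi : ∀ k, Integrable (fun ω => ξ k ω ^ α) μ := by
    intro k
    refine ⟨(hpm k).aestronglyMeasurable, ?_⟩
    rw [hasFiniteIntegral_iff_ofReal (Eventually.of_forall (hp0 k))]
    have := hmom k Set.univ MeasurableSet.univ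
    rw [Measure.restrict_univ] at this
    exact lt_of_le_of_lt this (ENNReal.mul_lt_top ENNReal.ofReal_lt_top (measure_lt_top _ _))
  have hset : ∀ k A, MeasurableSet[𝒢 k] A → ∫ ω in A, ξ k ω ^ α ∂μ ≤ M * μ.real A := by
    intro k A hA
    rw [integral_eq_lintegral_of_nonneg_ae (Eventually.of_forall (hp0 k))
      (hpm k).aestronglyMeasurable]
    refine ENNReal.toReal_le_of_le_ofReal (by positivity) ((hmom k A hA).trans_eq ?_)
    rw [ENNReal.ofReal_mul hM, Measure.real, ENNReal.ofReal_toReal (measure_ne_top _ _)]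
  have hV1 : ∀ k ω, V k ω ≤ B ^ (1 - α) * ξ k ω ^ α := by
    intro k ω
    simp only [hV]
    split_ifs with h
    · have hpos : 0 < ξ k ω := hB.trans h.1
      calc ξ k ω = ξ k ω ^ (1 - α) * ξ k ω ^ α := by
            rw [← Real.rpow_add hpos]; simp
        _ ≤ B ^ (1 - α) * ξ k ω ^ α := by
            refine mul_le_mul_of_nonneg_right ?_ (hp0 k ω)
            exact Real.rpow_le_rpow_of_nonpos hB h.1.le (by linarith)
    · exact mul_nonneg (Real.rpow_nonneg hB.le _) (hp0 k ω)
  have hVsq : ∀ k : ℕ, ∀ ω, V k ω ^ 2 ≤ ((k : ℝ) + 1) ^ (2 - α) * ξ k ω ^ α := by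
    intro k ω
    simp only [hV]
    split_ifs with h
    · have hpos : 0 < ξ k ω := hB.trans h.1
      calc ξ k ω ^ 2 = ξ k ω ^ (2 - α) * ξ k ω ^ α := by
            rw [← Real.rpow_add hpos, ← Real.rpow_natCast]; norm_num
        _ ≤ _ := by
            refine mul_le_mul_of_nonneg_right ?_ (hp0 k ω)
            exact Real.rpow_le_rpow hpos.le h.2 (by linarith)
    · have : (0 : ℝ) ≤ ((k : ℝ) + 1) ^ (2 - α) := Real.rpow_nonneg (by positivity) _
      simpa using mul_nonneg this (hp0 k ω)
  have hb : ∀ k : ℕ, ∫ ω, V k ω ^ 2 ∂μ ≤ ((k : ℝ) + 1) ^ (2 - α) * M := by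
    intro k
    calc ∫ ω, V k ω ^ 2 ∂μ ≤ ∫ ω, ((k : ℝ) + 1) ^ (2 - α) * ξ k ω ^ α ∂μ :=
          integral_mono (hV2 k).integrable_sq ((hpi k).const_mul _) (hVsq k)
      _ ≤ _ := by
          rw [integral_const_mul]
          refine mul_le_mul_of_nonneg_left ?_ (Real.rpow_nonneg (by positivity) _)
          have := hset k Set.univ MeasurableSet.univ
          simpa using this
  have hsα : Summable fun k : ℕ => ((k : ℝ) + 1) ^ (-α) := by
    have := (summable_nat_add_iff 1).2 (Real.summable_nat_rpow.2 (by linarith : -α < -1))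
    refine this.congr fun k => by push_cast; rfl
  have hsum : Summable fun k : ℕ => ((k : ℝ) + 1) ^ (2 - α) * M / ((k : ℝ) + 1) ^ 2 := by
    refine (hsα.mul_left M).congr fun k => ?_
    have hk : (0 : ℝ) < (k : ℝ) + 1 := by positivity
    have e : ((k : ℝ) + 1) ^ (2 - α) = ((k : ℝ) + 1) ^ 2 * ((k : ℝ) + 1) ^ (-α) := by
      rw [← Real.rpow_natCast ((k : ℝ) + 1) 2, ← Real.rpow_add hk]
      norm_num [sub_eq_add_neg]
    rw [e]
    field_simp
  have h1 := ae_tendsto_sum_sub_condExp 𝒢 hVm hV2 hb hsum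
  have h2 : ∀ᵐ ω ∂μ, ∀ k, (μ[V k | 𝒢 k]) ω ≤ M * B ^ (1 - α) := by
    rw [ae_all_iff]
    intro k
    refine condExp_le_const_of_setIntegral_le (𝒢.le k) ((hV2 k).integrable one_le_two) ?_
    intro A hA
    calc ∫ ω in A, V k ω ∂μ ≤ ∫ ω in A, B ^ (1 - α) * ξ k ω ^ α ∂μ :=
          integral_mono ((hV2 k).integrable one_le_two).integrableOn
            ((hpi k).const_mul _).integrableOn (hV1 k)
      _ = B ^ (1 - α) * ∫ ω in A, ξ k ω ^ α ∂μ := integral_const_mul _ _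
      _ ≤ B ^ (1 - α) * (M * μ.real A) :=
          mul_le_mul_of_nonneg_left (hset k A hA) (Real.rpow_nonneg hB.le _)
      _ = _ := by ring
  -- Borel-Cantelli: eventually no term exceeds its index
  have h3 : ∀ᵐ ω ∂μ, ∀ᶠ k : ℕ in atTop, ω ∉ {ω | (k : ℝ) + 1 < ξ k ω} := by
    refine ae_eventually_notMem (ne_top_of_le_ne_top (b := ∑' k : ℕ,
      ENNReal.ofReal (M * ((k : ℝ) + 1) ^ (-α))) ?_ ?_)
    · rw [← ENNReal.ofReal_tsum_of_nonneg (fun k => mul_nonneg hM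
        (Real.rpow_nonneg (by positivity) _)) (hsα.mul_left M)]
      exact ENNReal.ofReal_ne_top
    · refine ENNReal.tsum_le_tsum fun k => ?_
      have hk : (0 : ℝ) < (k : ℝ) + 1 := by positivity
      have g1 : μ {ω | (k : ℝ) + 1 < ξ k ω} ≤
          μ {ω | ENNReal.ofReal (((k : ℝ) + 1) ^ α) ≤ ENNReal.ofReal (ξ k ω ^ α)} :=
        measure_mono fun ω hω =>
          ENNReal.ofReal_le_ofReal (Real.rpow_le_rpow hk.le (le_of_lt hω) hα0.le)
      have g2 := mul_meas_ge_le_lintegral (μ := μ) (hpm k).ennreal_ofReal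
        (ENNReal.ofReal (((k : ℝ) + 1) ^ α))
      have g3 := hmom k Set.univ MeasurableSet.univ
      rw [Measure.restrict_univ, measure_univ, mul_one] at g3
      have hkα : (0 : ℝ) < ((k : ℝ) + 1) ^ α := Real.rpow_pos_of_pos hk _
      have g4 : ENNReal.ofReal (((k : ℝ) + 1) ^ α) * μ {ω | (k : ℝ) + 1 < ξ k ω} ≤
          ENNReal.ofReal M := (mul_le_mul_right g1 _).trans (g2.trans g3)
      rw [Real.rpow_neg hk.le, ← div_eq_mul_inv, ENNReal.ofReal_div_of_pos hkα]
      rw [ENNReal.le_div_iff_mul_le (Or.inl (ENNReal.ofReal_pos.2 hkα).ne')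
        (Or.inl ENNReal.ofReal_ne_top), mul_comm]
      exact g4
  filter_upwards [h1, h2, h3] with ω g1 g2 g3 δ hδ
  obtain ⟨K, hK⟩ := eventually_atTop.1 g3
  set R : ℝ := ∑ k ∈ Finset.range K, ξ k ω with hR
  have hle : ∀ n : ℕ, ∑ k ∈ Finset.range n, (if B < ξ k ω then ξ k ω else 0) ≤
      ∑ k ∈ Finset.range n, V k ω + R := by
    intro n
    have e : ∀ k, (if B < ξ k ω then ξ k ω else 0) ≤ V k ω + (if k < K then ξ k ω else 0) := by
      intro k
      by_cases hk : k < K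
      · rw [if_pos hk]
        have := hV0 k ω
        split_ifs
        · linarith
        · linarith [h0 k ω]
      · have := hK k (not_lt.1 hk)
        rw [not_lt] at this
        simp only [hV, this, hk, if_false, and_true, add_zero, le_refl]
    refine (Finset.sum_le_sum fun k _ => e k).trans ?_
    rw [Finset.sum_add_distrib]
    have e' : ∑ k ∈ Finset.range n, (if k < K then ξ k ω else 0) ≤ R := by
      rw [← Finset.sum_filter]
      exact Finset.sum_le_sum_of_subset_of_nonneg
        (fun k hk => Finset.mem_range.2 (Finset.mem_filter.1 hk).2) fun k _ _ => h0 k ω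
    linarith
  have hlim : Tendsto (fun n : ℕ => (n : ℝ)⁻¹ *
      ∑ k ∈ Finset.range n, (V k ω - (μ[V k | 𝒢 k]) ω) + (n : ℝ)⁻¹ * R) atTop (𝓝 0) := by
    have := g1.add ((tendsto_inv_atTop_nhds_zero_nat (𝕜 := ℝ)).mul_const R)
    simpa using this
  filter_upwards [hlim.eventually (gt_mem_nhds (sub_pos.2 hδ)), eventually_gt_atTop 0]
    with n hn hn0
  have hn' : (0 : ℝ) < n := by exact_mod_cast hn0
  have e1 : ∑ k ∈ Finset.range n, V k ω ≤
      ∑ k ∈ Finset.range n, (V k ω - (μ[V k | 𝒢 k]) ω) + n * (M * B ^ (1 - α)) := by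
    rw [Finset.sum_sub_distrib]
    have : ∑ k ∈ Finset.range n, (μ[V k | 𝒢 k]) ω ≤ n * (M * B ^ (1 - α)) := by
      refine (Finset.sum_le_sum fun k _ => g2 k).trans ?_
      simp
    linarith
  have e2 : ∑ k ∈ Finset.range n, (V k ω - (μ[V k | 𝒢 k]) ω) + R <
      (δ - M * B ^ (1 - α)) * n := by
    rw [← mul_add, inv_mul_lt_iff₀ hn'] at hn
    linarith
  have := hle n
  nlinarith

end StrongLaw

/-! ### Averages along an approximate renewal sequence -/

section Smoothing

lemma abs_sub_le_of_lipschitz {x : ℕ → ℝ} (hx : ∀ n, |x (n + 1) - x n| ≤ 1) (a j : ℕ) :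
    |x (a + j) - x a| ≤ j := by
  induction j with
  | zero => simp
  | succ j ih =>
    have := abs_sub_le (x (a + (j + 1))) (x (a + j)) (x a)
    have h := hx (a + j)
    rw [add_assoc] at h
    push_cast
    linarith

lemma sum_Ico_shift_sub (x : ℕ → ℝ) (N a b : ℕ) (hab : a ≤ b) :
    ∑ t ∈ Finset.Ico a b, (x (t + N) - x t) = ∑ j ∈ Finset.range N, (x (b + j) - x (a + j)) := by
  induction b, hab using Nat.le_induction with
  | base => simp
  | succ b hab ih =>
    rw [Finset.sum_Ico_succ_top hab, ih]
    have h1 : ∑ j ∈ Finset.range N, (x (b + 1 + j) - x (b + j)) = x (b + N) - x b := by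
      have := Finset.sum_range_sub (fun j => x (b + j)) N
      simp only [add_zero] at this
      rw [← this]
      refine Finset.sum_congr rfl fun j _ => ?_
      rw [add_assoc, add_comm 1 j]
    rw [← h1, ← Finset.sum_add_distrib]
    exact Finset.sum_congr rfl fun j _ => by ring

/-- Smoothing over windows of length `N`: the displacement between the times `T 0` and `T K` is,
up to boundary terms, the average of the window increments `x (t + N) - x t`; within a block
`[T k, T (k+1))` of length at most `B` these are replaced by the window increment at its right end,
whose weight, the length of the block, is then known when the window starts. -/
lemma abs_smoothing_le {x : ℕ → ℝ} (hx : ∀ n, |x (n + 1) - x n| ≤ 1) {T : ℕ → ℕ}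
    (hT : StrictMono T) {N : ℕ} {B c : ℝ} (hB : 0 ≤ B)
    (hc : |c| ≤ 1) (K : ℕ) :
    N * |x (T K) - x (T 0) - c * ((T K : ℝ) - T 0)| ≤
      2 * N * N + |∑ k ∈ Finset.range K,
        (if ((T (k + 1) : ℝ) - T k) ≤ B then ((T (k + 1) : ℝ) - T k) else 0) *
          (x (T (k + 1) + N) - x (T (k + 1)) - N * c)| + 2 * B * ((T K : ℝ) - T 0) +
        2 * N * ∑ k ∈ Finset.range K,
          (if B < ((T (k + 1) : ℝ) - T k) then ((T (k + 1) : ℝ) - T k) else 0) := by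
  have hblock : ∀ k, |∑ t ∈ Finset.Ico (T k) (T (k + 1)), (x (t + N) - x t - N * c) -
      (if ((T (k + 1) : ℝ) - T k) ≤ B then ((T (k + 1) : ℝ) - T k) else 0) *
          (x (T (k + 1) + N) - x (T (k + 1)) - N * c)| ≤
      2 * B * (if ((T (k + 1) : ℝ) - T k) ≤ B then ((T (k + 1) : ℝ) - T k) else 0) +
        2 * N * (if B < ((T (k + 1) : ℝ) - T k) then ((T (k + 1) : ℝ) - T k) else 0) := by
    intro k
    have hlt := hT (Nat.lt_succ_self k)
    have hcard : ((Finset.Ico (T k) (T (k + 1))).card : ℝ) = (T (k + 1) : ℝ) - T k := by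
      rw [Nat.card_Ico, Nat.cast_sub hlt.le]
    have hNc : |(N : ℝ) * c| ≤ N := by
      rw [abs_mul, Nat.abs_cast]
      exact mul_le_of_le_one_right (Nat.cast_nonneg _) hc
    by_cases h : ((T (k + 1) : ℝ) - T k) ≤ B
    · rw [if_pos h, if_neg (not_lt.2 h), mul_zero, add_zero]
      have e : ∑ t ∈ Finset.Ico (T k) (T (k + 1)), (x (t + N) - x t - N * c) -
          ((T (k + 1) : ℝ) - T k) * (x (T (k + 1) + N) - x (T (k + 1)) - N * c) =
          ∑ t ∈ Finset.Ico (T k) (T (k + 1)), ((x (T (k + 1)) - x t) -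
            (x (T (k + 1) + N) - x (t + N))) := by
        have e0 : ((T (k + 1) : ℝ) - T k) * (x (T (k + 1) + N) - x (T (k + 1)) - N * c) =
            ∑ t ∈ Finset.Ico (T k) (T (k + 1)), (x (T (k + 1) + N) - x (T (k + 1)) - N * c) := by
          rw [Finset.sum_const, nsmul_eq_mul, hcard]
        rw [e0, ← Finset.sum_sub_distrib]
        exact Finset.sum_congr rfl fun t _ => by ring
      rw [e]
      refine (Finset.abs_sum_le_sum_abs _ _).trans ?_
      calc _ ≤ ∑ t ∈ Finset.Ico (T k) (T (k + 1)), 2 * B := by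
            refine Finset.sum_le_sum fun t ht => ?_
            rw [Finset.mem_Ico] at ht
            obtain ⟨j, hj⟩ := Nat.exists_eq_add_of_le ht.2.le
            have h1 := abs_sub_le_of_lipschitz hx t j
            have h2 := abs_sub_le_of_lipschitz hx (t + N) j
            have hjB : (j : ℝ) ≤ B := by
              have : (T k : ℝ) ≤ t := by exact_mod_cast ht.1
              have h3 : (T (k + 1) : ℝ) = t + j := by exact_mod_cast hj
              linarith
            rw [hj, show t + j + N = t + N + j by omega]
            refine (abs_sub _ _).trans ?_
            linarith
        _ = _ := by rw [Finset.sum_const, nsmul_eq_mul, hcard]; ring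
    · rw [if_neg h, if_pos (not_le.1 h), mul_zero, zero_mul, sub_zero, zero_add]
      refine (Finset.abs_sum_le_sum_abs _ _).trans ?_
      calc _ ≤ ∑ t ∈ Finset.Ico (T k) (T (k + 1)), 2 * (N : ℝ) := by
            refine Finset.sum_le_sum fun t _ => ?_
            have h1 := abs_sub_le_of_lipschitz hx t N
            refine (abs_sub _ _).trans ?_
            linarith
        _ = _ := by rw [Finset.sum_const, nsmul_eq_mul, hcard]; ring
  have hsplit : ∀ f : ℕ → ℝ, ∑ t ∈ Finset.Ico (T 0) (T K), f t =
      ∑ k ∈ Finset.range K, ∑ t ∈ Finset.Ico (T k) (T (k + 1)), f t := by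
    intro f
    induction K with
    | zero => simp
    | succ K ih =>
      rw [Finset.sum_range_succ, ← ih, Finset.sum_Ico_consecutive _ (hT.monotone (Nat.zero_le _))
        (hT.monotone (Nat.le_succ _))]
  have htel : ∑ k ∈ Finset.range K, ((T (k + 1) : ℝ) - T k) = (T K : ℝ) - T 0 :=
    Finset.sum_range_sub (fun k => (T k : ℝ)) K
  have hnn : ∀ k, 0 < ((T (k + 1) : ℝ) - T k) := fun k =>
    sub_pos.2 (by exact_mod_cast hT (Nat.lt_succ_self k))
  set w : ℕ → ℝ := fun k => if ((T (k + 1) : ℝ) - T k) ≤ B then ((T (k + 1) : ℝ) - T k) else 0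
  set r : ℕ → ℝ := fun k => if B < ((T (k + 1) : ℝ) - T k) then ((T (k + 1) : ℝ) - T k) else 0
  have hmain : |∑ t ∈ Finset.Ico (T 0) (T K), (x (t + N) - x t - N * c) -
      ∑ k ∈ Finset.range K, w k * (x (T (k + 1) + N) - x (T (k + 1)) - N * c)| ≤
      2 * B * ((T K : ℝ) - T 0) + 2 * N * ∑ k ∈ Finset.range K, r k := by
    rw [hsplit, ← Finset.sum_sub_distrib, ← htel, Finset.mul_sum, Finset.mul_sum,
      ← Finset.sum_add_distrib]
    refine (Finset.abs_sum_le_sum_abs _ _).trans (Finset.sum_le_sum fun k _ => ?_)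
    refine (hblock k).trans ?_
    have : 2 * B * w k ≤ 2 * B * ((T (k + 1) : ℝ) - T k) := by
      simp only [w]
      split_ifs with h
      · exact le_rfl
      · rw [mul_zero]; exact mul_nonneg (by linarith) (hnn k).le
    simp only [r]
    linarith
  have hle : T 0 ≤ T K := hT.monotone (Nat.zero_le _)
  have e1 : ∑ t ∈ Finset.Ico (T 0) (T K), (x (t + N) - x t - N * c) =
      ∑ j ∈ Finset.range N, (x (T K + j) - x (T 0 + j)) - ((T K : ℝ) - T 0) * (N * c) := by
    rw [Finset.sum_sub_distrib, sum_Ico_shift_sub x N _ _ hle, Finset.sum_const, nsmul_eq_mul,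
      Nat.card_Ico, Nat.cast_sub hle]
  have e2 : |∑ j ∈ Finset.range N, (x (T K + j) - x (T 0 + j)) - N * (x (T K) - x (T 0))| ≤
      2 * N * N := by
    have : (N : ℝ) * (x (T K) - x (T 0)) = ∑ j ∈ Finset.range N, (x (T K) - x (T 0)) := by
      rw [Finset.sum_const, nsmul_eq_mul, Finset.card_range]
    rw [this, ← Finset.sum_sub_distrib]
    refine (Finset.abs_sum_le_sum_abs _ _).trans ?_
    calc _ ≤ ∑ j ∈ Finset.range N, 2 * (N : ℝ) := by
          refine Finset.sum_le_sum fun j hj => ?_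
          have hj' : (j : ℝ) ≤ N := by exact_mod_cast (Finset.mem_range.1 hj).le
          have h1 := abs_sub_le_of_lipschitz hx (T K) j
          have h2 := abs_sub_le_of_lipschitz hx (T 0) j
          rw [show x (T K + j) - x (T 0 + j) - (x (T K) - x (T 0)) =
            (x (T K + j) - x (T K)) - (x (T 0 + j) - x (T 0)) by ring]
          refine (abs_sub _ _).trans ?_
          linarith
      _ = _ := by simp; ring
  rw [← Nat.abs_cast N, ← abs_mul, Nat.abs_cast]
  have e3 : (N : ℝ) * (x (T K) - x (T 0) - c * ((T K : ℝ) - T 0)) =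
      -(∑ j ∈ Finset.range N, (x (T K + j) - x (T 0 + j)) - N * (x (T K) - x (T 0))) +
      (∑ t ∈ Finset.Ico (T 0) (T K), (x (t + N) - x t - N * c) -
      ∑ k ∈ Finset.range K, w k * (x (T (k + 1) + N) - x (T (k + 1)) - N * c)) +
      ∑ k ∈ Finset.range K, w k * (x (T (k + 1) + N) - x (T (k + 1)) - N * c) := by
    rw [e1]; ring
  rw [e3]
  have a1 := abs_add_le (-(∑ j ∈ Finset.range N, (x (T K + j) - x (T 0 + j)) -
      N * (x (T K) - x (T 0))) + (∑ t ∈ Finset.Ico (T 0) (T K), (x (t + N) - x t - N * c) -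
      ∑ k ∈ Finset.range K, w k * (x (T (k + 1) + N) - x (T (k + 1)) - N * c)))
      (∑ k ∈ Finset.range K, w k * (x (T (k + 1) + N) - x (T (k + 1)) - N * c))
  have a2 := abs_add_le (-(∑ j ∈ Finset.range N, (x (T K + j) - x (T 0 + j)) -
      N * (x (T K) - x (T 0)))) (∑ t ∈ Finset.Ico (T 0) (T K), (x (t + N) - x t - N * c) -
      ∑ k ∈ Finset.range K, w k * (x (T (k + 1) + N) - x (T (k + 1)) - N * c))
  rw [abs_neg] at a2
  linarith

/-- If the blocks longer than `B` are negligible and the window increments, weighted with the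
lengths of the other blocks, have mean `N c` up to `N ρ`, then `c` is nearly the speed. -/
lemma eventually_abs_sub_le_of_smoothing {x : ℕ → ℝ} (hx : ∀ n, |x (n + 1) - x n| ≤ 1)
    {T : ℕ → ℕ} (hT : StrictMono T) {N : ℕ} (hN : 0 < N) {B c ρ δ : ℝ} (hB : 0 ≤ B)
    (hc : |c| ≤ 1) (hρ : 0 ≤ ρ) (hδ : 0 < δ)
    (h1 : ∀ᶠ K : ℕ in atTop, |∑ k ∈ Finset.range K,
        (if ((T (k + 1) : ℝ) - T k) ≤ B then ((T (k + 1) : ℝ) - T k) else 0) *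
          (x (T (k + 1) + N) - x (T (k + 1)) - N * c)| ≤ N * ρ * T K)
    (h2 : ∀ᶠ K : ℕ in atTop, ∑ k ∈ Finset.range K,
        (if B < ((T (k + 1) : ℝ) - T k) then ((T (k + 1) : ℝ) - T k) else 0) ≤ δ * K) :
    ∀ᶠ n : ℕ in atTop, |x n - c * n| ≤ (ρ + 2 * B / N + 5 * δ) * n := by
  obtain ⟨K₀, hK₀⟩ := eventually_atTop.1 (h1.and h2)
  have hN' : (0 : ℝ) < N := by exact_mod_cast hN
  have hlarge : ∀ᶠ n : ℕ in atTop, 2 * B + 2 * δ + 2 * N + |x (T 0)| + T 0 ≤ δ * n :=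
    (tendsto_natCast_atTop_atTop.const_mul_atTop hδ).eventually_ge_atTop _
  filter_upwards [eventually_ge_atTop (T K₀), hlarge] with n hn hnC
  -- the last block that starts by time `n`
  set K := Nat.findGreatest (fun K => T K ≤ n) n with hK
  have hK1 : K₀ ≤ K := Nat.le_findGreatest ((hT.id_le K₀).trans hn) hn
  have hK2 : T K ≤ n := Nat.findGreatest_spec (P := fun K => T K ≤ n)
    ((hT.id_le K₀).trans hn) hn
  have hK3 : n < T (K + 1) := by
    by_contra h
    have h := not_lt.1 h
    have := Nat.le_findGreatest (P := fun K => T K ≤ n) ((hT.id_le (K + 1)).trans h) h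
    rw [id, ← hK] at this
    omega
  have hKn : (K : ℝ) ≤ n := by exact_mod_cast (hT.id_le K).trans hK2
  have hTn : (T K : ℝ) ≤ n := by exact_mod_cast hK2
  have hnT : (n : ℝ) ≤ T (K + 1) := by exact_mod_cast hK3.le
  obtain ⟨g1, g2⟩ := hK₀ K hK1
  have g3 := (hK₀ (K + 1) (by omega)).2
  set r : ℕ → ℝ := fun k => if B < ((T (k + 1) : ℝ) - T k) then ((T (k + 1) : ℝ) - T k) else 0
    with hr
  have hpos : ∀ k, 0 < ((T (k + 1) : ℝ) - T k) := fun k =>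
    sub_pos.2 (by exact_mod_cast hT (Nat.lt_succ_self k))
  have hr0 : ∀ k, 0 ≤ r k := fun k => by
    simp only [hr]; split_ifs; exacts [(hpos k).le, le_rfl]
  have hξ : ((T (K + 1) : ℝ) - T K) ≤ B + δ * (K + 1) := by
    have h4 : r K ≤ ∑ k ∈ Finset.range (K + 1), r k :=
      Finset.single_le_sum (fun k _ => hr0 k) (Finset.mem_range.2 (Nat.lt_succ_self K))
    push_cast at g3
    have h5 : ((T (K + 1) : ℝ) - T K) ≤ B + r K := by
      simp only [hr]
      split_ifs with h
      · linarith
      · linarith [not_lt.1 h]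
    linarith
  have hs := abs_smoothing_le hx hT (N := N) hB hc K
  have hT0 : (0 : ℝ) ≤ T 0 := Nat.cast_nonneg _
  have hmid : |x (T K) - x (T 0) - c * ((T K : ℝ) - T 0)| ≤
      2 * N + ρ * T K + 2 * B / N * ((T K : ℝ) - T 0) + 2 * (δ * K) := by
    have e : (N : ℝ) * (2 * N + ρ * T K + 2 * B / N * ((T K : ℝ) - T 0) + 2 * (δ * K)) =
        2 * N * N + N * ρ * T K + 2 * B * ((T K : ℝ) - T 0) + 2 * N * (δ * K) := by
      field_simp
    refine le_of_mul_le_mul_left ?_ hN'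
    rw [e]
    have : 2 * (N : ℝ) * ∑ k ∈ Finset.range K, r k ≤ 2 * N * (δ * K) :=
      mul_le_mul_of_nonneg_left g2 (by positivity)
    linarith
  obtain ⟨j, hj⟩ := Nat.exists_eq_add_of_le hK2
  have hjr : (n : ℝ) = T K + j := by exact_mod_cast hj
  have hlip := abs_sub_le_of_lipschitz hx (T K) j
  rw [← hj] at hlip
  have hcm : ∀ a : ℝ, 0 ≤ a → |c * a| ≤ a := fun a ha => by
    rw [abs_mul, abs_of_nonneg ha]; exact mul_le_of_le_one_left ha hc
  have e : x n - c * n = (x n - x (T K)) + (-(c * j)) +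
      (x (T K) - x (T 0) - c * ((T K : ℝ) - T 0)) + (x (T 0) + -(c * T 0)) := by
    rw [hjr]; ring
  have a1 := abs_add_le ((x n - x (T K)) + (-(c * j)) +
      (x (T K) - x (T 0) - c * ((T K : ℝ) - T 0))) (x (T 0) + -(c * T 0))
  have a2 := abs_add_le ((x n - x (T K)) + (-(c * j)))
      (x (T K) - x (T 0) - c * ((T K : ℝ) - T 0))
  have a3 := abs_add_le (x n - x (T K)) (-(c * j))
  have a4 := abs_add_le (x (T 0)) (-(c * T 0))
  rw [abs_neg] at a3 a4
  have a5 := hcm j (Nat.cast_nonneg _)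
  have a6 := hcm (T 0) hT0
  have b1 : ρ * T K ≤ ρ * n := mul_le_mul_of_nonneg_left hTn hρ
  have b2 : 2 * B / N * ((T K : ℝ) - T 0) ≤ 2 * B / N * n :=
    mul_le_mul_of_nonneg_left (by linarith) (by positivity)
  have b3 : δ * K ≤ δ * n := mul_le_mul_of_nonneg_left hKn hδ.le
  rw [e]
  have e2 : (ρ + 2 * B / N + 5 * δ) * n = ρ * n + 2 * B / N * n + 5 * (δ * n) := by ring
  rw [e2]
  linarith

end Smoothing

section Approximate

variable {Ω : Type*} {mΩ : MeasurableSpace Ω} {μ : Measure Ω} [IsProbabilityMeasure μ]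

/-- A sequence of times with bounded conditional moments of an order `α > 1`, such that the
conditional mean of the window increment after each of them is `N c` up to `N ρ`: along it, the
speed of `x` is nearly `c`. -/
lemma ae_eventually_abs_sub_le (𝒢 : Filtration ℕ mΩ) {T : ℕ → Ω → ℕ}
    (hT : ∀ ω, StrictMono fun k => T k ω) (hTm : ∀ k, Measurable[𝒢 k] (T k))
    {N : ℕ} (hN : 0 < N) {Z : ℕ → Ω → ℝ} (hZ : ∀ k, StronglyMeasurable[𝒢 (k + N)] (Z k))
    (hZN : ∀ k ω, |Z k ω| ≤ N) {x : ℕ → Ω → ℝ}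
    (hx : ∀ᵐ ω ∂μ, ∀ n, |x (n + 1) ω - x n ω| ≤ 1)
    (hxZ : ∀ᵐ ω ∂μ, ∀ k, Z k ω = x (T k ω + N) ω - x (T k ω) ω)
    {c ρ α M B δ : ℝ} (hc : |c| ≤ 1) (hρ : 0 ≤ ρ)
    (hmean : ∀ k A, MeasurableSet[𝒢 k] A →
      |∫ ω in A, Z k ω ∂μ - N * c * μ.real A| ≤ N * ρ * μ.real A)
    (hα : 1 < α) (hα2 : α ≤ 2) (hM : 0 ≤ M)
    (hmom : ∀ k A, MeasurableSet[𝒢 k] A →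
      ∫⁻ ω in A, ENNReal.ofReal (((T (k + 1) ω : ℝ) - T k ω) ^ α) ∂μ ≤ ENNReal.ofReal M * μ A)
    (hB : 0 < B) (hδ : M * B ^ (1 - α) < δ) :
    ∀ᵐ ω ∂μ, ∀ᶠ n : ℕ in atTop, |x n ω - c * n| ≤ (ρ + 2 * B / N + 6 * δ) * n := by
  have hδ0 : 0 < δ := lt_of_le_of_lt (mul_nonneg hM (Real.rpow_nonneg hB.le _)) hδ
  have hN' : (0 : ℝ) < N := by exact_mod_cast hN
  have hTr : ∀ k, Measurable[𝒢 k] fun ω => (T k ω : ℝ) := fun k =>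
    (measurable_from_top (f := fun n : ℕ => (n : ℝ))).comp (hTm k)
  set ξ : ℕ → Ω → ℝ := fun k ω => (T (k + 1) ω : ℝ) - T k ω with hξ
  have hξm : ∀ k, Measurable[𝒢 (k + 1)] (ξ k) := fun k =>
    (hTr (k + 1)).sub ((hTr k).mono (𝒢.mono (Nat.le_succ k)) le_rfl)
  have hξ0 : ∀ k ω, 0 ≤ ξ k ω := fun k ω =>
    sub_nonneg.2 (by exact_mod_cast (hT ω (Nat.lt_succ_self k)).le)
  set w : ℕ → Ω → ℝ := fun k ω => if ξ k ω ≤ B then ξ k ω else 0 with hw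
  have hwm : ∀ k, Measurable[𝒢 (k + 1)] (w k) := fun k =>
    Measurable.ite (hξm k measurableSet_Iic) (hξm k) measurable_const
  have hw0 : ∀ k ω, 0 ≤ w k ω := fun k ω => by
    simp only [hw]; split_ifs; exacts [hξ0 k ω, le_rfl]
  have hwB : ∀ k ω, w k ω ≤ B := fun k ω => by
    simp only [hw]; split_ifs with h; exacts [h, hB.le]
  have hwξ : ∀ k ω, w k ω ≤ ξ k ω := fun k ω => by
    simp only [hw]; split_ifs with h; exacts [le_rfl, hξ0 k ω]
  have hZi : ∀ k, Integrable (Z k) μ := fun k =>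
    Integrable.of_bound ((hZ k).mono (𝒢.le _)).aestronglyMeasurable N
      (Eventually.of_forall fun ω => hZN k ω)
  -- the weight `w k` and the window increment after `T (k + 1)` meet at the index `k + 1`
  set 𝒢' : Filtration ℕ mΩ := ⟨fun k => 𝒢 (k + 1),
    fun a b hab => 𝒢.mono (Nat.add_le_add_right hab 1), fun k => 𝒢.le _⟩ with h𝒢'
  have htail := ae_sum_tail_le (μ := μ) 𝒢 hξ0 (fun k => (hξm k).stronglyMeasurable) hα hα2 hM
    hmom hB
  have hlaw := ae_tendsto_sum_sub_condExp_lag (μ := μ) 𝒢' (N := N) (C := B * N)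
    (D := fun k ω => w k ω * Z (k + 1) ω)
    (fun k => by
      have e : 𝒢' (k + N) = 𝒢 (k + 1 + N) := congrArg 𝒢 (by omega)
      rw [e]
      exact (((hwm k).mono (𝒢.mono (by omega)) le_rfl).stronglyMeasurable).mul (hZ (k + 1)))
    (fun k ω => by
      rw [abs_mul, abs_of_nonneg (hw0 k ω)]
      exact mul_le_mul (hwB k ω) (hZN _ ω) (abs_nonneg _) hB.le)
  have hpull : ∀ᵐ ω ∂μ, ∀ k, (μ[fun ω => w k ω * Z (k + 1) ω | 𝒢' k]) ω =
      w k ω * (μ[Z (k + 1) | 𝒢 (k + 1)]) ω := by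
    rw [ae_all_iff]
    intro k
    refine condExp_mul_of_stronglyMeasurable_left (m := 𝒢 (k + 1)) (hwm k).stronglyMeasurable ?_
      (hZi (k + 1))
    refine (hZi (k + 1)).bdd_mul (c := B)
      ((hwm k).stronglyMeasurable.mono (𝒢.le _)).aestronglyMeasurable
      (Eventually.of_forall fun ω => ?_)
    rw [Real.norm_eq_abs, abs_of_nonneg (hw0 k ω)]
    exact hwB k ω
  have hup : ∀ᵐ ω ∂μ, ∀ k, (μ[Z (k + 1) | 𝒢 (k + 1)]) ω ≤ N * c + N * ρ := by
    rw [ae_all_iff]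
    intro k
    refine condExp_le_const_of_setIntegral_le (𝒢.le _) (hZi _) fun A hA => ?_
    have := (abs_le.1 (hmean (k + 1) A hA)).2
    linarith
  have hlow : ∀ᵐ ω ∂μ, ∀ k, N * c - N * ρ ≤ (μ[Z (k + 1) | 𝒢 (k + 1)]) ω := by
    rw [ae_all_iff]
    intro k
    refine const_le_condExp_of_le_setIntegral (𝒢.le _) (hZi _) fun A hA => ?_
    have := (abs_le.1 (hmean (k + 1) A hA)).1
    linarith
  filter_upwards [hx, hxZ, htail, hlaw, hpull, hup, hlow] with ω g1 g2 g3 g4 g5 g6 g7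
  have h1 : ∀ᶠ K : ℕ in atTop, |∑ k ∈ Finset.range K, w k ω *
      (x (T (k + 1) ω + N) ω - x (T (k + 1) ω) ω - N * c)| ≤ N * (ρ + δ) * T K ω := by
    have h4 := g4.eventually (Metric.ball_mem_nhds 0 (mul_pos hN' hδ0))
    filter_upwards [h4, eventually_gt_atTop 0] with K hK hK0
    have hK' : (0 : ℝ) < K := by exact_mod_cast hK0
    have hKT : (K : ℝ) ≤ T K ω := by exact_mod_cast (hT ω).id_le K
    rw [dist_zero_right, Real.norm_eq_abs, abs_mul, abs_of_pos (inv_pos.2 hK'),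
      inv_mul_lt_iff₀ hK'] at hK
    have e : ∑ k ∈ Finset.range K, w k ω *
        (x (T (k + 1) ω + N) ω - x (T (k + 1) ω) ω - N * c) =
        ∑ k ∈ Finset.range K, (w k ω * Z (k + 1) ω -
          (μ[fun ω => w k ω * Z (k + 1) ω | 𝒢' k]) ω) +
        ∑ k ∈ Finset.range K, w k ω * ((μ[Z (k + 1) | 𝒢 (k + 1)]) ω - N * c) := by
      rw [← Finset.sum_add_distrib]
      refine Finset.sum_congr rfl fun k _ => ?_
      rw [g5 k, g2 (k + 1)]; ring
    have h5 : |∑ k ∈ Finset.range K, w k ω * ((μ[Z (k + 1) | 𝒢 (k + 1)]) ω - N * c)| ≤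
        N * ρ * T K ω := by
      refine (Finset.abs_sum_le_sum_abs _ _).trans ?_
      calc _ ≤ ∑ k ∈ Finset.range K, ξ k ω * (N * ρ) := by
            refine Finset.sum_le_sum fun k _ => ?_
            rw [abs_mul, abs_of_nonneg (hw0 k ω)]
            refine mul_le_mul (hwξ k ω) ?_ (abs_nonneg _) (hξ0 k ω)
            rw [abs_le]
            constructor
            · linarith [g7 k]
            · linarith [g6 k]
        _ = ((T K ω : ℝ) - T 0 ω) * (N * ρ) := by
            rw [← Finset.sum_mul]
            congr 1
            exact Finset.sum_range_sub (fun k => (T k ω : ℝ)) K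
        _ ≤ N * ρ * T K ω := by
            have : (0 : ℝ) ≤ T 0 ω * (N * ρ) := by positivity
            linarith
    rw [e]
    refine (abs_add_le _ _).trans ?_
    have h6 : (K : ℝ) * (N * δ) ≤ T K ω * (N * δ) := mul_le_mul_of_nonneg_right hKT (by positivity)
    linarith
  have := eventually_abs_sub_le_of_smoothing (x := fun n => x n ω) (T := fun k => T k ω) g1
    (hT ω) hN hB.le hc (by linarith : 0 ≤ ρ + δ) hδ0
    h1 (g3 δ hδ)
  filter_upwards [this] with n hn
  refine hn.trans (le_of_eq ?_)
  ring

/-- Under the moment bound the times grow at most linearly. -/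
lemma ae_eventually_le_mul (𝒢 : Filtration ℕ mΩ) {T : ℕ → Ω → ℕ}
    (hT : ∀ ω, StrictMono fun k => T k ω) (hTm : ∀ k, Measurable[𝒢 k] (T k))
    {α M : ℝ} (hα : 1 < α) (hα2 : α ≤ 2) (hM : 0 ≤ M)
    (hmom : ∀ k A, MeasurableSet[𝒢 k] A →
      ∫⁻ ω in A, ENNReal.ofReal (((T (k + 1) ω : ℝ) - T k ω) ^ α) ∂μ ≤ ENNReal.ofReal M * μ A) :
    ∀ᵐ ω ∂μ, ∀ᶠ K : ℕ in atTop, (T K ω : ℝ) ≤ (M + 3) * K := by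
  have hTr : ∀ k, Measurable[𝒢 k] fun ω => (T k ω : ℝ) := fun k =>
    (measurable_from_top (f := fun n : ℕ => (n : ℝ))).comp (hTm k)
  set ξ : ℕ → Ω → ℝ := fun k ω => (T (k + 1) ω : ℝ) - T k ω with hξ
  have hξm : ∀ k, Measurable[𝒢 (k + 1)] (ξ k) := fun k =>
    (hTr (k + 1)).sub ((hTr k).mono (𝒢.mono (Nat.le_succ k)) le_rfl)
  have hξ0 : ∀ k ω, 0 ≤ ξ k ω := fun k ω =>
    sub_nonneg.2 (by exact_mod_cast (hT ω (Nat.lt_succ_self k)).le)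
  have htail := ae_sum_tail_le (μ := μ) 𝒢 hξ0 (fun k => (hξm k).stronglyMeasurable) hα hα2 hM
    hmom one_pos
  filter_upwards [htail] with ω g
  have g1 := g (M + 1) (by rw [Real.one_rpow]; linarith)
  filter_upwards [g1, eventually_ge_atTop (T 0 ω)] with K h1 h2
  have h2' : (T 0 ω : ℝ) ≤ K := by exact_mod_cast h2
  have h3 : (T K ω : ℝ) - T 0 ω ≤
      ∑ k ∈ Finset.range K, (1 + if 1 < ξ k ω then ξ k ω else 0) := by
    rw [← Finset.sum_range_sub (fun k => (T k ω : ℝ)) K]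
    refine Finset.sum_le_sum fun k _ => ?_
    split_ifs with h
    · change ξ k ω ≤ _; linarith
    · change ξ k ω ≤ _; linarith [not_lt.1 h]
  rw [Finset.sum_add_distrib, Finset.sum_const, Finset.card_range, nsmul_eq_mul, mul_one] at h3
  linarith

end Approximate

/-! ### Histories up to the regeneration times -/

section History

/-- Two measures that compare on the fibres of a map to a countable set compare on all preimages. -/
lemma measure_preimage_le_of_fiber {α β : Type*} {mα : MeasurableSpace α} [Countable β]
    {μ ν : Measure α} {f : α → β} (hf : ∀ b, MeasurableSet (f ⁻¹' {b}))
    (h : ∀ b, μ (f ⁻¹' {b}) ≤ ν (f ⁻¹' {b})) (S : Set β) : μ (f ⁻¹' S) ≤ ν (f ⁻¹' S) := by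
  have e : f ⁻¹' S = ⋃ b ∈ S, f ⁻¹' {b} := by
    ext a; simp
  have hd : S.PairwiseDisjoint fun b => f ⁻¹' {b} := fun a _ b _ hab =>
    Disjoint.preimage f (Set.disjoint_singleton.2 hab)
  rw [e, measure_biUnion S.to_countable hd fun b _ => hf b,
    measure_biUnion S.to_countable hd fun b _ => hf b]
  exact ENNReal.tsum_le_tsum fun b => h b

variable {d : ℕ} {l : Site d} {ζ : ℝ} {L : ℕ}

/-- The event that all `τ_k` are finite. -/
def regenerates (l : Site d) (ζ : ℝ) (L : ℕ) : Set (Space l) := {p | ∀ k, tau l ζ L k p < ⊤}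

lemma measurableSet_regenerates : MeasurableSet (regenerates l ζ L) := by
  unfold regenerates
  simp only [Set.ofPred_forall]
  exact MeasurableSet.iInter fun k =>
    measurable_tau k (MeasurableSet.of_discrete (s := {t : ℕ∞ | t < ⊤}))

open scoped Classical in
/-- The letters and the path up to `τ_{k+1}`; a single value off the event that all these times are
finite.  The values range over a countable set, so that statements about the `σ`-algebra of this map
reduce to its fibres. -/
def history (l : Site d) (ζ : ℝ) (L k : ℕ) (p : Space l) : Option (Σ n, Word l n) :=
  if p ∈ regenerates l ζ L then
    some ⟨(tau l ζ L (k + 1) p).toNat, word (tau l ζ L (k + 1) p).toNat (toWalk p)⟩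
  else none

lemma tau_eq_toNat {p : Space l} (hp : p ∈ regenerates l ζ L) (k : ℕ) :
    tau l ζ L k p = ((tau l ζ L k p).toNat : ℕ∞) := (ENat.natCast_toNat (hp k).ne).symm

lemma history_eq_some {k n : ℕ} {w : Word l n} {p : Space l} :
    history l ζ L k p = some ⟨n, w⟩ ↔
      p ∈ regenerates l ζ L ∧ tau l ζ L (k + 1) p = n ∧ word n (toWalk p) = w := by
  unfold history
  split_ifs with hp
  · simp only [Option.some.injEq, Sigma.mk.injEq, hp, true_and]
    constructor
    · rintro ⟨rfl, h⟩
      exact ⟨tau_eq_toNat hp _, eq_of_heq h⟩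
    · rintro ⟨h1, rfl⟩
      rw [h1, ENat.toNat_natCast]
      exact ⟨rfl, HEq.rfl⟩
  · simp [hp]

lemma history_eq_none {k : ℕ} {p : Space l} :
    history l ζ L k p = none ↔ p ∉ regenerates l ζ L := by
  unfold history
  split_ifs with hp <;> simp [hp]

/-- A fibre of `history` is an atom, up to the event that all regeneration times are finite. -/
lemma history_fiber (k n : ℕ) (p : Space l) :
    history l ζ L k ⁻¹' {some ⟨n, word n (toWalk p)⟩} =
      regenerates l ζ L ∩ atom l ζ L (k + 1) n (toWalk p) := by
  ext q
  rw [Set.mem_preimage, Set.mem_singleton_iff, history_eq_some, tau_eq]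
  exact and_congr_right fun _ => ⟨fun h => ⟨mem_cyl_iff_word.2 h.2, h.1⟩,
    fun h => ⟨h.2, mem_cyl_iff_word.1 h.1⟩⟩

lemma measurableSet_history_fiber (k : ℕ) (h : Option (Σ n, Word l n)) :
    MeasurableSet (history l ζ L k ⁻¹' {h}) := by
  rcases h with _ | ⟨n, w⟩
  · have : history l ζ L k ⁻¹' {none} = (regenerates l ζ L)ᶜ := by
      ext p; exact history_eq_none
    rw [this]
    exact measurableSet_regenerates.compl
  · have : history l ζ L k ⁻¹' {some ⟨n, w⟩} = regenerates l ζ L ∩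
        (tau l ζ L (k + 1) ⁻¹' {(n : ℕ∞)} ∩ toWalk ⁻¹' wordCyl n w) := by
      ext p
      rw [Set.mem_preimage, Set.mem_singleton_iff, history_eq_some, ← mem_wordCyl]
      rfl
    rw [this]
    exact measurableSet_regenerates.inter ((measurable_tau _ (measurableSet_singleton _)).inter
      (measurable_toWalk (measurableSet_wordCyl n w)))

/-- Equal histories have the same regeneration times up to `τ_{k+1}`, and walks that agree up to
`τ_{k+1}`. -/
lemma history_eq_history (hζ : 0 ≤ ζ) {k : ℕ} {p q : Space l}
    (h : history l ζ L k p = history l ζ L k q) :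
    (p ∉ regenerates l ζ L ∧ q ∉ regenerates l ζ L) ∨
      (p ∈ regenerates l ζ L ∧ q ∈ regenerates l ζ L ∧
        (∀ j ≤ k + 1, tau l ζ L j q = tau l ζ L j p) ∧
        Agree (tau l ζ L (k + 1) p).toNat (toWalk p) (toWalk q)) := by
  by_cases hp : p ∈ regenerates l ζ L
  · right
    obtain ⟨n, hn⟩ : ∃ n : ℕ, tau l ζ L (k + 1) p = n := ⟨_, tau_eq_toNat hp _⟩
    rw [history_eq_some.2 ⟨hp, hn, rfl⟩] at h
    obtain ⟨hq, hqn, hw⟩ := history_eq_some.1 h.symm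
    have ha : Agree n (toWalk p) (toWalk q) := agree_of_mem_cyl (mem_cyl_iff_word.2 hw)
    refine ⟨hp, hq, fun j hj => ?_, by rwa [hn, ENat.toNat_natCast]⟩
    rw [tau_eq] at hqn hn
    have := walkTau_agree hζ (k + 1) ha hn (exitCone_walkTau hqn) j hj
    rwa [tau_eq, tau_eq]
  · left
    exact ⟨hp, history_eq_none.1 (h.symm.trans (history_eq_none.2 hp))⟩

lemma tau_add_le {p : Space l} (hp : p ∈ regenerates l ζ L) (k : ℕ) :
    (tau l ζ L k p).toNat + L ≤ (tau l ζ L (k + 1) p).toNat := by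
  have h1 := tau_eq_toNat hp k
  have h2 := tau_eq_toNat hp (k + 1)
  rw [tau_eq] at h1 h2
  rw [tau_eq, tau_eq]
  exact (walkTau_candidate h1 h2).1

lemma tau_add_le_tau {p : Space l} (hp : p ∈ regenerates l ζ L) (hL : 0 < L) (k j : ℕ) :
    (tau l ζ L k p).toNat + j ≤ (tau l ζ L (k + j) p).toNat := by
  induction j with
  | zero => simp
  | succ j ih =>
    have := tau_add_le hp (k + j)
    rw [add_assoc] at this
    omega

/-- The `σ`-algebras of the histories up to `τ_{k+1}`.  They increase since a history determines the
earlier ones. -/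
def historyFiltration (l : Site d) (hζ : 0 ≤ ζ) (hL : 0 < L) :
    Filtration ℕ (inferInstance : MeasurableSpace (Space l)) where
  seq k := MeasurableSpace.comap (history l ζ L k) ⊤
  mono' := by
    refine monotone_nat_of_le_succ fun k => ?_
    rintro _ ⟨S, -, rfl⟩
    refine ⟨history l ζ L (k + 1) '' (history l ζ L k ⁻¹' S), trivial, ?_⟩
    ext p
    constructor
    · rintro ⟨q, hq, hqp⟩
      have : history l ζ L k q = history l ζ L k p := by
        rcases history_eq_history hζ hqp with ⟨h1, h2⟩ | ⟨h1, h2, h3, h4⟩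
        · rw [history_eq_none.2 h1, history_eq_none.2 h2]
        · have h5 := tau_eq_toNat h1 (k + 1)
          rw [history_eq_some.2 ⟨h1, h5, rfl⟩]
          refine (history_eq_some.2 ⟨h2, (h3 _ (Nat.le_succ _)).trans h5, ?_⟩).symm
          have h6 := tau_add_le_tau h1 hL (k + 1) 1
          have h7 := h4.mono (by omega : (tau l ζ L (k + 1) q).toNat ≤ _)
          exact mem_cyl_iff_word.1
            ⟨fun i hi => (h7.1 i hi).symm, fun i hi => (h7.2 i hi).symm⟩
      change history l ζ L k p ∈ S
      rw [← this]; exact hq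
    · intro hp
      exact ⟨p, hp, rfl⟩
  le' k := by
    rintro _ ⟨S, -, rfl⟩
    rw [← Set.biUnion_preimage_singleton]
    exact MeasurableSet.biUnion S.to_countable fun h _ => measurableSet_history_fiber k h

/-- All functions of the history are measurable, its values carrying the discrete `σ`-algebra. -/
lemma measurable_of_history {hζ : 0 ≤ ζ} {hL : 0 < L} {k : ℕ} {β : Type*} [MeasurableSpace β]
    {f : Space l → β} (h : ∀ p q, history l ζ L k p = history l ζ L k q → f p = f q) :
    Measurable[historyFiltration l hζ hL k] f := by
  intro S _
  refine ⟨history l ζ L k '' (f ⁻¹' S), trivial, ?_⟩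
  ext p
  constructor
  · rintro ⟨q, hq, hqp⟩
    change f p ∈ S
    rw [← h q p hqp]; exact hq
  · intro hp
    exact ⟨p, hp, rfl⟩

/-- A fibre of `history` is null or almost surely equal to an atom. -/
lemma history_fiber_ae (μ : Measure (Space l)) (hμ : ∀ᵐ p ∂μ, p ∈ regenerates l ζ L) (k : ℕ)
    (h : Option (Σ n, Word l n)) :
    μ (history l ζ L k ⁻¹' {h}) = 0 ∨ ∃ (n : ℕ) (z : Walk l), walkTau l ζ L (k + 1) z = n ∧
      history l ζ L k ⁻¹' {h} =ᵐ[μ] atom l ζ L (k + 1) n z := by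
  rcases (history l ζ L k ⁻¹' {h}).eq_empty_or_nonempty with he | ⟨p, hp⟩
  · left; rw [he, measure_empty]
  · rcases h with _ | ⟨n, w⟩
    · left
      refine measure_mono_null (fun q hq => ?_) (ae_iff.1 hμ)
      exact history_eq_none.1 hq
    · right
      obtain ⟨h1, h2, rfl⟩ := history_eq_some.1 hp
      refine ⟨n, toWalk p, by rw [← tau_eq]; exact h2, ?_⟩
      rw [history_fiber]
      filter_upwards [hμ] with q hq
      exact propext (and_iff_right hq)

open scoped Classical in
/-- The regeneration times `τ_{k+1}` as natural numbers.  Where some of them are infinite the value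
is `k`, to keep the sequence strictly increasing everywhere. -/
def regTime (l : Site d) (ζ : ℝ) (L k : ℕ) (p : Space l) : ℕ :=
  if p ∈ regenerates l ζ L then (tau l ζ L (k + 1) p).toNat else k

lemma strictMono_regTime (hL : 0 < L) (p : Space l) : StrictMono fun k => regTime l ζ L k p := by
  refine strictMono_nat_of_lt_succ fun k => ?_
  unfold regTime
  split_ifs with hp
  · have := tau_add_le hp (k + 1)
    omega
  · omega

lemma measurable_regTime (hζ : 0 ≤ ζ) (hL : 0 < L) (k : ℕ) :
    Measurable[historyFiltration l hζ hL k] (regTime l ζ L k) := by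
  refine measurable_of_history fun p q h => ?_
  unfold regTime
  rcases history_eq_history hζ h with ⟨h1, h2⟩ | ⟨h1, h2, h3, -⟩
  · rw [if_neg h1, if_neg h2]
  · rw [if_pos h1, if_pos h2, h3 _ le_rfl]

/-- The event that coordinate `i` of the increment of the walk in the `N` steps after `τ_{k+1}`
exceeds `j - N` (and all regeneration times are finite). -/
def exceeds (l : Site d) (ζ : ℝ) (L k N : ℕ) (i : Fin d) (j : ℕ) : Set (Space l) :=
  regenerates l ζ L ∩ pathAfter l ζ L (k + 1) ⁻¹' {X | (j : ℤ) < X N i + N}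

lemma measurableSet_exceedsPath (N : ℕ) (i : Fin d) (j : ℕ) :
    MeasurableSet {X : ℕ → Site d | (j : ℤ) < X N i + N} := by
  have h : Measurable fun X : ℕ → Site d => X N := measurable_pi_apply N
  exact h (MeasurableSet.of_discrete (s := {x : Site d | (j : ℤ) < x i + N}))

lemma measurableSet_exceeds (k N : ℕ) (i : Fin d) (j : ℕ) :
    MeasurableSet (exceeds l ζ L k N i j) :=
  measurableSet_regenerates.inter (measurable_pathAfter _ (measurableSet_exceedsPath N i j))

/-- Coordinate `i` of the increment of the walk in the `N` steps after `τ_{k+1}`, truncated to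
`[-N, N]` and written as a sum of indicators, to which the variational distance applies.  Its value
is `-N` where some regeneration time is infinite. -/
def window (l : Site d) (ζ : ℝ) (L k N : ℕ) (i : Fin d) (p : Space l) : ℝ :=
  ∑ j ∈ Finset.range (2 * N), (exceeds l ζ L k N i j).indicator (fun _ => (1 : ℝ)) p - N

lemma abs_window_le (k N : ℕ) (i : Fin d) (p : Space l) : |window l ζ L k N i p| ≤ N := by
  have h1 : ∀ j, 0 ≤ (exceeds l ζ L k N i j).indicator (fun _ => (1 : ℝ)) p ∧
      (exceeds l ζ L k N i j).indicator (fun _ => (1 : ℝ)) p ≤ 1 := fun j => by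
    by_cases h : p ∈ exceeds l ζ L k N i j
    · rw [Set.indicator_of_mem h]; norm_num
    · rw [Set.indicator_of_notMem h]; norm_num
  have h2 := Finset.sum_nonneg fun j (_ : j ∈ Finset.range (2 * N)) => (h1 j).1
  have h3 := Finset.sum_le_sum fun j (_ : j ∈ Finset.range (2 * N)) => (h1 j).2
  simp only [Finset.sum_const, Finset.card_range, nsmul_eq_mul, mul_one] at h3
  push_cast at h3
  unfold window
  rw [abs_le]
  constructor <;> linarith

/-- The window closes before `N` more regenerations have occurred. -/
lemma measurable_window (hζ : 0 ≤ ζ) (hL : 0 < L) (k N : ℕ) (i : Fin d) :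
    Measurable[historyFiltration l hζ hL (k + N)] (window l ζ L k N i) := by
  refine measurable_of_history fun p q h => ?_
  have key : ∀ j, p ∈ exceeds l ζ L k N i j ↔ q ∈ exceeds l ζ L k N i j := by
    intro j
    rcases history_eq_history hζ h with ⟨h1, h2⟩ | ⟨h1, h2, h3, h4⟩
    · exact ⟨fun h => absurd h.1 h1, fun h => absurd h.1 h2⟩
    · have h5 := tau_add_le_tau h1 hL (k + 1) N
      rw [show k + 1 + N = k + N + 1 by omega] at h5
      have e : pathAfter l ζ L (k + 1) p N = pathAfter l ζ L (k + 1) q N := by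
        unfold pathAfter
        rw [h3 (k + 1) (by omega)]
        exact congrArg₂ (· - ·) (h4.2 _ h5) (h4.2 _ (by omega))
      unfold exceeds
      simp only [Set.mem_inter_iff, h1, h2, true_and, Set.mem_preimage, Set.mem_ofPred_eq, e]
  unfold window
  congr 1
  refine Finset.sum_congr rfl fun j _ => ?_
  by_cases hj : p ∈ exceeds l ζ L k N i j
  · rw [Set.indicator_of_mem hj, Set.indicator_of_mem ((key j).1 hj)]
  · rw [Set.indicator_of_notMem hj, Set.indicator_of_notMem (mt (key j).2 hj)]

lemma window_eq {k N : ℕ} {i : Fin d} {p : Space l} (hp : p ∈ regenerates l ζ L)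
    (hx : ∀ n, |((p.2 (n + 1) i : ℤ) : ℝ) - (p.2 n i : ℤ)| ≤ 1) :
    window l ζ L k N i p = ((p.2 (regTime l ζ L k p + N) i : ℤ) : ℝ) -
      (p.2 (regTime l ζ L k p) i : ℤ) := by
  have h := abs_sub_le_of_lipschitz (x := fun n => ((p.2 n i : ℤ) : ℝ)) hx (regTime l ζ L k p) N
  set m : ℤ := p.2 (regTime l ζ L k p + N) i - p.2 (regTime l ζ L k p) i with hm
  have hmr : ((m : ℤ) : ℝ) = ((p.2 (regTime l ζ L k p + N) i : ℤ) : ℝ) -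
      (p.2 (regTime l ζ L k p) i : ℤ) := by rw [hm]; push_cast; rfl
  rw [← hmr] at h ⊢
  have h' : |m| ≤ N := by exact_mod_cast h
  rw [abs_le] at h'
  obtain ⟨a, ha⟩ := Int.eq_ofNat_of_zero_le (by linarith [h'.1] : 0 ≤ m + N)
  have hmem : ∀ j, p ∈ exceeds l ζ L k N i j ↔ j < a := by
    intro j
    have e : pathAfter l ζ L (k + 1) p N i = m := by
      rw [hm]; unfold pathAfter regTime; rw [if_pos hp]; rfl
    unfold exceeds
    simp only [Set.mem_inter_iff, hp, true_and, Set.mem_preimage, Set.mem_ofPred_eq, e, ha]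
    exact Int.ofNat_lt
  have hsum : ∑ j ∈ Finset.range (2 * N), (exceeds l ζ L k N i j).indicator
      (fun _ => (1 : ℝ)) p = a := by
    have : ∀ j ∈ Finset.range (2 * N), (exceeds l ζ L k N i j).indicator (fun _ => (1 : ℝ)) p =
        if j < a then 1 else 0 := fun j _ => by
      by_cases hj : j < a
      · rw [if_pos hj, Set.indicator_of_mem ((hmem j).2 hj)]
      · rw [if_neg hj, Set.indicator_of_notMem (mt (hmem j).1 hj)]
    rw [Finset.sum_congr rfl this, Finset.sum_boole]
    have e : (Finset.range (2 * N)).filter (fun j => j < a) = Finset.range a := by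
      ext j
      simp only [Finset.mem_filter, Finset.mem_range]
      omega
    rw [e, Finset.card_range]
  unfold window
  rw [hsum]
  have : ((m + N : ℤ) : ℝ) = a := by rw [ha]; simp
  push_cast at this
  linarith

end History

/-! ### Conditional estimates given the history -/

section Estimates

variable {d : ℕ} {l : Site d} {ζ : ℝ} {L : ℕ}

/-- A conditional bound given `D' = ∞` and the environment behind the origin is a conditional bound
given the history. -/
lemma lintegral_history_le (P : Measure (Env d)) [IsProbabilityMeasure P]
    (hP : ∀ x : Site d, MeasurePreserving (shift x) P P) (hl : l ≠ 0) (hL : 0 < L) (hζ : 0 ≤ ζ)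
    (κ : ℝ) (hreg : ∀ᵐ p ∂(extAnnealed P l κ), p ∈ regenerates l ζ L)
    {f : Walk l → ℝ≥0∞} (hf : Measurable f) (C : ℝ≥0∞)
    (hC : ∀ h : Env d → ℝ≥0∞, Measurable[envSigma {y : Site d | y ⬝ᵥ l < -(L : ℤ)}] h →
      ∫⁻ ω, h ω * ∫⁻ z in confined l ζ, f z ∂(walkLaw l κ (ω, 0)) ∂P ≤
        C * ∫⁻ ω, h ω * walkLaw l κ (ω, 0) (confined l ζ) ∂P)
    (k : ℕ) {A : Set (Space l)} (hA : MeasurableSet[historyFiltration l hζ hL k] A) :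
    ∫⁻ p in A, f (recenter (regTime l ζ L k p) (toWalk p)) ∂(extAnnealed P l κ) ≤
      C * extAnnealed P l κ A := by
  obtain ⟨S, -, rfl⟩ := hA
  have hrm : Measurable (regTime l ζ L k) :=
    (measurable_regTime hζ hL k).mono ((historyFiltration l hζ hL).le k) le_rfl
  have hSm : MeasurableSet (history l ζ L k ⁻¹' S) :=
    (historyFiltration l hζ hL).le k _ ⟨S, trivial, rfl⟩
  have hgm : Measurable fun p : Space l => f (recenter (regTime l ζ L k p) (toWalk p)) :=
    measurable_random_index (f := fun n (p : Space l) => f (recenter n (toWalk p)))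
      (fun n => hf.comp ((measurable_recenter n).comp measurable_toWalk)) hrm
  have key := measure_preimage_le_of_fiber
    (μ := (extAnnealed P l κ).withDensity fun p => f (recenter (regTime l ζ L k p) (toWalk p)))
    (ν := C • extAnnealed P l κ) (measurableSet_history_fiber (l := l) (ζ := ζ) (L := L) k)
    (fun h => ?_) S
  · rwa [withDensity_apply _ hSm, Measure.smul_apply, smul_eq_mul] at key
  · rw [withDensity_apply _ (measurableSet_history_fiber k h), Measure.smul_apply, smul_eq_mul]
    rcases history_fiber_ae _ hreg k h with h0 | ⟨n, z, hz, he⟩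
    · rw [setLIntegral_measure_zero _ _ h0]; exact zero_le
    · rw [setLIntegral_congr he, measure_congr he]
      refine le_trans (le_of_eq ?_) (setLIntegral_atom_le P hP hl hL hζ κ hf C hC hz)
      refine setLIntegral_congr_fun_ae (measurableSet_atom _ _ _) ?_
      filter_upwards [hreg] with p hp hpa
      have : regTime l ζ L k p = n := by
        have h2 : walkTau l ζ L (k + 1) (toWalk p) = n := hpa.2
        unfold regTime
        rw [if_pos hp, tau_eq, h2, ENat.toNat_natCast]
      rw [this]

/-- The approximate renewal hypothesis, given the history. -/
lemma abs_history_inter_sub_le (P : Measure (Env d)) [IsProbabilityMeasure P] (κ : ℝ)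
    (hD : extAnnealed P l κ (neverExits l ζ) ≠ 0) (hζ : 0 ≤ ζ) (hL : 0 < L)
    (hreg : ∀ᵐ p ∂(extAnnealed P l κ), p ∈ regenerates l ζ L) (k : ℕ) {c : ℝ} (hc : 0 ≤ c)
    (hR : ∀ᵐ p ∂(extAnnealed P l κ),
      varDist ((condExpKernel (extAnnealed P l κ) (calH l ζ L (k + 1)) p).map
        (pathAfter l ζ L (k + 1))) (confinedPathLaw P l κ ζ) ≤ c)
    {A : Set (Space l)} (hA : MeasurableSet[historyFiltration l hζ hL k] A)
    {B : Set (ℕ → Site d)} (hB : MeasurableSet B) :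
    |(extAnnealed P l κ).real (A ∩ (regenerates l ζ L ∩ pathAfter l ζ L (k + 1) ⁻¹' B)) -
      (confinedPathLaw P l κ ζ).real B * (extAnnealed P l κ).real A| ≤
      c * (extAnnealed P l κ).real A := by
  obtain ⟨S, -, rfl⟩ := hA
  set μ := extAnnealed P l κ with hμ
  set q := (confinedPathLaw P l κ ζ).real B with hq
  have hq0 : 0 ≤ q := measureReal_nonneg
  set E := regenerates l ζ L ∩ pathAfter l ζ L (k + 1) ⁻¹' B with hE
  have hEm : MeasurableSet E := measurableSet_regenerates.inter (measurable_pathAfter _ hB)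
  have hSm : MeasurableSet (history l ζ L k ⁻¹' S) :=
    (historyFiltration l hζ hL).le k _ ⟨S, trivial, rfl⟩
  have hfib := measurableSet_history_fiber (l := l) (ζ := ζ) (L := L) k
  -- on a fibre, this is the estimate for an atom
  have hf : ∀ h, |μ.real (history l ζ L k ⁻¹' {h} ∩ E) - q * μ.real (history l ζ L k ⁻¹' {h})| ≤
      c * μ.real (history l ζ L k ⁻¹' {h}) := by
    intro h
    rcases history_fiber_ae _ hreg k h with h0 | ⟨n, z, hz, he⟩
    · have h1 : μ.real (history l ζ L k ⁻¹' {h}) = 0 := by rw [Measure.real, h0]; rfl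
      have h2 : μ.real (history l ζ L k ⁻¹' {h} ∩ E) = 0 := by
        rw [Measure.real, measure_mono_null Set.inter_subset_left h0]; rfl
      rw [h1, h2]; simp
    · have hEe : E =ᵐ[μ] pathAfter l ζ L (k + 1) ⁻¹' B := by
        filter_upwards [hreg] with p hp
        exact propext (and_iff_right hp)
      rw [measureReal_congr he, measureReal_congr (he.inter hEe), mul_comm q]
      exact abs_atom_inter_sub_le P κ hD (Nat.succ_pos k) hR n z hB
  have cv : ∀ (a : ℝ) (s : Set (Space l)), 0 ≤ a →
      ENNReal.ofReal a * μ s = ENNReal.ofReal (a * μ.real s) := fun a s ha => by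
    rw [ENNReal.ofReal_mul ha, Measure.real, ENNReal.ofReal_toReal (measure_ne_top _ _)]
  have cv1 : ∀ s : Set (Space l), μ s = ENNReal.ofReal (μ.real s) := fun s => by
    rw [Measure.real, ENNReal.ofReal_toReal (measure_ne_top _ _)]
  have hup := measure_preimage_le_of_fiber (μ := μ.restrict E) (ν := ENNReal.ofReal (q + c) • μ)
    hfib (fun h => by
      rw [Measure.restrict_apply (hfib h), Measure.smul_apply, smul_eq_mul, cv _ _ (by positivity),
        cv1]
      refine ENNReal.ofReal_le_ofReal ?_
      have := (abs_le.1 (hf h)).2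
      linarith) S
  have hlow := measure_preimage_le_of_fiber (μ := ENNReal.ofReal q • μ)
    (ν := μ.restrict E + ENNReal.ofReal c • μ) hfib (fun h => by
      rw [Measure.add_apply, Measure.restrict_apply (hfib h), Measure.smul_apply,
        Measure.smul_apply, smul_eq_mul, smul_eq_mul, cv _ _ hq0, cv _ _ hc, cv1 (_ ∩ _),
        ← ENNReal.ofReal_add measureReal_nonneg (by positivity)]
      refine ENNReal.ofReal_le_ofReal ?_
      have := (abs_le.1 (hf h)).1
      linarith) S
  rw [Measure.restrict_apply hSm, Measure.smul_apply, smul_eq_mul, cv _ _ (by positivity), cv1,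
    ENNReal.ofReal_le_ofReal_iff (by positivity)] at hup
  rw [Measure.add_apply, Measure.restrict_apply hSm, Measure.smul_apply,
        Measure.smul_apply, smul_eq_mul, smul_eq_mul, cv _ _ hq0, cv _ _ hc, cv1 (_ ∩ _),
        ← ENNReal.ofReal_add measureReal_nonneg (by positivity),
    ENNReal.ofReal_le_ofReal_iff (by positivity)] at hlow
  rw [abs_le]
  constructor <;> linarith

/-- The mean speed in direction `i` over the first `N` steps, for the walk conditioned not to leave
its cone (with the increment truncated to `[-N, N]`).  The expectation of a variable with values in
`{-N, …, N}` is written as a sum of tail probabilities. -/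
def windowSpeed (P : Measure (Env d)) (l : Site d) (κ ζ : ℝ) (N : ℕ) (i : Fin d) : ℝ :=
  (∑ j ∈ Finset.range (2 * N),
    (confinedPathLaw P l κ ζ).real {X | (j : ℤ) < X N i + N} - N) / N

lemma abs_windowSpeed_le (P : Measure (Env d)) [IsProbabilityMeasure P] (κ : ℝ)
    (hD : extAnnealed P l κ (neverExits l ζ) ≠ 0) (N : ℕ) (i : Fin d) :
    |windowSpeed P l κ ζ N i| ≤ 1 := by
  have := cond_isProbabilityMeasure hD
  have : IsProbabilityMeasure (confinedPathLaw P l κ ζ) :=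
    Measure.isProbabilityMeasure_map measurable_snd.aemeasurable
  rcases Nat.eq_zero_or_pos N with rfl | hN
  · simp [windowSpeed]
  have hN' : (0 : ℝ) < N := by exact_mod_cast hN
  have h2 := Finset.sum_nonneg fun j (_ : j ∈ Finset.range (2 * N)) =>
    (measureReal_nonneg (μ := confinedPathLaw P l κ ζ) (s := {X | (j : ℤ) < X N i + N}))
  have h3 := Finset.sum_le_sum fun j (_ : j ∈ Finset.range (2 * N)) =>
    (measureReal_le_one (μ := confinedPathLaw P l κ ζ) (s := {X | (j : ℤ) < X N i + N}))
  simp only [Finset.sum_const, Finset.card_range, nsmul_eq_mul, mul_one] at h3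
  push_cast at h3
  unfold windowSpeed
  rw [abs_div, Nat.abs_cast, div_le_one hN', abs_le]
  constructor <;> linarith

lemma abs_integral_window_sub_le (P : Measure (Env d)) [IsProbabilityMeasure P] (κ : ℝ)
    (hD : extAnnealed P l κ (neverExits l ζ) ≠ 0) (hζ : 0 ≤ ζ) (hL : 0 < L)
    (hreg : ∀ᵐ p ∂(extAnnealed P l κ), p ∈ regenerates l ζ L) (k : ℕ) {c : ℝ} (hc : 0 ≤ c)
    (hR : ∀ᵐ p ∂(extAnnealed P l κ),
      varDist ((condExpKernel (extAnnealed P l κ) (calH l ζ L (k + 1)) p).map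
        (pathAfter l ζ L (k + 1))) (confinedPathLaw P l κ ζ) ≤ c)
    {N : ℕ} (hN : 0 < N) (i : Fin d)
    {A : Set (Space l)} (hA : MeasurableSet[historyFiltration l hζ hL k] A) :
    |∫ p in A, window l ζ L k N i p ∂(extAnnealed P l κ) -
      N * windowSpeed P l κ ζ N i * (extAnnealed P l κ).real A| ≤
      N * (2 * c) * (extAnnealed P l κ).real A := by
  have hN' : (N : ℝ) ≠ 0 := by exact_mod_cast hN.ne'
  have hAm : MeasurableSet A := (historyFiltration l hζ hL).le k _ hA
  have hint : ∀ j, Integrable ((exceeds l ζ L k N i j).indicator fun _ => (1 : ℝ))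
      ((extAnnealed P l κ).restrict A) := fun j =>
    (integrable_const 1).indicator (measurableSet_exceeds k N i j)
  have e : ∫ p in A, window l ζ L k N i p ∂(extAnnealed P l κ) =
      ∑ j ∈ Finset.range (2 * N), (extAnnealed P l κ).real (A ∩ exceeds l ζ L k N i j) -
        N * (extAnnealed P l κ).real A := by
    unfold window
    rw [integral_sub (integrable_finsetSum _ fun j _ => hint j) (integrable_const _),
      integral_finsetSum _ fun j _ => hint j, setIntegral_const, smul_eq_mul, mul_comm _ (N : ℝ)]
    congr 1
    refine Finset.sum_congr rfl fun j _ => ?_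
    rw [integral_indicator (measurableSet_exceeds k N i j),
      Measure.restrict_restrict (measurableSet_exceeds k N i j), setIntegral_const, smul_eq_mul,
      mul_one, Set.inter_comm]
  have e2 : (N : ℝ) * windowSpeed P l κ ζ N i * (extAnnealed P l κ).real A =
      ∑ j ∈ Finset.range (2 * N), (confinedPathLaw P l κ ζ).real {X | (j : ℤ) < X N i + N} *
        (extAnnealed P l κ).real A - N * (extAnnealed P l κ).real A := by
    unfold windowSpeed
    rw [mul_div_cancel₀ _ hN', ← Finset.sum_mul]
    ring
  rw [e, e2, sub_sub_sub_cancel_right, ← Finset.sum_sub_distrib]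
  refine (Finset.abs_sum_le_sum_abs _ _).trans ?_
  calc _ ≤ ∑ j ∈ Finset.range (2 * N), c * (extAnnealed P l κ).real A :=
        Finset.sum_le_sum fun j _ => abs_history_inter_sub_le P κ hD hζ hL hreg k hc hR hA
          (measurableSet_exceedsPath N i j)
    _ = _ := by
        rw [Finset.sum_const, Finset.card_range, nsmul_eq_mul]; push_cast; ring

end Estimates

/-! ### Almost sure properties of the walk -/

section AlmostSure

variable {d : ℕ} {l : Site d}

/-- An event that fails only on histories of probability zero holds almost surely, the histories
being countable. -/
lemma ae_walkLaw_of_cylWeight (κ : ℝ) (ω : Env d) (x : Site d) (n : ℕ) {p : Walk l → Prop}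
    (h : ∀ z, ¬ p z → cylWeight κ n z.1 z.2 ω = 0) : ∀ᵐ z ∂(walkLaw l κ (ω, x)), p z := by
  rw [ae_iff]
  refine measure_mono_null (t := ⋃ k ∈ {k : Word l n | walkLaw l κ (ω, x) (wordCyl n k) = 0},
    wordCyl n k) (fun z hz => ?_)
    ((measure_biUnion_null_iff (Set.to_countable _)).2 fun k hk => hk)
  refine Set.mem_biUnion (x := word n z) ?_ (mem_wordCyl.2 rfl)
  change walkLaw l κ (ω, x) (wordCyl n (word n z)) = 0
  rw [wordCyl_word, walkLaw_cyl, h z hz, mul_zero]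

lemma ae_extAnnealed_of_walkLaw (P : Measure (Env d)) [IsProbabilityMeasure P] (κ : ℝ)
    {p : Walk l → Prop} (hp : MeasurableSet {z | p z})
    (h : ∀ ω, ∀ᵐ z ∂(walkLaw l κ (ω, 0)), p z) : ∀ᵐ q ∂(extAnnealed P l κ), p (toWalk q) := by
  rw [ae_iff]
  have hm : MeasurableSet {q : Space l | ¬ p (toWalk q)} := measurable_toWalk hp.compl
  rw [extAnnealed_apply P κ hm]
  refine (lintegral_congr fun ω => ?_).trans lintegral_zero
  exact ae_iff.1 (h ω)

lemma ae_obeys (P : Measure (Env d)) [IsProbabilityMeasure P] (κ : ℝ) :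
    ∀ᵐ q ∂(extAnnealed P l κ), ∀ n, Obeys n (toWalk q) := by
  rw [ae_all_iff]
  intro n
  refine ae_extAnnealed_of_walkLaw P κ ?_ fun ω => ae_walkLaw_of_cylWeight κ ω 0 n fun z hz =>
    cylWeight_eq_zero_of_not_obeys κ hz ω
  unfold Obeys
  simp only [Set.ofPred_forall]
  refine MeasurableSet.iInter fun i => MeasurableSet.iInter fun _ => ?_
  have h : Measurable fun z : Walk l => (z.1 i, z.2 i, z.2 (i + 1)) := by fun_prop
  have h2 := h (MeasurableSet.of_discrete (s := {q : Letter l × Site d × Site d |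
    (q.1 : Site d) ≠ 0 → q.2.2 = q.2.1 + q.1}))
  exact h2

lemma abs_coord_le_of_mem_unitVectors {x : Site d} (hx : x ∈ unitVectors d) (i : Fin d) :
    |x i| ≤ 1 := by
  classical
  rcases Finset.mem_union.1 hx with h | h <;>
  · obtain ⟨j, -, rfl⟩ := Finset.mem_image.1 h
    by_cases hij : i = j
    · subst hij; simp
    · simp [hij]

/-- Almost surely, the coordinates of the walk change by at most one at each step. -/
lemma ae_abs_step_le (P : Measure (Env d)) [IsProbabilityMeasure P] (κ : ℝ) :
    ∀ᵐ q ∂(extAnnealed P l κ), ∀ n i, |((q.2 (n + 1) i : ℤ) : ℝ) - (q.2 n i : ℤ)| ≤ 1 := by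
  rw [ae_all_iff]
  intro n
  have key : ∀ᵐ q ∂(extAnnealed P l κ),
      (fun z : Walk l => z.2 (n + 1) = z.2 n ∨ z.2 (n + 1) - z.2 n ∈ unitVectors d) (toWalk q) := by
    refine ae_extAnnealed_of_walkLaw (l := l) P κ
      (p := fun z : Walk l => z.2 (n + 1) = z.2 n ∨ z.2 (n + 1) - z.2 n ∈ unitVectors d) ?_
      fun ω => ae_walkLaw_of_cylWeight κ ω 0 (n + 1) fun z hz => ?_
    · have h : Measurable fun z : Walk l => (z.2 n, z.2 (n + 1)) := by fun_prop
      exact h (MeasurableSet.of_discrete (s := {q : Site d × Site d |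
        q.2 = q.1 ∨ q.2 - q.1 ∈ unitVectors d}))
    · push Not at hz
      refine Finset.prod_eq_zero (Finset.mem_range.2 (Nat.lt_succ_self n)) ?_
      rw [jumpProb_eq_zero κ ω _ hz.1 hz.2, mul_zero]
  filter_upwards [key] with q hq i
  rcases hq with h | h
  · have h : q.2 (n + 1) = q.2 n := h
    rw [h]; simp
  · have := abs_coord_le_of_mem_unitVectors h i
    have h2 : |q.2 (n + 1) i - q.2 n i| ≤ 1 := this
    exact_mod_cast h2

end AlmostSure

/-! ### The path has the same law under both annealed measures -/

section Transfer

variable {d : ℕ} {l : Site d}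

/-- The elements of `𝓔` do not exhaust the directions, so their total probability is less than
one. -/
lemma kappa_mul_card_lt_one (P : Measure (Env d)) [IsProbabilityMeasure P] (hl : l ≠ 0) {κ : ℝ}
    (h : Elliptic P l κ) : κ * (calE l).card < 1 := by
  classical
  obtain ⟨ω, h1, h2⟩ := (h.1.and h.2).exists
  obtain ⟨i, hi⟩ := Function.ne_iff.1 hl
  have hi : l i ≠ 0 := hi
  have hs : (l i).sign ≠ 0 := fun h => hi (Int.sign_eq_zero_iff_zero.1 h)
  obtain ⟨e, he⟩ : ∃ e : Dir d, (e : Site d) ∉ calE l := by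
    have hmem : (Pi.single i (-(l i).sign) : Site d) ∈ unitVectors d := by
      rcases lt_or_gt_of_ne hi with h | h
      · rw [Int.sign_eq_neg_one_of_neg h, neg_neg]
        exact Finset.mem_union_left _ (Finset.mem_image_of_mem _ (Finset.mem_univ i))
      · rw [Int.sign_eq_one_of_pos h]
        exact Finset.mem_union_right _ (Finset.mem_image_of_mem _ (Finset.mem_univ i))
    refine ⟨⟨_, hmem⟩, fun hc => ?_⟩
    obtain ⟨-, hc⟩ := Finset.mem_erase.1 hc
    obtain ⟨j, -, hj⟩ := Finset.mem_image.1 hc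
    have hji : (Pi.single j (l j).sign : Site d) i = (Pi.single i (-(l i).sign) : Site d) i :=
      congrFun hj i
    rw [Pi.single_eq_same (M := fun _ => ℤ) i (-(l i).sign)] at hji
    by_cases hij : i = j
    · subst hij
      rw [Pi.single_eq_same] at hji
      omega
    · rw [Pi.single_eq_of_ne hij] at hji
      omega
  have hsum : ∑ e : Dir d, (ω 0 e : ℝ) = 1 := (ω 0).2.2
  have hcard : ∑ e : Dir d, (if (e : Site d) ∈ calE l then κ else 0) = κ * (calE l).card := by
    rw [Finset.sum_coe_sort (unitVectors d) (fun e : Site d => if e ∈ calE l then κ else 0),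
      Finset.sum_ite_mem, Finset.inter_eq_right.2 fun e he => calE_subset he]
    simp [mul_comm]
  rw [← hcard, ← hsum]
  refine Finset.sum_lt_sum (fun e _ => ?_) ⟨e, Finset.mem_univ e, ?_⟩
  · split_ifs with hc
    · exact h2 e hc
    · exact (h1 e).le
  · rw [if_neg he]; exact h1 e

/-- By stationarity ellipticity holds at all sites, so the quenched law of the path is recovered by
averaging over the letters. -/
lemma ae_annealed_of_ae_extAnnealed (P : Measure (Env d)) [IsProbabilityMeasure P] (hl : l ≠ 0)
    {κ : ℝ} (hκ : 0 ≤ κ) (hP : ∀ x : Site d, MeasurePreserving (shift x) P P)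
    (hell : Elliptic P l κ) {p : (ℕ → Site d) → Prop} (hp : MeasurableSet {X | p X})
    (h : ∀ᵐ q ∂(extAnnealed P l κ), p q.2) : ∀ᵐ q ∂(annealed P), p q.2 := by
  have hω : ∀ᵐ ω ∂P, ∀ x, ∀ e : Dir d, (e : Site d) ∈ calE l → κ ≤ ω x e := by
    rw [ae_all_iff]
    intro x
    filter_upwards [(hP x).quasiMeasurePreserving.ae hell.2] with ω hω e he
    have := hω e he
    rwa [shift, add_zero] at this
  have hpm : MeasurableSet {X : ℕ → Site d | ¬ p X} := hp.compl
  rw [ae_iff] at h ⊢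
  have hm1 : MeasurableSet {q : Space l | ¬ p q.2} := measurable_snd hpm
  have hm2 : MeasurableSet {q : Env d × (ℕ → Site d) | ¬ p q.2} := measurable_snd hpm
  rw [extAnnealed_apply P κ hm1] at h
  have hmk : IsMarkovKernel (quenched d) := by unfold quenched; infer_instance
  rw [annealed, Measure.compProd_apply hm2, ← h]
  refine lintegral_congr_ae ?_
  filter_upwards [hω] with ω hω
  have := walkLaw_map_snd hκ (kappa_mul_card_lt_one P hl hell) ω 0 hω
  rw [Kernel.comap_apply, ← this]
  change (walkLaw l κ (ω, 0)).map Prod.snd {X : ℕ → Site d | ¬ p X} = _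
  rw [Measure.map_apply measurable_snd hpm]
  rfl

end Transfer

/-! ### The law of large numbers -/

section Speed

/-- Nearly constant averages for every precision force convergence to a constant. -/
lemma exists_tendsto_of_approx {Ω : Type*} {mΩ : MeasurableSpace Ω} {μ : Measure Ω}
    [IsProbabilityMeasure μ] {x : ℕ → Ω → ℝ}
    (h : ∀ ε : ℝ, 0 < ε → ∃ a : ℝ, ∀ᵐ ω ∂μ, ∀ᶠ n : ℕ in atTop, |x n ω - a * n| ≤ ε * n) :
    ∃ v : ℝ, ∀ᵐ ω ∂μ, Tendsto (fun n : ℕ => (n : ℝ)⁻¹ * x n ω) atTop (𝓝 v) := by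
  have hε : ∀ m : ℕ, (0 : ℝ) < 1 / ((m : ℝ) + 1) := fun m => by positivity
  choose a ha using fun m : ℕ => h _ (hε m)
  have hall := ae_all_iff.2 ha
  have hdiv : ∀ (ω : Ω) (m n : ℕ), 0 < n → |x n ω - a m * n| ≤ 1 / ((m : ℝ) + 1) * n →
      |(n : ℝ)⁻¹ * x n ω - a m| ≤ 1 / ((m : ℝ) + 1) := by
    intro ω m n hn hx
    have hn' : (0 : ℝ) < n := by exact_mod_cast hn
    have e : (n : ℝ)⁻¹ * x n ω - a m = (n : ℝ)⁻¹ * (x n ω - a m * n) := by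
      field_simp
    rw [e, abs_mul, abs_of_pos (inv_pos.2 hn'), inv_mul_le_iff₀ hn', mul_comm (n : ℝ) (1 / _)]
    exact hx
  have hlim : Tendsto (fun m : ℕ => 1 / ((m : ℝ) + 1)) atTop (𝓝 0) :=
    tendsto_one_div_add_atTop_nhds_zero_nat
  have hdist : ∀ m m', |a m - a m'| ≤ 1 / ((m : ℝ) + 1) + 1 / ((m' : ℝ) + 1) := by
    intro m m'
    obtain ⟨ω, hω⟩ := hall.exists
    obtain ⟨n, ⟨h1, h2⟩, h3⟩ := (((hω m).and (hω m')).and (eventually_gt_atTop 0)).exists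
    have g1 := hdiv ω m n h3 h1
    have g2 := hdiv ω m' n h3 h2
    rw [abs_sub_comm] at g1
    exact (abs_sub_le _ _ _).trans (add_le_add g1 g2)
  have hcauchy : CauchySeq a := by
    rw [Metric.cauchySeq_iff]
    intro ε hε'
    obtain ⟨M, hM⟩ := eventually_atTop.1 (hlim.eventually (gt_mem_nhds (half_pos hε')))
    refine ⟨M, fun m hm m' hm' => ?_⟩
    rw [Real.dist_eq]
    linarith [hdist m m', hM m hm, hM m' hm']
  obtain ⟨v, hv⟩ := cauchySeq_tendsto_of_complete hcauchy
  have hav : ∀ m, |a m - v| ≤ 1 / ((m : ℝ) + 1) := by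
    intro m
    have h1 : Tendsto (fun m' => |a m - a m'|) atTop (𝓝 |a m - v|) :=
      (tendsto_const_nhds.sub hv).abs
    have h2 : Tendsto (fun m' : ℕ => 1 / ((m : ℝ) + 1) + 1 / ((m' : ℝ) + 1)) atTop
        (𝓝 (1 / ((m : ℝ) + 1) + 0)) := tendsto_const_nhds.add hlim
    rw [add_zero] at h2
    exact le_of_tendsto_of_tendsto' h1 h2 (hdist m)
  refine ⟨v, ?_⟩
  filter_upwards [hall] with ω hω
  rw [Metric.tendsto_atTop]
  intro ε hε'
  obtain ⟨m, hm⟩ := (hlim.eventually (gt_mem_nhds (half_pos hε'))).exists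
  obtain ⟨n₀, hn₀⟩ := eventually_atTop.1 ((hω m).and (eventually_gt_atTop 0))
  refine ⟨n₀, fun n hn => ?_⟩
  obtain ⟨h1, h2⟩ := hn₀ n hn
  rw [Real.dist_eq]
  have := abs_sub_le ((n : ℝ)⁻¹ * x n ω) (a m) v
  linarith [hdiv ω m n h2 h1, hav m]

variable {d : ℕ} {l : Site d} {ζ : ℝ} {L : ℕ}

lemma norm_toReal_pos (hl : l ≠ 0) : 0 < ‖toReal l‖ := by
  rw [norm_pos_iff]
  intro h
  refine hl (funext fun i => ?_)
  have : (toReal l) i = 0 := by rw [h]; rfl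
  exact_mod_cast (show ((l i : ℤ) : ℝ) = 0 from this)

/-- The mixing rate is nonnegative, as it bounds the correlation of two sure events. -/
lemma mixing_nonneg (P : Measure (Env d)) [IsProbabilityMeasure P] (hl : l ≠ 0) {φ : ℝ → ℝ}
    (h : ConeMixing P l ζ φ) {t : ℝ} (ht : 0 < t) : 0 ≤ φ t := by
  have hn := norm_toReal_pos hl
  have := h.2 (t / ‖toReal l‖) (by positivity) Set.univ Set.univ (by simp)
    MeasurableSet.univ MeasurableSet.univ
  rw [div_mul_cancel₀ _ hn.ne'] at this
  exact (abs_nonneg _).trans this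

/-- The moment hypothesis, carried over to the times between regenerations given the history.  The
exponent is lowered to `min α 2`, which is harmless as these times are at least one. -/
lemma exists_moment_bound (P : Measure (Env d)) [IsProbabilityMeasure P]
    (hP : ∀ x : Site d, MeasurePreserving (shift x) P P) (hl : l ≠ 0) (hL : 0 < L) (hζ : 0 ≤ ζ)
    {κ : ℝ} (hκ : 0 < κ) (hD : extAnnealed P l κ (neverExits l ζ) ≠ 0)
    (hreg : ∀ᵐ p ∂(extAnnealed P l κ), p ∈ regenerates l ζ L) {α M : ℝ} (hα : 1 < α)
    (hmom : ∀ᵐ p ∂(cond (extAnnealed P l κ) (neverExits l ζ)),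
      condLExp (calF l L) (cond (extAnnealed P l κ) (neverExits l ζ))
        (fun q => (ENNReal.ofReal κ ^ L * (tau l ζ L 1 q : ℝ≥0∞)) ^ α) p ≤ ENNReal.ofReal M) :
    ∃ α' M' : ℝ, 1 < α' ∧ α' ≤ 2 ∧ 0 ≤ M' ∧
      ∀ k A, MeasurableSet[historyFiltration l hζ hL k] A →
        ∫⁻ p in A, ENNReal.ofReal (((regTime l ζ L (k + 1) p : ℝ) - regTime l ζ L k p) ^ α')
          ∂(extAnnealed P l κ) ≤ ENNReal.ofReal M' * extAnnealed P l κ A := by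
  set f : Walk l → ℝ≥0∞ := fun z => (ENNReal.ofReal κ ^ L * (walkTau l ζ L 1 z : ℝ≥0∞)) ^ α with hf
  have hfm : Measurable f := by
    have h1 : Measurable fun z : Walk l => (walkTau l ζ L 1 z : ℝ≥0∞) :=
      (measurable_of_countable fun t : ℕ∞ => (t : ℝ≥0∞)).comp (measurable_walkTau 1)
    exact (h1.const_mul _).pow_const α
  have hM : ∀ᵐ p ∂(cond (extAnnealed P l κ) (neverExits l ζ)),
      condLExp (calF l L) (cond (extAnnealed P l κ) (neverExits l ζ)) (fun q => f (toWalk q)) p ≤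
        ENNReal.ofReal M := by
    have e : (fun q : Space l => f (toWalk q)) =
        fun q => (ENNReal.ofReal κ ^ L * (tau l ζ L 1 q : ℝ≥0∞)) ^ α := by
      funext q; simp only [hf, tau_eq]
    rw [e]; exact hmom
  have hC := lintegral_mul_le_of_condLExp_le P κ hD hfm hM
  set b : ℝ := κ ^ L with hb
  have hb0 : 0 < b := pow_pos hκ L
  refine ⟨min α 2, (b ^ α)⁻¹ * max M 0, lt_min hα one_lt_two, min_le_right _ _, by positivity,
    fun k A hA => ?_⟩
  have hle : ∀ᵐ p ∂(extAnnealed P l κ), ENNReal.ofReal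
      (((regTime l ζ L (k + 1) p : ℝ) - regTime l ζ L k p) ^ (min α 2)) ≤
        ENNReal.ofReal (b ^ α)⁻¹ * f (recenter (regTime l ζ L k p) (toWalk p)) := by
    filter_upwards [hreg] with p hp
    have hlt : regTime l ζ L k p < regTime l ζ L (k + 1) p :=
      strictMono_regTime hL p (Nat.lt_succ_self k)
    obtain ⟨m, hm⟩ := Nat.exists_eq_add_of_lt hlt
    have hξ : (regTime l ζ L (k + 1) p : ℝ) - regTime l ζ L k p = ((m + 1 : ℕ) : ℝ) := by
      rw [hm]; push_cast; ring
    have ht : walkTau l ζ L 1 (recenter (regTime l ζ L k p) (toWalk p)) = ((m + 1 : ℕ) : ℕ∞) := by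
      have h1 : walkTau l ζ L (k + 1) (toWalk p) = (regTime l ζ L k p : ℕ∞) := by
        unfold regTime
        rw [if_pos hp, ← tau_eq]; exact tau_eq_toNat hp _
      have h2 : walkTau l ζ L (k + 1 + 1) (toWalk p) = (regTime l ζ L (k + 1) p : ℕ∞) := by
        unfold regTime
        rw [if_pos hp, ← tau_eq]; exact tau_eq_toNat hp _
      obtain ⟨m', hm', h3, h4⟩ := walkTau_succ_eq_coe.1 h2
      obtain rfl : m' = regTime l ζ L k p := by rw [h1] at h3; exact_mod_cast h3.symm
      refine walkTau_succ_eq_coe.2 ⟨0, Nat.zero_le _, rfl, ?_⟩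
      have e : recenter 0 (recenter (regTime l ζ L k p) (toWalk p)) =
          recenter (regTime l ζ L k p) (toWalk p) := by
        unfold recenter
        simp
      rw [e, h4, hm]
      congr 1
      omega
    have hm1 : (1 : ℝ) ≤ ((m + 1 : ℕ) : ℝ) := by exact_mod_cast Nat.succ_pos m
    have hm0 : (0 : ℝ) < ((m + 1 : ℕ) : ℝ) := by positivity
    have hfv : f (recenter (regTime l ζ L k p) (toWalk p)) =
        ENNReal.ofReal (b ^ α * ((m + 1 : ℕ) : ℝ) ^ α) := by
      simp only [hf, ht]
      rw [← ENNReal.ofReal_pow hκ.le, ← hb, ← Real.mul_rpow hb0.le hm0.le,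
        ← ENNReal.ofReal_rpow_of_pos (mul_pos hb0 hm0), ENNReal.ofReal_mul hb0.le,
        ENNReal.ofReal_natCast]
      rfl
    rw [hfv, ← ENNReal.ofReal_mul (by positivity), hξ]
    refine ENNReal.ofReal_le_ofReal ?_
    have hbα : b ^ α ≠ 0 := (Real.rpow_pos_of_pos hb0 α).ne'
    rw [inv_mul_cancel_left₀ hbα]
    exact Real.rpow_le_rpow_of_exponent_le hm1 (min_le_left _ _)
  calc _ ≤ ∫⁻ p in A, ENNReal.ofReal (b ^ α)⁻¹ * f (recenter (regTime l ζ L k p) (toWalk p))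
          ∂(extAnnealed P l κ) := lintegral_mono_ae (ae_restrict_of_ae hle)
    _ = ENNReal.ofReal (b ^ α)⁻¹ * ∫⁻ p in A, f (recenter (regTime l ζ L k p) (toWalk p))
          ∂(extAnnealed P l κ) := lintegral_const_mul' _ _ ENNReal.ofReal_ne_top
    _ ≤ ENNReal.ofReal (b ^ α)⁻¹ * (ENNReal.ofReal M * extAnnealed P l κ A) := by
        gcongr
        exact lintegral_history_le P hP hl hL hζ κ hreg hfm _ hC k hA
    _ = _ := by
        rw [ENNReal.ofReal_mul (by positivity), ENNReal.ofReal_max, ENNReal.ofReal_zero,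
          max_eq_left zero_le, mul_assoc]

/-- For a fixed `L`, the coordinates of the walk have a nearly constant speed, up to an error
proportional to the distance to renewal. -/
lemma exists_approx_speed (P : Measure (Env d)) [IsProbabilityMeasure P] (hL : 0 < L) (hζ : 0 ≤ ζ)
    {κ : ℝ} (hD : extAnnealed P l κ (neverExits l ζ) ≠ 0)
    (hreg : ∀ᵐ p ∂(extAnnealed P l κ), p ∈ regenerates l ζ L) {c : ℝ} (hc : 0 ≤ c)
    (hR : ∀ k, ∀ᵐ p ∂(extAnnealed P l κ),
      varDist ((condExpKernel (extAnnealed P l κ) (calH l ζ L (k + 1)) p).map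
        (pathAfter l ζ L (k + 1))) (confinedPathLaw P l κ ζ) ≤ c)
    {α M : ℝ} (hα : 1 < α) (hα2 : α ≤ 2) (hM : 0 ≤ M)
    (hmom : ∀ k A, MeasurableSet[historyFiltration l hζ hL k] A →
      ∫⁻ p in A, ENNReal.ofReal (((regTime l ζ L (k + 1) p : ℝ) - regTime l ζ L k p) ^ α)
        ∂(extAnnealed P l κ) ≤ ENNReal.ofReal M * extAnnealed P l κ A)
    (i : Fin d) {η : ℝ} (hη : 0 < η) :
    ∃ a : ℝ, ∀ᵐ p ∂(extAnnealed P l κ), ∀ᶠ n : ℕ in atTop,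
      |((p.2 n i : ℤ) : ℝ) - a * n| ≤ (2 * c + η) * n := by
  -- first the truncation level `B`, then a window length `N` much larger than `B`
  obtain ⟨B, hB, hBδ⟩ : ∃ B : ℝ, 0 < B ∧ M * B ^ (1 - α) < η / 12 := by
    have h1 : Tendsto (fun B : ℝ => M * B ^ (-(α - 1))) atTop (𝓝 (M * 0)) :=
      (tendsto_rpow_neg_atTop (by linarith)).const_mul M
    rw [mul_zero] at h1
    obtain ⟨B, h2, h3⟩ := ((h1.eventually (gt_mem_nhds (by positivity : 0 < η / 12))).and
      (eventually_gt_atTop 0)).exists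
    exact ⟨B, h3, by rwa [neg_sub] at h2⟩
  obtain ⟨N, hNB⟩ := exists_nat_gt (4 * B / η)
  have hN' : (0 : ℝ) < N := lt_of_le_of_lt (by positivity) hNB
  have hN : 0 < N := by exact_mod_cast hN'
  have hBN : 2 * B / N ≤ η / 2 := by
    rw [div_lt_iff₀ hη] at hNB
    rw [div_le_iff₀ hN']
    linarith
  refine ⟨windowSpeed P l κ ζ N i, ?_⟩
  have hstep := ae_abs_step_le (l := l) P κ
  have key := ae_eventually_abs_sub_le (μ := extAnnealed P l κ) (historyFiltration l hζ hL)
    (T := regTime l ζ L) (strictMono_regTime hL) (measurable_regTime hζ hL) hN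
    (Z := fun k => window l ζ L k N i) (fun k => (measurable_window hζ hL k N i).stronglyMeasurable)
    (fun k p => abs_window_le k N i p) (x := fun n p => ((p.2 n i : ℤ) : ℝ))
    (hstep.mono fun p hp n => hp n i)
    (by
      filter_upwards [hstep, hreg] with p h1 h2 k
      exact window_eq h2 fun n => h1 n i)
    (c := windowSpeed P l κ ζ N i) (ρ := 2 * c) (abs_windowSpeed_le P κ hD N i) (by positivity)
    (fun k A hA => abs_integral_window_sub_le P κ hD hζ hL hreg k hc (hR k) hN i hA)
    hα hα2 hM hmom hB hBδ
  filter_upwards [key] with p hp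
  filter_upwards [hp] with n hn
  refine hn.trans (mul_le_mul_of_nonneg_right ?_ (Nat.cast_nonneg n))
  linarith

/-- Each regeneration time is a strict record, and `X·ℓ` is an integer. -/
lemma dotProduct_regTime_ge (hl : l ≠ 0) (hL : 0 < L) {p : Space l}
    (hp : p ∈ regenerates l ζ L) (ho : ∀ n, Obeys n (toWalk p)) (k : ℕ) :
    p.2 (regTime l ζ L 0 p) ⬝ᵥ l + k ≤ p.2 (regTime l ζ L k p) ⬝ᵥ l := by
  induction k with
  | zero => simp
  | succ k ih =>
    have h2 : walkTau l ζ L (k + 1 + 1) (toWalk p) = (regTime l ζ L (k + 1) p : ℕ∞) := by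
      unfold regTime
      rw [if_pos hp, ← tau_eq]; exact tau_eq_toNat hp _
    have h3 := (walkTau_record hl hL (k + 1) (ho _) h2).2.2.2 _
      (strictMono_regTime hL p (Nat.lt_succ_self k))
    have h4 : p.2 (regTime l ζ L k p) ⬝ᵥ l < p.2 (regTime l ζ L (k + 1) p) ⬝ᵥ l := h3
    push_cast
    omega

/-- If the regeneration times grow at most linearly, the walk is ballistic in direction `ℓ`. -/
lemma speed_pos (hl : l ≠ 0) (hL : 0 < L) {p : Space l}
    (hp : p ∈ regenerates l ζ L) (ho : ∀ n, Obeys n (toWalk p)) {C : ℝ} (hC : 0 < C)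
    (hT : ∀ᶠ k : ℕ in atTop, (regTime l ζ L k p : ℝ) ≤ C * k) {u : ℝ}
    (hu : Tendsto (fun n : ℕ => (n : ℝ)⁻¹ * ((p.2 n ⬝ᵥ l : ℤ) : ℝ)) atTop (𝓝 u)) : 0 < u := by
  have hTt : Tendsto (fun k => regTime l ζ L k p) atTop atTop :=
    (strictMono_regTime hL p).tendsto_atTop
  have h1 := hu.comp hTt
  set s : ℤ := p.2 (regTime l ζ L 0 p) ⬝ᵥ l with hs
  have hlarge : ∀ᶠ k : ℕ in atTop, -2 * (s : ℝ) ≤ k :=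
    tendsto_natCast_atTop_atTop.eventually_ge_atTop _
  -- along the regeneration times `X·ℓ` is at least `s + k ≥ k / 2`
  have h2 : ∀ᶠ k : ℕ in atTop, (2 * C)⁻¹ ≤
      ((fun n : ℕ => (n : ℝ)⁻¹ * ((p.2 n ⬝ᵥ l : ℤ) : ℝ)) ∘ fun k => regTime l ζ L k p) k := by
    filter_upwards [hT, hlarge, eventually_gt_atTop 0] with k g1 g2 g3
    have g4 := dotProduct_regTime_ge hl hL hp ho k
    rw [← hs] at g4
    have g4' : (s : ℝ) + k ≤ ((p.2 (regTime l ζ L k p) ⬝ᵥ l : ℤ) : ℝ) := by exact_mod_cast g4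
    have hk : (0 : ℝ) < k := by exact_mod_cast g3
    have hTk : (0 : ℝ) < regTime l ζ L k p :=
      hk.trans_le (by exact_mod_cast (strictMono_regTime hL p).id_le k)
    change (2 * C)⁻¹ ≤ (regTime l ζ L k p : ℝ)⁻¹ * _
    rw [le_inv_mul_iff₀ hTk, ← div_eq_mul_inv, div_le_iff₀ (by positivity)]
    nlinarith
  exact lt_of_lt_of_le (by positivity) (ge_of_tendsto h1 h2)

end Speed

end

end RWRE

open RWRE in
theorem mainTheorem1 (d : ℕ) (P : MeasureTheory.Measure (RWRE.Env d))
    [MeasureTheory.IsProbabilityMeasure P]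
    (l : RWRE.Site d) (hl : l ≠ 0)
    (κ ζ : ℝ) (φ : ℝ → ℝ)
    (hκ : 0 < κ) (hζ0 : 0 < ζ) (hζ1 : ζ < 1)
    (hcone : RWRE.StaysInCone l ζ)
    (hP : RWRE.StationaryErgodic P)
    (hmix : RWRE.ConeMixing P l ζ φ)
    (hell : RWRE.Elliptic P l κ)
    (hrenewal : RWRE.ApproxRenewal P l κ ζ φ)
    (hmoment : RWRE.MomentCondition P l κ ζ φ) :
    ∃ v : EuclideanSpace ℝ (Fin d), 0 < inner ℝ v (RWRE.toReal l) ∧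
      ∀ᵐ p ∂(RWRE.annealed P),
        Filter.Tendsto (fun n : ℕ => (n : ℝ)⁻¹ • RWRE.toReal (p.2 n)) Filter.atTop (nhds v) := by
  obtain ⟨α, M, hα, -, hmom⟩ := hmoment
  have hl1 := RWRE.normOne_pos hl
  have hζ : 0 ≤ ζ := hζ0.le
  -- what holds for all large multiples of `|ℓ|₁`
  have hL : ∀ᶠ j : ℕ in atTop, 0 < j * normOne l ∧ 0 ≤ φ ((j * normOne l : ℕ) : ℝ) ∧
      φ ((j * normOne l : ℕ) : ℝ) < (extAnnealed P l κ).real (neverExits l ζ) ∧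
      (∀ᵐ p ∂(extAnnealed P l κ), p ∈ regenerates l ζ (j * normOne l)) ∧
      (∀ k, ∀ᵐ p ∂(extAnnealed P l κ),
        varDist ((condExpKernel (extAnnealed P l κ) (calH l ζ (j * normOne l) (k + 1)) p).map
          (pathAfter l ζ (j * normOne l) (k + 1))) (confinedPathLaw P l κ ζ) ≤
          phiPrime P l κ ζ φ (j * normOne l)) ∧
      ∀ᵐ p ∂(cond (extAnnealed P l κ) (neverExits l ζ)),
        condLExp (calF l (j * normOne l)) (cond (extAnnealed P l κ) (neverExits l ζ))
          (fun q => (ENNReal.ofReal κ ^ (j * normOne l) *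
            (tau l ζ (j * normOne l) 1 q : ENNReal)) ^ α) p ≤ ENNReal.ofReal (M (j * normOne l)) := by
    filter_upwards [hrenewal, hmom, eventually_gt_atTop 0] with j h1 h2 h3
    obtain ⟨g1, g2⟩ := h1 _ rfl
    have hpos : 0 < j * normOne l := Nat.mul_pos h3 hl1
    refine ⟨hpos, mixing_nonneg P hl hmix (by exact_mod_cast hpos), g1, ?_,
      fun k => (g2 (k + 1) (Nat.succ_pos k)).2, h2 _ rfl⟩
    have := ae_all_iff.2 fun k : ℕ => (g2 (k + 1) (Nat.succ_pos k)).1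
    filter_upwards [this] with p hp k
    cases k with
    | zero => exact ENat.natCast_lt_top 0
    | succ k => exact hp k
  have hpD : 0 < (extAnnealed P l κ).real (neverExits l ζ) := by
    obtain ⟨j, hj⟩ := hL.exists
    exact hj.2.1.trans_lt hj.2.2.1
  have hD : extAnnealed P l κ (neverExits l ζ) ≠ 0 := fun h => by
    rw [Measure.real, h] at hpD
    exact lt_irrefl _ hpD
  have hφ' : Tendsto (fun j : ℕ => phiPrime P l κ ζ φ (j * normOne l)) atTop (𝓝 0) := by
    have h1 : Tendsto (fun j : ℕ => ((j * normOne l : ℕ) : ℝ)) atTop atTop :=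
      tendsto_natCast_atTop_atTop.comp (tendsto_id.atTop_mul_const' hl1)
    have h2 := hmix.1.comp h1
    have h3 := ((tendsto_const_nhds (x := (extAnnealed P l κ).real (neverExits l ζ))).sub h2).inv₀
      (by rw [sub_zero]; exact hpD.ne')
    have h4 := (h3.const_mul 2).mul h2
    rw [mul_zero] at h4
    exact h4
  -- each coordinate has a speed: apply the approximation with `L` large enough for the precision
  have hcoord : ∀ i : Fin d, ∃ v : ℝ, ∀ᵐ p ∂(extAnnealed P l κ),
      Tendsto (fun n : ℕ => (n : ℝ)⁻¹ * ((p.2 n i : ℤ) : ℝ)) atTop (𝓝 v) := by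
    intro i
    refine exists_tendsto_of_approx (μ := extAnnealed P l κ)
      (x := fun n p => ((p.2 n i : ℤ) : ℝ)) fun ε hε => ?_
    obtain ⟨j, ⟨g1, g2, g3, g4, g5, g6⟩, g7⟩ :=
      (hL.and (hφ'.eventually (gt_mem_nhds (by positivity : 0 < ε / 4)))).exists
    obtain ⟨α', M', hα', hα2', hM', hmom'⟩ := exists_moment_bound P hP.1 hl g1 hζ hκ hD g4 hα g6
    have hc : 0 ≤ phiPrime P l κ ζ φ (j * normOne l) :=
      mul_nonneg (mul_nonneg zero_le_two (inv_nonneg.2 (sub_nonneg.2 g3.le))) g2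
    obtain ⟨a, ha⟩ := exists_approx_speed P g1 hζ hD g4 hc g5 hα' hα2' hM' hmom' i
      (half_pos hε)
    refine ⟨a, ha.mono fun p hp => hp.mono fun n hn => hn.trans ?_⟩
    refine mul_le_mul_of_nonneg_right ?_ (Nat.cast_nonneg n)
    linarith
  choose w hw using hcoord
  have hwall := ae_all_iff.2 hw
  set v : EuclideanSpace ℝ (Fin d) := WithLp.toLp 2 w with hv
  have hlim : ∀ᵐ p ∂(extAnnealed P l κ),
      Tendsto (fun n : ℕ => (n : ℝ)⁻¹ • toReal (p.2 n)) atTop (𝓝 v) := by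
    filter_upwards [hwall] with p hp
    have h1 : Tendsto (fun n : ℕ => fun i => (n : ℝ)⁻¹ * ((p.2 n i : ℤ) : ℝ)) atTop (𝓝 w) :=
      tendsto_pi_nhds.2 hp
    exact ((PiLp.continuous_toLp 2 (fun _ : Fin d => ℝ)).tendsto w).comp h1
  refine ⟨v, ?_, ?_⟩
  -- a single `L` suffices for the ballistic direction
  · obtain ⟨j, g1, g2, g3, g4, g5, g6⟩ := hL.exists
    obtain ⟨α', M', hα', hα2', hM', hmom'⟩ := exists_moment_bound P hP.1 hl g1 hζ hκ hD g4 hα g6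
    have hlin := ae_eventually_le_mul (μ := extAnnealed P l κ) (historyFiltration l hζ g1)
      (T := regTime l ζ (j * normOne l)) (strictMono_regTime g1) (measurable_regTime hζ g1)
      hα' hα2' hM' hmom'
    obtain ⟨p, h1, h2, h3, h4⟩ :=
      (hlim.and (hlin.and ((ae_obeys (l := l) P κ).and g4))).exists
    refine speed_pos hl g1 h4 h3 (by linarith : 0 < M' + 3) h2 ?_
    have h5 := Filter.Tendsto.inner (𝕜 := ℝ) h1 (tendsto_const_nhds (x := toReal l))
    refine h5.congr fun n => ?_
    rw [inner_smul_left, inner_toReal]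
    simp
  · refine ae_annealed_of_ae_extAnnealed (l := l) P hl hκ.le hP.1 hell
      (p := fun X => Tendsto (fun n : ℕ => (n : ℝ)⁻¹ • toReal (X n)) atTop (𝓝 v)) ?_ hlim
    refine measurableSet_tendsto (𝓝 v) fun n => ?_
    exact (measurable_of_countable fun x : Site d => (n : ℝ)⁻¹ • toReal x).comp
      (measurable_pi_apply n)
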